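/- For each $n$ let $y=\mu+z$ with $\mu\in\mathbb R^n$, $z\sim N_n(0,I)$, and write $P_\mu,E_\mu$ for the law of $y$ and its expectation. Let $\Theta_n\subset\mathbb R^n$ be one of - $\ell_0[\eta_n]=\{\mu:\ \#\{i:\mu_i\ne0\}\le \eta_n n\}$, - $\ell_p[\eta_n]=\{\mu:\ \frac1n\sum_{i=1}^n|\mu_i|^p\le\eta_n^p\}$ with $0<p<2$ (strong $\ell_p$), - $m_p[\eta_n]=\{\mu:\ |\mu|_{(k)}\le\eta_n n^{1/p}k^{-1/p},\ k=1,\dots,n\}$ with $0<p<2$ (weak $\ell_p$), where $|\mu|_{(1)}\ge\dots\ge|\mu|_{(n)}$ are the ordered magnitudes of the components of $\mu$, with $p$ fixed and the kind of class the same for all $n$, and let $R_n(\Theta_n)=\inf_{\hat\mu}\sup_{\mu\in\Theta_n}E_\mu\|\hat\mu(y)-\mu\|_2^2$ be the minimax risk, the infimum being over all measurable functions $\hat\mu$ of $y$. Assume - (Q) $q_n\to q\in[0,1)$ and, if $q=0$, there is $b_1>0$ with $q_n\ge b_1/\log n$ for all large $n$; - (H) $\eta_n\ge 0$, and there are $b_2,b_3>0$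 such that for all large $n$ the number $\eta_n$ (for $\ell_0$), respectively $\eta_n^p$ (for $\ell_p$ and $m_p$), lies in $[n^{-1}\log^5n,\ b_2n^{-b_3}]$. Let $t_l=z\big(\tfrac{q_n}{2}\cdot\tfrac ln\big)$, where $z(\alpha)$ is the upper $\alpha$-quantile of $N(0,1)$, let $\mathrm{Pen}(\mu)=\sum_{l=1}^{\|\mu\|_0}t_l^2$ with $\|\mu\|_0=\#\{i:\mu_i\neq0\}$, and let the penalized FDR estimator $\hat\mu_2$ be a measurable function of $y$ whose value is a global minimizer of $\tilde\mu\mapsto\|y-\tilde\mu\|_2^2+\mathrm{Pen}(\tilde\mu)$. Put $$\mathrm{Err}_2(\mu,\hat\mu_2)=2E_\mu\langle z,\hat\mu_2-\mu\rangle-E_\mu\mathrm{Pen}(\hat\mu_2).$$ Let $u_{2p}=1$ for $\ell_0$ and for strong $\ell_p$, and $u_{2p}=1-p/2$ for weak $\ell_p$. Then, for all large $n$, $\mathrm{Err}_2(\cdot,\hat\mu_2)$ is bounded above on $\Theta_n$, and as $n\to\infty$ $$\sup_{\mu\in\Theta_n}\mathrm{Err}_2(\mu,\hat\mu_2)=\begin{cases}R_n(\Theta_n)\cdot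 u_{2p}\cdot\dfrac{2q-1}{1-q}\,(1+o(1)), & q>1/2,\\[2mm] o(R_n(\Theta_n)), & q\le1/2.\end{cases}$$ -/

import Mathlib

open MeasureTheory ProbabilityTheory Filter Asymptotics
open scoped ENNReal

noncomputable section

/-! ### The Gaussian shift model and Gaussian quantiles -/

/-- The law `P_μ` of `y ∼ N_n(μ, I)`. -/
def gaussShift {n : ℕ} (μ : Fin n → ℝ) : Measure (Fin n → ℝ) :=
  Measure.pi fun i => gaussianReal (μ i) 1

/-- The upper tail `P(Z > t)` of a standard normal variable. -/
def gaussTail (t : ℝ) : ℝ := (gaussianReal 0 1).real (Set.Ioi t)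

/-- The upper Gaussian quantile: for `0 < α < 1` it is the unique `t` with `P(Z > t) = α`. -/
def upperQuantile (α : ℝ) : ℝ := sInf {t : ℝ | gaussTail t ≤ α}

/-- The FDR boundary `t_l = z((q / 2) (l / n))`. -/
def fdrBoundary (n : ℕ) (q : ℝ) (l : ℕ) : ℝ := upperQuantile (q / 2 * (l / n))

/-! ### The penalized FDR estimator -/

/-- `Pen(x) = ∑_{l=1}^{‖x‖₀} t_l²`; `hammingNorm x` is the number of nonzero entries of `x`. -/
def fdrPen {n : ℕ} (q : ℝ) (x : Fin n → ℝ) : ℝ :=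
  ∑ l ∈ Finset.Icc 1 (hammingNorm x), fdrBoundary n q l ^ 2

/-- The complexity `K(x, y) = ‖y - x‖₂² + Pen(x)`. -/
def complexity {n : ℕ} (q : ℝ) (x y : Fin n → ℝ) : ℝ :=
  ∑ i, (y i - x i) ^ 2 + fdrPen q x

/-- `m` is (a version of) the penalized FDR estimator `μ̂₂`: a measurable function of the data
whose value at every `y` is a global minimizer of `x ↦ K(x, y)`. -/
structure IsPenalizedFDR {n : ℕ} (q : ℝ) (m : (Fin n → ℝ) → Fin n → ℝ) : Prop where
  measurable : Measurable m
  minimizes : ∀ y x, complexity q (m y) y ≤ complexity q x y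

/-- `Err₂(μ, m) = 2 E_μ⟨z, m(y) - μ⟩ - E_μ Pen(m(y))`, where `z = y - μ`. -/
def err₂ {n : ℕ} (q : ℝ) (m : (Fin n → ℝ) → Fin n → ℝ) (μ : Fin n → ℝ) : ℝ :=
  2 * ∫ y, ∑ i, (y i - μ i) * (m y i - μ i) ∂gaussShift μ
    - ∫ y, fdrPen q (m y) ∂gaussShift μ

/-! ### Minimax risk -/

/-- The squared-error risk `E_μ ‖m(y) - μ‖₂²`, as an extended nonnegative number. -/
def sqRisk {n : ℕ} (m : (Fin n → ℝ) → Fin n → ℝ) (μ : Fin n → ℝ) : ℝ≥0∞ :=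
  ∫⁻ y, ENNReal.ofReal (∑ i, (m y i - μ i) ^ 2) ∂gaussShift μ

/-- The minimax risk over `Θ`: the infimum over all estimators (measurable functions of the data)
of the worst-case risk. It is at most `n`, the risk of `m(y) = y`, hence finite. -/
def minimaxSqRisk {n : ℕ} (Θ : Set (Fin n → ℝ)) : ℝ :=
  (⨅ (m : (Fin n → ℝ) → Fin n → ℝ) (_ : Measurable m), ⨆ μ ∈ Θ, sqRisk m μ).toReal

/-! ### Sparse parameter spaces -/

/-- The decreasing rearrangement of the amplitudes: `absRearr μ k` is `|μ|_{(k+1)}`. -/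
def absRearr {n : ℕ} (μ : Fin n → ℝ) (k : Fin n) : ℝ :=
  |μ (Tuple.sort (fun i => -|μ i|) k)|

/-- The three kinds of sparsity classes. -/
inductive SparsityClass where
  /-- nearly black vectors, `ℓ₀` -/
  | nearlyBlack
  /-- strong `ℓ_p` balls -/
  | strong (p : ℝ)
  /-- weak `ℓ_p` balls -/
  | weak (p : ℝ)

namespace SparsityClass

/-- The admissible exponents are `0 < p < 2`. -/
def Admissible : SparsityClass → Prop
  | nearlyBlack => True
  | strong p => 0 < p ∧ p < 2
  | weak p => 0 < p ∧ p < 2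

/-- The parameter spaces `ℓ₀[η]`, `ℓ_p[η]` and `m_p[η]` in `ℝⁿ`. -/
def ball (c : SparsityClass) (n : ℕ) (η : ℝ) : Set (Fin n → ℝ) :=
  match c with
  | nearlyBlack => {μ | (hammingNorm μ : ℝ) ≤ η * n}
  | strong p => {μ | 1 / (n : ℝ) * ∑ i, |μ i| ^ p ≤ η ^ p}
  | weak p => {μ | ∀ k : Fin n,
      absRearr μ k ≤ η * (n : ℝ) ^ (1 / p) * ((k : ℝ) + 1) ^ (-(1 / p))}

/-- The normalized radius on which sparsity is measured: `η` for `ℓ₀`, `η ^ p` otherwise. -/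
def sparsity (c : SparsityClass) (η : ℝ) : ℝ :=
  match c with
  | nearlyBlack => η
  | strong p => η ^ p
  | weak p => η ^ p

/-- The constant `u_{2p}`. -/
def u : SparsityClass → ℝ
  | nearlyBlack => 1
  | strong _ => 1
  | weak p => 1 - p / 2

end SparsityClass

/-! ### Standing assumptions -/

/-- Assumption (Q) on the false discovery control parameters `q_n` with limit `q`. -/
def AssumptionQ (qs : ℕ → ℝ) (q : ℝ) : Prop :=
  q ∈ Set.Ico (0 : ℝ) 1 ∧ Tendsto qs atTop (nhds q) ∧
    (q = 0 → ∃ b₁ : ℝ, 0 < b₁ ∧ ∀ᶠ n : ℕ in atTop, b₁ / Real.log n ≤ qs n)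

/-- Assumption (H): the sparsity lies in `[n⁻¹ log⁵ n, b₂ n^{-b₃}]`. -/
def AssumptionH (c : SparsityClass) (η : ℕ → ℝ) : Prop :=
  (∀ n, 0 ≤ η n) ∧ ∃ b₂ b₃ : ℝ, 0 < b₂ ∧ 0 < b₃ ∧ ∀ᶠ n : ℕ in atTop,
    c.sparsity (η n) ∈ Set.Icc ((n : ℝ)⁻¹ * Real.log n ^ 5) (b₂ * (n : ℝ) ^ (-b₃))

end

noncomputable section

/-! ### Gaussian integrals and tails -/

/-! Let ν be the sparsity, τ = (2 log(1/ν))^{1/2} and κ = n ν τ^{-p}, with p = 0 for nearly black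
vectors. A worst-case member of the class looks like about κ spikes of height near τ. The unit of
measurement is κτ², and the minimax risk is (1 + o(1)) κτ²/u.

The estimator is a hard threshold rule: with k the size of its support, every kept coordinate has
|y_i| ≥ t_k and every discarded one has |y_i| ≤ t_{k+1}. The boundary is calibrated so that n pure
noise coordinates produce on average q l exceedances of t_l (`two_tail_thr`). Passing from rank l to
rank l + 1 therefore admits q noise values of squared size about t_l², so the expected noise energy
above t_k is q(t_1² + ... + t_k²), that is q Pen, up to the energy above t_1, which is O(τ²)
(`penSum_le_noiseEnergy`, `noiseEnergy_le_penSum`). Up to o(κτ²) the cross term ⟨z, μ̂₂ - μ⟩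
consists of the z² of the kept noise. Hence Err₂ ≤ (2q - 1) E Pen + o(κτ²) uniformly on the class
(`SparseRegime.eventually_err₂_le`), with the reverse inequality at sparse spike vectors
(`SparseRegime.eventually_le_err₂`).

Counting instead of summing energies gives the self-bounding inequality k ≤ κ + qk + o(κ) on
average, so E Pen ≤ (1/(1 - q) + o(1)) κτ². If q ≤ 1/2 the positive part of 2q - 1 vanishes and the
supremum is at most o(κτ²); it is nonnegative because Err₂ ≥ 0 at the origin. If q > 1/2, about κ
spikes slightly above τ are almost all kept, so k is close to κ + qk and the upper bound is
attained.

Two difficulties are handled on the way. First, k is random: it is sandwiched in a geometric grid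
with O(log n) = O(τ²) points, and at each point the expected excess of a fluctuation over a small
allowance is bounded by a variance (`integral_deviation_le`). The total is a power of τ, negligible
because (H) forces κ ≥ τ⁸/32. Second, most coordinates may be nonzero but small: by symmetrising the
shift, a mean m changes tail counts and energies only to order m², with an exponentially small
factor as long as |m| stays below (1 - ε)τ (`tailCount_le`, `tailMeanSq_le`, `tailQuartic_le`). The
coordinates above a fixed fraction of τ number O(κ) and contribute O(κτ) to the cross term.

The minimax risk is bounded above by soft thresholding just above τ, and below by independent blocks
with one spike at a random position, of height below τ, through a truncated second moment argument
(`minimaxSqRisk_ge`). The constant 1/u for weak balls is the energy of the extremal sequence cut at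
τ: a plateau of κ ranks plus its power tail. -/

theorem integrable_polynomial_gaussianReal (m : ℝ) (P : Polynomial ℝ) :
    Integrable (fun y => P.eval y) (gaussianReal m 1) := by
  induction P using Polynomial.induction_on' with
  | add p q hp hq => simp only [Polynomial.eval_add]; exact hp.add hq
  | monomial k a =>
    simp only [Polynomial.eval_monomial]
    refine Integrable.const_mul ?_ a
    have := (memLp_id_gaussianReal (μ := m) (v := 1) (k : NNReal))
    have h2 := this.integrable_norm_pow' (f := (id : ℝ → ℝ)) (p := k)
    have h3 : Integrable (fun y : ℝ => ‖y‖ ^ k) (gaussianReal m 1) := by simpa using h2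
    refine h3.mono' (by fun_prop) (ae_of_all _ fun y => by simp)

theorem integrable_pow_gaussianReal (m : ℝ) (k : ℕ) :
    Integrable (fun y : ℝ => y ^ k) (gaussianReal m 1) := by
  simpa using integrable_polynomial_gaussianReal m (Polynomial.X ^ k)

theorem integral_gaussianReal_shift (m : ℝ) (f : ℝ → ℝ) :
    ∫ y, f y ∂gaussianReal m 1 = ∫ z, f (z + m) ∂gaussianReal 0 1 := by
  have h : (gaussianReal 0 1).map (· + m) = gaussianReal m 1 := by
    rw [gaussianReal_map_add_const]; simp
  rw [← h, (MeasurableEquiv.addRight m).measurableEmbedding.integral_map (f := (· + m)) f |>.symm]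

theorem integral_gaussianReal_centered (m : ℝ) (f : ℝ → ℝ) :
    ∫ y, f (y - m) ∂gaussianReal m 1 = ∫ z, f z ∂gaussianReal 0 1 := by
  rw [integral_gaussianReal_shift]; simp

theorem integral_gaussianReal_neg (m : ℝ) (f : ℝ → ℝ) :
    ∫ y, f (-y) ∂gaussianReal m 1 = ∫ y, f y ∂gaussianReal (-m) 1 := by
  rw [← gaussianReal_map_neg]
  rw [(MeasurableEquiv.neg ℝ).measurableEmbedding.integral_map (f := fun x => -x) f |>.symm]

theorem gaussianPDFReal_eq_tilt (m x : ℝ) :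
    gaussianPDFReal m 1 x = gaussianPDFReal 0 1 x * Real.exp (m * x - m ^ 2 / 2) := by
  simp only [gaussianPDFReal, mul_assoc, ← Real.exp_add]
  congr 2
  simp; ring

theorem integral_gaussianReal_tilt (m : ℝ) (f : ℝ → ℝ) :
    ∫ y, f y ∂gaussianReal m 1 = ∫ z, Real.exp (m * z - m ^ 2 / 2) * f z ∂gaussianReal 0 1 := by
  rw [integral_gaussianReal_eq_integral_smul one_ne_zero,
    integral_gaussianReal_eq_integral_smul one_ne_zero]
  refine integral_congr_ae (ae_of_all _ fun x => ?_)
  simp only [gaussianPDFReal_eq_tilt m x, smul_eq_mul]; ring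

theorem gaussianReal_eq_withDensity_tilt (m : ℝ) :
    gaussianReal m 1 = (gaussianReal 0 1).withDensity
      fun z => ENNReal.ofReal (Real.exp (m * z - m ^ 2 / 2)) := by
  rw [gaussianReal_of_var_ne_zero _ one_ne_zero, gaussianReal_of_var_ne_zero _ one_ne_zero,
    ← withDensity_mul _ (by fun_prop) (by fun_prop)]
  congr 1
  ext x
  simp only [gaussianPDF, Pi.mul_apply]
  rw [gaussianPDFReal_eq_tilt m x, ENNReal.ofReal_mul (gaussianPDFReal_nonneg _ _ _)]

theorem integrable_tilt {m : ℝ} {f : ℝ → ℝ} (hf : Integrable f (gaussianReal m 1)) :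
    Integrable (fun z => Real.exp (m * z - m ^ 2 / 2) * f z) (gaussianReal 0 1) := by
  rw [gaussianReal_eq_withDensity_tilt,
    integrable_withDensity_iff_integrable_smul' (by fun_prop) (by simp)] at hf
  refine hf.congr (ae_of_all _ fun z => ?_)
  simp [ENNReal.toReal_ofReal (Real.exp_nonneg _)]

/-- The variables with absolute value at least `t`. -/
abbrev absGe (t : ℝ) : Set ℝ := {y | t ≤ |y|}

theorem measurableSet_absGe (t : ℝ) : MeasurableSet (absGe t) :=
  measurableSet_le measurable_const measurable_abs

theorem absGe_anti {s t : ℝ} (h : s ≤ t) : absGe t ⊆ absGe s := fun _ hy => h.trans hy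

theorem integral_exp_mul_gaussianReal (t : ℝ) :
    ∫ z, Real.exp (t * z) ∂gaussianReal 0 1 = Real.exp (t ^ 2 / 2) := by
  have := congrFun (mgf_id_gaussianReal (μ := 0) (v := 1)) t
  simpa [mgf] using this

theorem integrable_exp_abs (t : ℝ) :
    Integrable (fun z : ℝ => Real.exp (t * |z|)) (gaussianReal 0 1) := by
  refine ((integrable_exp_mul_gaussianReal (μ := 0) (v := 1) t).add
    (integrable_exp_mul_gaussianReal (μ := 0) (v := 1) (-t))).mono' (by fun_prop)
    (ae_of_all _ fun z => ?_)
  rw [Real.norm_of_nonneg (Real.exp_nonneg _)]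
  rcases abs_cases z with ⟨h, _⟩ | ⟨h, _⟩ <;> rw [h] <;> simp only [Pi.add_apply]
  · linarith [Real.exp_pos (-t * z)]
  · have : t * -z = -t * z := by ring
    rw [this]; linarith [Real.exp_pos (t * z)]

theorem integral_exp_abs_le (t : ℝ) :
    ∫ z, Real.exp (t * |z|) ∂gaussianReal 0 1 ≤ 2 * Real.exp (t ^ 2 / 2) := by
  have h : ∫ z, Real.exp (t * |z|) ∂gaussianReal 0 1
      ≤ ∫ z, (Real.exp (t * z) + Real.exp (-t * z)) ∂gaussianReal 0 1 := by
    refine integral_mono (integrable_exp_abs t) ((integrable_exp_mul_gaussianReal t).add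
      (integrable_exp_mul_gaussianReal (-t))) fun z => ?_
    rcases abs_cases z with ⟨h, _⟩ | ⟨h, _⟩ <;> simp only [h]
    · linarith [Real.exp_pos (-t * z)]
    · have : t * -z = -t * z := by ring
      rw [this]; linarith [Real.exp_pos (t * z)]
  rw [integral_add (integrable_exp_mul_gaussianReal t) (integrable_exp_mul_gaussianReal (-t)),
    integral_exp_mul_gaussianReal, integral_exp_mul_gaussianReal] at h
  have h2 : (-t) ^ 2 = t ^ 2 := by ring
  rw [h2] at h; linarith

/-- Moments of a standard normal variable restricted to `|z| ≥ T`. -/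
theorem integral_pow_tail_le (k : ℕ) {T : ℝ} (hT : 0 ≤ T) :
    ∫ z, (absGe T).indicator (fun z => |z| ^ k) z ∂gaussianReal 0 1
      ≤ k.factorial * (2 * Real.exp (1 / 2 + T - T ^ 2 / 2)) := by
  -- On |z| ≥ T one has 1 ≤ exp(T|z| - T²), and |z|^k ≤ k! exp|z|. The exponential moment at 1 + T
  -- then produces the exponent (1 + T)²/2 - T² = 1/2 + T - T²/2.
  have hp : ∀ z : ℝ, (absGe T).indicator (fun z => |z| ^ k) z
      ≤ k.factorial * (Real.exp (-T ^ 2) * Real.exp ((1 + T) * |z|)) := by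
    intro z
    by_cases hz : z ∈ absGe T
    · rw [Set.indicator_of_mem hz, ← Real.exp_add]
      have h1 := Real.pow_div_factorial_le_exp |z| (abs_nonneg z) k
      rw [div_le_iff₀ (by positivity)] at h1
      have hz' : T ≤ |z| := hz
      have h2 : Real.exp |z| ≤ Real.exp (-T ^ 2 + (1 + T) * |z|) := by
        apply Real.exp_le_exp.2; nlinarith
      calc |z| ^ k ≤ Real.exp |z| * k.factorial := h1
        _ ≤ Real.exp (-T ^ 2 + (1 + T) * |z|) * k.factorial := by gcongr
        _ = _ := by ring
    · rw [Set.indicator_of_notMem hz]; positivity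
  have hi : Integrable (fun z : ℝ => (absGe T).indicator (fun z => |z| ^ k) z)
      (gaussianReal 0 1) := by
    refine Integrable.indicator ?_ (measurableSet_absGe T)
    simpa [abs_pow] using (integrable_pow_gaussianReal 0 k).abs
  calc _ ≤ ∫ z, k.factorial * (Real.exp (-T ^ 2) * Real.exp ((1 + T) * |z|)) ∂gaussianReal 0 1 :=
        integral_mono hi (((integrable_exp_abs (1 + T)).const_mul _).const_mul _) hp
    _ = k.factorial * (Real.exp (-T ^ 2) * ∫ z, Real.exp ((1 + T) * |z|) ∂gaussianReal 0 1) := by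
        rw [integral_const_mul, integral_const_mul]
    _ ≤ k.factorial * (Real.exp (-T ^ 2) * (2 * Real.exp ((1 + T) ^ 2 / 2))) := by
        gcongr; exact integral_exp_abs_le _
    _ = _ := by
        have : Real.exp (-T ^ 2) * (2 * Real.exp ((1 + T) ^ 2 / 2))
            = 2 * Real.exp (1 / 2 + T - T ^ 2 / 2) := by
          rw [mul_left_comm, ← Real.exp_add]; congr 2; ring
        rw [this]

theorem gaussTail_nonneg (t : ℝ) : 0 ≤ gaussTail t := measureReal_nonneg

theorem gaussTail_sub {s t : ℝ} (h : s ≤ t) :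
    gaussTail s - gaussTail t = (gaussianReal 0 1).real (Set.Ioc s t) := by
  unfold gaussTail
  have : Set.Ioi s = Set.Ioc s t ∪ Set.Ioi t := (Set.Ioc_union_Ioi_eq_Ioi h).symm
  rw [this, measureReal_union (by
    rw [Set.disjoint_left]; intro x hx hx'; exact absurd hx.2 (not_le.2 hx')) measurableSet_Ioi]
  ring

theorem gaussianReal_real_Ioc {s t : ℝ} (h : s ≤ t) :
    (gaussianReal 0 1).real (Set.Ioc s t) = ∫ x in s..t, gaussianPDFReal 0 1 x := by
  rw [Measure.real, gaussianReal_apply_eq_integral _ one_ne_zero, ENNReal.toReal_ofReal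
    (integral_nonneg fun x => gaussianPDFReal_nonneg _ _ _), intervalIntegral.integral_of_le h]

theorem gaussTail_strictAnti : StrictAnti gaussTail := by
  intro s t h
  have := gaussTail_sub h.le
  have h2 : 0 < (gaussianReal 0 1).real (Set.Ioc s t) := by
    rw [gaussianReal_real_Ioc h.le]
    exact intervalIntegral.intervalIntegral_pos_of_pos
      ((integrable_gaussianPDFReal 0 1).intervalIntegrable)
      (fun x => gaussianPDFReal_pos _ _ _ one_ne_zero) h
  linarith

theorem gaussianPDFReal_std (x : ℝ) :
    gaussianPDFReal 0 1 x = (Real.sqrt (2 * Real.pi))⁻¹ * Real.exp (-x ^ 2 / 2) := by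
  simp [gaussianPDFReal]

theorem sqrt_two_pi_ge_one : 1 ≤ Real.sqrt (2 * Real.pi) := by
  rw [Real.one_le_sqrt]; linarith [Real.pi_gt_three]

theorem sqrt_two_pi_le_three : Real.sqrt (2 * Real.pi) ≤ 3 := by
  rw [Real.sqrt_le_left (by norm_num)]; linarith [Real.pi_lt_four]

theorem gaussTail_continuous : Continuous gaussTail := by
  have : LipschitzWith 1 gaussTail := by
    have key : ∀ s t : ℝ, s ≤ t → gaussTail s - gaussTail t ≤ t - s := by
      intro s t h
      rw [gaussTail_sub h, gaussianReal_real_Ioc h]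
      have : ∫ x in s..t, gaussianPDFReal 0 1 x ≤ ∫ x in s..t, (1 : ℝ) := by
        refine intervalIntegral.integral_mono_on h
          ((integrable_gaussianPDFReal 0 1).intervalIntegrable) (by simp) fun x _ => ?_
        rw [gaussianPDFReal_std]
        exact mul_le_one₀ (inv_le_one_of_one_le₀ sqrt_two_pi_ge_one) (Real.exp_nonneg _)
          (Real.exp_le_one_iff.2 (by nlinarith [sq_nonneg x]))
      simpa using this
    refine LipschitzWith.of_dist_le_mul fun s t => ?_
    rw [Real.dist_eq, Real.dist_eq]
    rcases le_total s t with h | h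
    · rw [abs_of_nonneg (sub_nonneg.2 (gaussTail_strictAnti.antitone h)), abs_sub_comm,
        abs_of_nonneg (sub_nonneg.2 h)]
      simpa using key s t h
    · rw [abs_sub_comm, abs_of_nonneg (sub_nonneg.2 (gaussTail_strictAnti.antitone h)),
        abs_of_nonneg (sub_nonneg.2 h)]
      simpa using key t s h
  exact this.continuous

theorem gaussTail_add_neg (t : ℝ) : gaussTail t + gaussTail (-t) = 1 := by
  have h1 : gaussTail (-t) = (gaussianReal 0 1).real (Set.Iio t) := by
    unfold gaussTail
    have h := gaussianReal_map_neg (μ := 0) (v := 1)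
    rw [neg_zero] at h
    conv_lhs => rw [← h]
    rw [map_measureReal_apply (by fun_prop) measurableSet_Ioi]
    congr 1; ext x; simp
  have h2 : (gaussianReal 0 1).real (Set.Iio t) = (gaussianReal 0 1).real (Set.Iic t) := by
    have := nullSingletonClass_gaussianReal (μ := 0) (v := 1) one_ne_zero
    exact measureReal_congr Iio_ae_eq_Iic
  rw [h1, h2, gaussTail, ← Set.compl_Iic, probReal_compl_eq_one_sub measurableSet_Iic]; ring

theorem gaussTail_zero : gaussTail 0 = 1 / 2 := by
  have := gaussTail_add_neg 0
  rw [neg_zero] at this; linarith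

theorem two_mul_gaussTail {t : ℝ} (ht : 0 ≤ t) :
    2 * gaussTail t = (gaussianReal 0 1).real (absGe t) := by
  have := nullSingletonClass_gaussianReal (μ := 0) (v := 1) one_ne_zero
  have h1 : absGe t = Set.Ici t ∪ Set.Iic (-t) := by
    ext y; simp [le_abs, le_neg]
  have h2 : (gaussianReal 0 1).real (Set.Ici t) = gaussTail t :=
    measureReal_congr Ioi_ae_eq_Ici.symm
  have h3 : (gaussianReal 0 1).real (Set.Iic (-t)) = gaussTail t := by
    rw [← Set.compl_Ioi, probReal_compl_eq_one_sub measurableSet_Ioi]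
    have := gaussTail_add_neg t
    unfold gaussTail at *; linarith
  rcases ht.eq_or_lt with rfl | ht
  · rw [gaussTail_zero]
    have : absGe (0:ℝ) = Set.univ := by ext; simp
    rw [this]; simp
  rw [h1, measureReal_union _ measurableSet_Iic, h2, h3]; · ring
  rw [Set.disjoint_left]; intro x hx hx'
  simp only [Set.mem_Ici, Set.mem_Iic] at hx hx'; linarith

theorem gaussTail_le_exp {t : ℝ} (ht : 0 ≤ t) : gaussTail t ≤ Real.exp (-t ^ 2 / 2) := by
  have h := measure_ge_le_exp_mul_mgf (X := id) (μ := gaussianReal 0 1) t ht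
    (integrable_exp_mul_gaussianReal t)
  rw [mgf_id_gaussianReal, ← Real.exp_add] at h
  refine (measureReal_mono fun x hx => ?_).trans (h.trans (Real.exp_le_exp.2 (le_of_eq ?_)))
  · exact le_of_lt (by simpa using hx)
  · simp; ring

/-- The interval (t, t + 1] alone carries this mass: the density there is at least its value at t +
1, and √(2π) ≤ 3. The loss against the true tail is e^{O(t)}, harmless beside the Gaussian gaps used
later. -/
theorem le_gaussTail {t : ℝ} (ht : 0 ≤ t) : Real.exp (-(t + 1) ^ 2 / 2) / 3 ≤ gaussTail t := by
  have h1 := gaussTail_sub (show t ≤ t + 1 by linarith)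
  rw [gaussianReal_real_Ioc (by linarith)] at h1
  have h2 : ∫ x in t..t + 1, Real.exp (-(t + 1) ^ 2 / 2) / 3
      ≤ ∫ x in t..t + 1, gaussianPDFReal 0 1 x := by
    refine intervalIntegral.integral_mono_on (by linarith) (by simp)
          ((integrable_gaussianPDFReal 0 1).intervalIntegrable) fun x hx => ?_
    rw [gaussianPDFReal_std, div_eq_inv_mul]
    have := sqrt_two_pi_ge_one
    gcongr
    · exact sqrt_two_pi_le_three
    · linarith [hx.1]
    · exact hx.2
  simp only [intervalIntegral.integral_const, smul_eq_mul] at h2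
  have := gaussTail_nonneg (t + 1)
  linarith

/-! ### Gaussian quantiles -/

theorem exists_gaussTail_eq {α : ℝ} (h0 : 0 < α) (h1 : α < 1) : ∃ t, gaussTail t = α := by
  have hlim : Tendsto (fun t : ℝ => Real.exp (-t ^ 2 / 2)) atTop (nhds 0) := by
    refine Real.tendsto_exp_atBot.comp ?_
    have : Tendsto (fun t : ℝ => t ^ 2 / 2) atTop atTop :=
      (tendsto_pow_atTop two_ne_zero).atTop_div_const (by norm_num)
    simp only [neg_div]
    exact tendsto_neg_atTop_atBot.comp this
  obtain ⟨s, hs0, hs⟩ := ((eventually_ge_atTop 0).and (hlim.eventually (gt_mem_nhds h0))).exists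
  obtain ⟨r, hr0, hr⟩ := ((eventually_ge_atTop 0).and
    (hlim.eventually (gt_mem_nhds (sub_pos.2 h1)))).exists
  have hsα : gaussTail s ≤ α := (gaussTail_le_exp hs0).trans hs.le
  have hrα : α ≤ gaussTail (-r) := by
    have := gaussTail_add_neg r
    have := gaussTail_le_exp hr0
    linarith
  obtain ⟨t, -, ht⟩ := intermediate_value_univ s (-r) gaussTail_continuous |>
    fun h => (⟨(h ⟨hsα, hrα⟩).choose, trivial, (h ⟨hsα, hrα⟩).choose_spec⟩ :
      ∃ t, True ∧ gaussTail t = α)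
  exact ⟨t, ht⟩

theorem gaussTail_upperQuantile {α : ℝ} (h0 : 0 < α) (h1 : α < 1) :
    gaussTail (upperQuantile α) = α := by
  obtain ⟨t, rfl⟩ := exists_gaussTail_eq h0 h1
  have : {s | gaussTail s ≤ gaussTail t} = Set.Ici t := by
    ext s; simp [gaussTail_strictAnti.le_iff_ge]
  rw [upperQuantile, this, csInf_Ici]

theorem le_upperQuantile_iff {α s : ℝ} (h0 : 0 < α) (h1 : α < 1) :
    s ≤ upperQuantile α ↔ α ≤ gaussTail s := by
  conv_rhs => rw [← gaussTail_upperQuantile h0 h1]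
  exact gaussTail_strictAnti.le_iff_ge.symm

theorem upperQuantile_le_iff {α s : ℝ} (h0 : 0 < α) (h1 : α < 1) :
    upperQuantile α ≤ s ↔ gaussTail s ≤ α := by
  conv_rhs => rw [← gaussTail_upperQuantile h0 h1]
  exact gaussTail_strictAnti.le_iff_ge.symm

theorem upperQuantile_lt {α β : ℝ} (h0 : 0 < α) (hαβ : α < β) (h1 : β < 1) :
    upperQuantile β < upperQuantile α := by
  rw [← gaussTail_strictAnti.lt_iff_gt, gaussTail_upperQuantile h0 (hαβ.trans h1),
    gaussTail_upperQuantile (h0.trans hαβ) h1]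
  exact hαβ

theorem upperQuantile_nonneg {α : ℝ} (h0 : 0 < α) (h1 : α ≤ 1 / 2) : 0 ≤ upperQuantile α := by
  rw [le_upperQuantile_iff h0 (by linarith), gaussTail_zero]; exact h1

theorem upperQuantile_pos {α : ℝ} (h0 : 0 < α) (h1 : α < 1 / 2) : 0 < upperQuantile α := by
  refine lt_of_le_of_ne (upperQuantile_nonneg h0 h1.le) fun h => ?_
  have := gaussTail_upperQuantile h0 (by linarith)
  rw [← h, gaussTail_zero] at this; linarith

/-! ### Comparison of shifted and centered Gaussian expectations -/

/-- For x² ≥ 2 it is immediate. Otherwise cosh x ≤ exp(x²/2) ≤ 1/(1 - x²/2), which rearranges to the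
claim. -/
theorem cosh_sub_one_le (x : ℝ) : Real.cosh x - 1 ≤ x ^ 2 / 2 * Real.cosh x := by
  rcases le_or_gt 2 (x ^ 2) with h | h
  · have := Real.cosh_pos x; nlinarith
  have h1 : Real.cosh x ≤ Real.exp (x ^ 2 / 2) := Real.cosh_le_exp_half_sq x
  have h2 : Real.exp (x ^ 2 / 2) ≤ 1 / (1 - x ^ 2 / 2) := by
    rw [le_div_iff₀ (by linarith)]
    have h3 := Real.add_one_le_exp (-(x ^ 2 / 2))
    have h4 : Real.exp (x ^ 2 / 2) * Real.exp (-(x ^ 2 / 2)) = 1 := by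
      rw [← Real.exp_add]; simp
    nlinarith [Real.exp_pos (x ^ 2 / 2)]
  have h3 := h1.trans h2
  rw [le_div_iff₀ (by linarith)] at h3
  linarith

/-- Averaging the likelihood ratios of the shifts m and -m cancels the first-order term; the sum is
2 exp(-m²/2) cosh(mz), and the remainder of the cosh is quadratic. -/
theorem tilt_symm_le (m z : ℝ) :
    Real.exp (m * z - m ^ 2 / 2) + Real.exp (-m * z - m ^ 2 / 2) - 2
      ≤ (m * z) ^ 2 / 2 * (Real.exp (m * z - m ^ 2 / 2) + Real.exp (-m * z - m ^ 2 / 2)) := by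
  have h1 : Real.exp (m * z - m ^ 2 / 2) + Real.exp (-m * z - m ^ 2 / 2)
      = 2 * Real.exp (-(m ^ 2 / 2)) * Real.cosh (m * z) := by
    rw [Real.cosh_eq, sub_eq_add_neg, sub_eq_add_neg, Real.exp_add, Real.exp_add]; ring_nf
  rw [h1]
  have h2 := cosh_sub_one_le (m * z)
  have h3 : Real.exp (-(m ^ 2 / 2)) ≤ 1 := Real.exp_le_one_iff.2 (by nlinarith [sq_nonneg m])
  have h4 := Real.exp_pos (-(m ^ 2 / 2))
  nlinarith [mul_le_mul_of_nonneg_left h2 h4.le]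

/-- For an even nonnegative function, shifting the Gaussian raises the expectation by at most
a second-order term. -/
theorem integral_shift_sub_le (m : ℝ) {W : ℝ → ℝ} (h0 : ∀ y, 0 ≤ W y) (heven : ∀ y, W (-y) = W y)
    (hi : ∀ a, Integrable W (gaussianReal a 1))
    (hi2 : ∀ a, Integrable (fun y => y ^ 2 * W y) (gaussianReal a 1)) :
    ∫ y, W y ∂gaussianReal m 1 - ∫ z, W z ∂gaussianReal 0 1
      ≤ m ^ 2 / 2 * ∫ y, y ^ 2 * W y ∂gaussianReal m 1 := by
  -- Evenness makes the shifts m and -m interchangeable, so each expectation is the average of its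
  -- two tilted versions and `tilt_symm_le` applies pointwise.
  have e1 : ∫ y, W y ∂gaussianReal m 1 = ∫ y, W y ∂gaussianReal (-m) 1 := by
    rw [← integral_gaussianReal_neg]; simp [heven]
  have e2 : ∫ y, y ^ 2 * W y ∂gaussianReal m 1 = ∫ y, y ^ 2 * W y ∂gaussianReal (-m) 1 := by
    rw [← integral_gaussianReal_neg]; simp [heven]
  have a1 := integral_gaussianReal_tilt m W
  have a2 := integral_gaussianReal_tilt (-m) W
  have b1 := integral_gaussianReal_tilt m (fun y => y ^ 2 * W y)
  have b2 := integral_gaussianReal_tilt (-m) (fun y => y ^ 2 * W y)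
  have i1 := integrable_tilt (hi m)
  have i2 := integrable_tilt (hi (-m))
  have j1 := integrable_tilt (hi2 m)
  have j2 := integrable_tilt (hi2 (-m))
  have i12 : Integrable (fun z => Real.exp (m * z - m ^ 2 / 2) * W z
    + Real.exp (-m * z - (-m) ^ 2 / 2) * W z) (gaussianReal 0 1) := i1.add i2
  have key : ∫ z, ((Real.exp (m * z - m ^ 2 / 2) * W z + Real.exp (-m * z - (-m) ^ 2 / 2) * W z)
        - 2 * W z) ∂gaussianReal 0 1
      ≤ ∫ z, m ^ 2 / 2 * (Real.exp (m * z - m ^ 2 / 2) * (z ^ 2 * W z)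
        + Real.exp (-m * z - (-m) ^ 2 / 2) * (z ^ 2 * W z)) ∂gaussianReal 0 1 := by
    refine integral_mono (i12.sub ((hi 0).const_mul 2)) ((j1.add j2).const_mul _)
      fun z => ?_
    have := mul_le_mul_of_nonneg_right (tilt_symm_le m z) (h0 z)
    simp only [neg_sq]
    nlinarith [this]
  rw [integral_sub i12 ((hi 0).const_mul 2), integral_add i1 i2, integral_const_mul,
    integral_const_mul, integral_add j1 j2, ← a1, ← a2, ← b1, ← b2, ← e1, ← e2] at key
  linarith

/-- An odd function with the sign of its argument has nonnegative expectation after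
multiplication by the shift. -/
theorem integral_shift_odd_nonneg (m : ℝ) {W : ℝ → ℝ} (h0 : ∀ y, 0 ≤ W y)
    (heven : ∀ y, W (-y) = W y) (hi : ∀ a, Integrable (fun y => y * W y) (gaussianReal a 1)) :
    0 ≤ ∫ y, m * (y * W y) ∂gaussianReal m 1 := by
  have e1 : ∫ y, m * (y * W y) ∂gaussianReal m 1 = ∫ y, -m * (y * W y) ∂gaussianReal (-m) 1 := by
    rw [← integral_gaussianReal_neg]; simp [heven]
  have a1 := integral_gaussianReal_tilt m (fun y => m * (y * W y))
  have a2 := integral_gaussianReal_tilt (-m) (fun y => -m * (y * W y))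
  have i1 := integrable_tilt ((hi m).const_mul m)
  have i2 := integrable_tilt ((hi (-m)).const_mul (-m))
  have : 0 ≤ ∫ z, (Real.exp (m * z - m ^ 2 / 2) * (m * (z * W z))
      + Real.exp (-m * z - (-m) ^ 2 / 2) * (-m * (z * W z))) ∂gaussianReal 0 1 := by
    refine integral_nonneg fun z => ?_
    -- The difference of the two tilts has the sign of mz.
    have h : (0:ℝ) ≤ (m * z) * (Real.exp (m * z - m ^ 2 / 2) - Real.exp (-m * z - m ^ 2 / 2)) := by
      rcases le_total 0 (m * z) with h | h
      · exact mul_nonneg h (sub_nonneg.2 (Real.exp_le_exp.2 (by linarith)))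
      · exact mul_nonneg_of_nonpos_of_nonpos h (sub_nonpos.2 (Real.exp_le_exp.2 (by linarith)))
    have := mul_nonneg h (h0 z)
    simp only [neg_sq, Pi.zero_apply]
    nlinarith [this]
  rw [integral_add i1 i2, ← a1, ← a2, ← e1] at this
  linarith

/-! ### The FDR boundary at real arguments and the energy of pure noise -/

/-- The FDR boundary at a real argument. -/
def thr (n : ℕ) (q x : ℝ) : ℝ := upperQuantile (q / 2 * (x / n))

/-- The sum of the first `k` squared boundary values. -/
def penSum (n : ℕ) (q : ℝ) (k : ℕ) : ℝ := ∑ l ∈ Finset.Icc 1 k, fdrBoundary n q l ^ 2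

theorem fdrPen_eq_penSum {n : ℕ} (q : ℝ) (x : Fin n → ℝ) :
    fdrPen q x = penSum n q (hammingNorm x) := rfl

theorem fdrBoundary_eq_thr (n : ℕ) (q : ℝ) (l : ℕ) : fdrBoundary n q l = thr n q l := rfl

theorem penSum_zero (n : ℕ) (q : ℝ) : penSum n q 0 = 0 := by simp [penSum]

theorem penSum_succ (n : ℕ) (q : ℝ) (k : ℕ) :
    penSum n q (k + 1) = penSum n q k + fdrBoundary n q (k + 1) ^ 2 := by
  rw [penSum, Finset.sum_Icc_succ_top (by omega)]; simp [penSum]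

theorem penSum_mono (n : ℕ) (q : ℝ) : Monotone (penSum n q) :=
  monotone_nat_of_le_succ fun k => by rw [penSum_succ]; nlinarith [sq_nonneg (fdrBoundary n q (k+1))]

theorem penSum_nonneg (n : ℕ) (q : ℝ) (k : ℕ) : 0 ≤ penSum n q k :=
  Finset.sum_nonneg fun _ _ => sq_nonneg _

section Threshold

variable {n : ℕ} {q : ℝ}

theorem thr_arg_pos (hn : 0 < n) (hq : 0 < q) {x : ℝ} (hx : 0 < x) : 0 < q / 2 * (x / n) := by
  positivity

theorem thr_arg_le (hn : 0 < n) {x : ℝ} (hx : q * x ≤ n) : q / 2 * (x / n) ≤ 1 / 2 := by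
  have : (0:ℝ) < n := by exact_mod_cast hn
  rw [div_mul_div_comm, div_le_iff₀ (by positivity)]; linarith

theorem thr_nonneg (hn : 0 < n) (hq : 0 < q) {x : ℝ} (hx : 0 < x) (hxn : q * x ≤ n) :
    0 ≤ thr n q x := upperQuantile_nonneg (thr_arg_pos hn hq hx) (thr_arg_le hn hxn)

theorem thr_lt (hn : 0 < n) (hq : 0 < q) {x x' : ℝ} (hx : 0 < x) (h : x < x') (hxn : q * x' ≤ n) :
    thr n q x' < thr n q x := by
  have : (0:ℝ) < n := by exact_mod_cast hn
  exact upperQuantile_lt (thr_arg_pos hn hq hx) (by gcongr) (by linarith [thr_arg_le hn hxn])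

theorem thr_le (hn : 0 < n) (hq : 0 < q) {x x' : ℝ} (hx : 0 < x) (h : x ≤ x') (hxn : q * x' ≤ n) :
    thr n q x' ≤ thr n q x := by
  rcases h.eq_or_lt with rfl | h
  · exact le_rfl
  · exact (thr_lt hn hq hx h hxn).le

/-- The quantile level (q/2)(x/n) is doubled by the two tails and multiplied by n. This calibration
is what links the penalty to noise: on average q x of n null coordinates exceed the boundary at x.
-/
theorem two_tail_thr (hn : 0 < n) (hq : 0 < q) {x : ℝ} (hx : 0 < x) (hxn : q * x ≤ n) :
    n * (gaussianReal 0 1).real (absGe (thr n q x)) = q * x := by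
  have : (0:ℝ) < n := by exact_mod_cast hn
  rw [← two_mul_gaussTail (thr_nonneg hn hq hx hxn), thr,
    gaussTail_upperQuantile (thr_arg_pos hn hq hx) (by linarith [thr_arg_le hn hxn])]
  field_simp

/-- The second moment of a standard normal variable on `|z| ≥ t`. -/
def tailEnergy (t : ℝ) : ℝ := ∫ z, (absGe t).indicator (fun z => z ^ 2) z ∂gaussianReal 0 1

theorem integrable_indicator_sq (t : ℝ) :
    Integrable ((absGe t).indicator fun z : ℝ => z ^ 2) (gaussianReal 0 1) :=
  (integrable_pow_gaussianReal 0 2).indicator (measurableSet_absGe t)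

theorem integrable_absGe_const (m t c : ℝ) :
    Integrable ((absGe t).indicator fun _ : ℝ => c) (gaussianReal m 1) :=
  (integrable_const c).indicator (measurableSet_absGe t)

theorem integral_absGe_const (m t c : ℝ) :
    ∫ z, (absGe t).indicator (fun _ => c) z ∂gaussianReal m 1
      = c * (gaussianReal m 1).real (absGe t) := by
  rw [integral_indicator (measurableSet_absGe t)]; simp [mul_comm]

/-- Between the levels s and t the integrand z² lies between s² and t², so an energy increment is a
count increment times a squared level. -/
theorem tailEnergy_sub_bounds {s t : ℝ} (hs : 0 ≤ s) (hst : s ≤ t) :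
    s ^ 2 * ((gaussianReal 0 1).real (absGe s) - (gaussianReal 0 1).real (absGe t))
        ≤ tailEnergy s - tailEnergy t ∧
      tailEnergy s - tailEnergy t
        ≤ t ^ 2 * ((gaussianReal 0 1).real (absGe s) - (gaussianReal 0 1).real (absGe t)) := by
  have key : ∀ z : ℝ, (absGe s).indicator (fun _ => s ^ 2) z - (absGe t).indicator (fun _ => s ^ 2) z
      ≤ (absGe s).indicator (fun z => z ^ 2) z - (absGe t).indicator (fun z => z ^ 2) z ∧
      (absGe s).indicator (fun z => z ^ 2) z - (absGe t).indicator (fun z => z ^ 2) z ≤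
      (absGe s).indicator (fun _ => t ^ 2) z - (absGe t).indicator (fun _ => t ^ 2) z := by
    intro z
    by_cases h1 : z ∈ absGe t
    · have h2 : z ∈ absGe s := absGe_anti hst h1
      simp only [Set.indicator_of_mem h1, Set.indicator_of_mem h2]; simp
    · by_cases h2 : z ∈ absGe s
      · simp only [Set.indicator_of_notMem h1, Set.indicator_of_mem h2, sub_zero]
        have h3 : |z| < t := not_le.1 h1
        have h4 : s ≤ |z| := h2
        rw [← sq_abs z]
        exact ⟨by gcongr, by gcongr⟩
      · simp only [Set.indicator_of_notMem h1, Set.indicator_of_notMem h2]; simp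
  have e : ∀ c, ∫ z, ((absGe s).indicator (fun _ => c) z - (absGe t).indicator (fun _ => c) z)
      ∂gaussianReal 0 1
      = c * ((gaussianReal 0 1).real (absGe s) - (gaussianReal 0 1).real (absGe t)) := by
    intro c
    rw [integral_sub (integrable_absGe_const 0 s c) (integrable_absGe_const 0 t c),
      integral_absGe_const, integral_absGe_const]; ring
  have e2 : tailEnergy s - tailEnergy t = ∫ z, ((absGe s).indicator (fun z => z ^ 2) z
      - (absGe t).indicator (fun z => z ^ 2) z) ∂gaussianReal 0 1 :=
    (integral_sub (integrable_indicator_sq s) (integrable_indicator_sq t)).symm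
  rw [e2, ← e, ← e]
  have i1 := (integrable_indicator_sq s).sub (integrable_indicator_sq t)
  exact ⟨integral_mono ((integrable_absGe_const 0 s _).sub (integrable_absGe_const 0 t _)) i1
      fun z => (key z).1,
    integral_mono i1 ((integrable_absGe_const 0 s _).sub (integrable_absGe_const 0 t _))
      fun z => (key z).2⟩

theorem le_tailEnergy {t : ℝ} (ht : 0 ≤ t) :
    t ^ 2 * (gaussianReal 0 1).real (absGe t) ≤ tailEnergy t := by
  rw [← integral_absGe_const]
  refine integral_mono (integrable_absGe_const 0 t _) (integrable_indicator_sq t) fun z => ?_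
  refine Set.indicator_le_indicator' fun hz => ?_
  rw [← sq_abs z]; gcongr; exact hz

theorem tailEnergy_nonneg (t : ℝ) : 0 ≤ tailEnergy t :=
  integral_nonneg fun _ => Set.indicator_nonneg (fun _ _ => sq_nonneg _) _

/-- The expected energy of `n` pure noise coordinates above the boundary at `x`. -/
def noiseEnergy (n : ℕ) (q x : ℝ) : ℝ := n * tailEnergy (thr n q x)

theorem noiseEnergy_nonneg (n : ℕ) (q x : ℝ) : 0 ≤ noiseEnergy n q x :=
  mul_nonneg (Nat.cast_nonneg _) (tailEnergy_nonneg _)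

/-- Moving from x to x' admits q(x' - x) null values on average, each with squared size between the
two squared boundary values. -/
theorem noiseEnergy_sub_bounds (hn : 0 < n) (hq : 0 < q) {x x' : ℝ} (hx : 0 < x) (h : x ≤ x')
    (hxn : q * x' ≤ n) :
    q * (x' - x) * thr n q x' ^ 2 ≤ noiseEnergy n q x' - noiseEnergy n q x ∧
      noiseEnergy n q x' - noiseEnergy n q x ≤ q * (x' - x) * thr n q x ^ 2 := by
  have hxn' : q * x ≤ n := (by gcongr : q * x ≤ q * x').trans hxn
  have hx' := hx.trans_le h
  have hb := tailEnergy_sub_bounds (thr_nonneg hn hq hx' hxn) (thr_le hn hq hx h hxn)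
  have e : q * (x' - x) = n * ((gaussianReal 0 1).real (absGe (thr n q x'))
      - (gaussianReal 0 1).real (absGe (thr n q x))) := by
    rw [mul_sub (n : ℝ), two_tail_thr hn hq hx' hxn, two_tail_thr hn hq hx hxn']; ring
  have : (0:ℝ) < n := by exact_mod_cast hn
  rw [e]; unfold noiseEnergy
  constructor <;> nlinarith [hb.1, hb.2]

theorem noiseEnergy_ge (hn : 0 < n) (hq : 0 < q) {x : ℝ} (hx : 0 < x) (hxn : q * x ≤ n) :
    q * x * thr n q x ^ 2 ≤ noiseEnergy n q x := by
  rw [← two_tail_thr hn hq hx hxn, noiseEnergy, mul_assoc]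
  have := le_tailEnergy (thr_nonneg hn hq hx hxn)
  gcongr
  linarith

/-- The increment is at most (a - 1) q x t_x², and q x t_x² is itself below the energy at x. So
replacing a rank by a neighbouring grid point costs only the factor of the grid. -/
theorem noiseEnergy_mul_le (hn : 0 < n) (hq : 0 < q) {x x' a : ℝ} (hx : 0 < x) (h : x ≤ x')
    (ha : x' ≤ a * x) (hxn : q * x' ≤ n) : noiseEnergy n q x' ≤ a * noiseEnergy n q x := by
  have h1 := (noiseEnergy_sub_bounds hn hq hx h hxn).2
  have hxn' : q * x ≤ n := (by gcongr : q * x ≤ q * x').trans hxn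
  have h2 := noiseEnergy_ge hn hq hx hxn'
  have ha1 : 1 ≤ a := by
    by_contra hcon; push Not at hcon; nlinarith
  have h3 : q * (x' - x) * thr n q x ^ 2 ≤ (a - 1) * (q * x * thr n q x ^ 2) := by
    have : q * (x' - x) * thr n q x ^ 2 ≤ q * ((a - 1) * x) * thr n q x ^ 2 := by
      gcongr; linarith
    linarith
  nlinarith

theorem noiseEnergy_mono (hn : 0 < n) (hq : 0 < q) {x x' : ℝ} (hx : 0 < x) (h : x ≤ x')
    (hxn : q * x' ≤ n) : noiseEnergy n q x ≤ noiseEnergy n q x' := by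
  have h1 := (noiseEnergy_sub_bounds hn hq hx h hxn).1
  have : 0 ≤ q * (x' - x) * thr n q x' ^ 2 :=
    mul_nonneg (mul_nonneg hq.le (by linarith)) (sq_nonneg _)
  linarith

/-- Each unit increment of the noise energy dominates q times the next squared boundary value, and
these telescope to q Pen. With the converse below, this is the identity "noise energy = q Pen" that
governs the cross term. -/
theorem penSum_le_noiseEnergy (hn : 0 < n) (hq : 0 < q) {k : ℕ} (hk : 1 ≤ k) (hkn : q * k ≤ n) :
    q * penSum n q k ≤ noiseEnergy n q k := by
  induction k, hk using Nat.le_induction with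
  | base =>
    rw [← zero_add 1, penSum_succ, penSum_zero, zero_add, fdrBoundary_eq_thr]
    have := noiseEnergy_ge hn hq (x := ((0 + 1 : ℕ) : ℝ)) (by norm_num) (by simpa using hkn)
    simpa using this
  | succ k hk ih =>
    have hk0 : (0:ℝ) < k := by exact_mod_cast hk
    have hkk : (k:ℝ) ≤ ((k + 1 : ℕ) : ℝ) := by push_cast; linarith
    have h1 := ih ((by gcongr : q * (k:ℝ) ≤ q * ((k + 1 : ℕ) : ℝ)).trans hkn)
    have h2 := (noiseEnergy_sub_bounds hn hq hk0 hkk hkn).1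
    rw [penSum_succ, fdrBoundary_eq_thr]
    push_cast at h2 ⊢
    linarith

theorem noiseEnergy_le_penSum (hn : 0 < n) (hq : 0 < q) {k : ℕ} (hk : 1 ≤ k) (hkn : q * k ≤ n) :
    noiseEnergy n q k ≤ q * penSum n q k + noiseEnergy n q 1 := by
  -- The increment from j to j + 1 is bounded by the boundary at the left end j, so the telescoped
  -- sum stops at k - 1 and the energy at rank 1 remains as the only error.
  have main : noiseEnergy n q k ≤ q * penSum n q (k - 1) + noiseEnergy n q 1 := by
    induction k, hk using Nat.le_induction with
    | base => simp [penSum_zero]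
    | succ j hj ih =>
      have hj0 : (0:ℝ) < j := by exact_mod_cast hj
      have hjj : (j:ℝ) ≤ ((j + 1 : ℕ) : ℝ) := by push_cast; linarith
      have g1 := ih ((by gcongr : q * (j:ℝ) ≤ q * ((j + 1 : ℕ) : ℝ)).trans hkn)
      have g2 := (noiseEnergy_sub_bounds hn hq hj0 hjj hkn).2
      rw [← fdrBoundary_eq_thr] at g2
      obtain ⟨i, rfl⟩ : ∃ i, j = i + 1 := ⟨j - 1, by omega⟩
      rw [Nat.add_sub_cancel] at g1 ⊢
      rw [penSum_succ]
      push_cast at g1 g2 ⊢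
      nlinarith
  exact main.trans (by gcongr; exact penSum_mono n q (by omega))

/-- The penalty is subadditive because the boundary is decreasing. -/
theorem penSum_add_le (hn : 0 < n) (hq : 0 < q) (k m : ℕ) (hkm : q * ((k + m : ℕ) : ℝ) ≤ n) :
    penSum n q (k + m) ≤ penSum n q k + penSum n q m := by
  induction m with
  | zero => simp [penSum_zero]
  | succ m ih =>
    have h1 : ((k + m : ℕ) : ℝ) ≤ ((k + (m + 1) : ℕ) : ℝ) := by push_cast; linarith
    have h2 := ih ((by gcongr : q * ((k + m : ℕ) : ℝ) ≤ q * ((k + (m + 1) : ℕ) : ℝ)).trans hkm)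
    rw [← add_assoc, penSum_succ, penSum_succ, fdrBoundary_eq_thr, fdrBoundary_eq_thr]
    have h3 : thr n q ((k + m + 1 : ℕ) : ℝ) ≤ thr n q ((m + 1 : ℕ) : ℝ) := by
      refine thr_le hn hq (by positivity) (by push_cast; linarith [Nat.cast_nonneg (α := ℝ) k]) hkm
    have h4 : 0 ≤ thr n q ((k + m + 1 : ℕ) : ℝ) := thr_nonneg hn hq (by positivity) hkm
    have : thr n q ((k + m + 1 : ℕ) : ℝ) ^ 2 ≤ thr n q ((m + 1 : ℕ) : ℝ) ^ 2 := by gcongr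
    linarith

theorem penSum_le_mul (hn : 0 < n) (hq : 0 < q) (m : ℕ) (hm : q * (m : ℝ) ≤ n) :
    penSum n q m ≤ m * thr n q 1 ^ 2 := by
  unfold penSum
  have : ∀ l ∈ Finset.Icc 1 m, fdrBoundary n q l ^ 2 ≤ thr n q 1 ^ 2 := by
    intro l hl
    rw [Finset.mem_Icc] at hl
    have h1 : (1:ℝ) ≤ l := by exact_mod_cast hl.1
    have h2 : (l:ℝ) ≤ m := by exact_mod_cast hl.2
    have h3 : q * (l:ℝ) ≤ n := (by gcongr : q * (l:ℝ) ≤ q * m).trans hm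
    rw [fdrBoundary_eq_thr]
    have := thr_nonneg hn hq (by linarith) h3
    gcongr
    exact thr_le hn hq one_pos h1 h3
  simpa using Finset.sum_le_sum this

theorem le_penSum (hn : 0 < n) (hq : 0 < q) (m : ℕ) {x : ℝ} (hx : q * x ≤ n) (hmx : (m : ℝ) ≤ x) :
    m * thr n q x ^ 2 ≤ penSum n q m := by
  unfold penSum
  have : ∀ l ∈ Finset.Icc 1 m, thr n q x ^ 2 ≤ fdrBoundary n q l ^ 2 := by
    intro l hl
    rw [Finset.mem_Icc] at hl
    have h1 : (1:ℝ) ≤ l := by exact_mod_cast hl.1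
    have h2 : (l:ℝ) ≤ x := (by exact_mod_cast hl.2 : (l:ℝ) ≤ m).trans hmx
    rw [fdrBoundary_eq_thr]
    have := thr_nonneg hn hq (by linarith) hx
    gcongr
    exact thr_le hn hq (by linarith) h2 hx
  simpa using Finset.sum_le_sum this

end Threshold

/-! ### The structure of the minimizers -/

namespace IsPenalizedFDR

variable {n : ℕ} {q : ℝ} {m : (Fin n → ℝ) → Fin n → ℝ}

theorem hammingNorm_le_card {n : ℕ} (x : Fin n → ℝ) : hammingNorm x ≤ n := by
  simpa using hammingNorm_le_card_fintype (x := x)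

/-- Replacing each nonzero entry by the datum does not enlarge the support, hence not the penalty,
and strictly lowers the residual unless the entries already agree. -/
theorem eq_of_ne_zero (h : IsPenalizedFDR q m) (y : Fin n → ℝ) {i : Fin n} (hi : m y i ≠ 0) :
    m y i = y i := by
  classical
  set x : Fin n → ℝ := fun i => if m y i ≠ 0 then y i else 0 with hx
  have h1 := h.minimizes y x
  have h2 : hammingNorm x ≤ hammingNorm (m y) := by
    refine Finset.card_le_card fun i => ?_
    simp only [Finset.mem_filter, Finset.mem_univ, true_and, hx]
    intro h h'; simp [h'] at h
  have h3 := penSum_mono n q h2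
  simp only [complexity, fdrPen_eq_penSum] at h1
  have h4 : ∑ i, ((y i - m y i) ^ 2 - (y i - x i) ^ 2) ≤ 0 := by
    rw [Finset.sum_sub_distrib]; linarith
  have h5 : ∀ i ∈ Finset.univ, 0 ≤ (y i - m y i) ^ 2 - (y i - x i) ^ 2 := by
    intro i _
    by_cases hi : m y i ≠ 0
    · simp [hx, hi]; positivity
    · push Not at hi; simp [hx, hi]
  have h6 := (Finset.sum_eq_zero_iff_of_nonneg h5).1
    (le_antisymm h4 (Finset.sum_nonneg h5)) i (Finset.mem_univ i)
  simp only [hx, hi, ne_eq, not_false_eq_true, if_true, sub_self] at h6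
  have : (y i - m y i) ^ 2 = 0 := by linarith
  have := pow_eq_zero_iff two_ne_zero |>.1 this
  linarith

/-- Removing one active coordinate adds y_i² to the residual and refunds the last penalty term t_k²;
minimality forbids a gain. -/
theorem sq_boundary_le (h : IsPenalizedFDR q m) (y : Fin n → ℝ) {i : Fin n} (hi : m y i ≠ 0) :
    fdrBoundary n q (hammingNorm (m y)) ^ 2 ≤ y i ^ 2 := by
  classical
  have h1 := h.minimizes y (Function.update (m y) i 0)
  have hsupp : Finset.univ.filter (fun j => m y j ≠ 0)
      = insert i (Finset.univ.filter fun j => Function.update (m y) i 0 j ≠ 0) := by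
    ext j; rcases eq_or_ne j i with rfl | hj
    · simp [hi]
    · simp [hj]
  have h2 : hammingNorm (m y) = hammingNorm (Function.update (m y) i 0) + 1 := by
    unfold hammingNorm
    rw [hsupp, Finset.card_insert_of_notMem (by simp)]
  simp only [complexity, fdrPen_eq_penSum] at h1
  rw [h2, penSum_succ] at h1
  rw [h2]
  have h3 : ∑ j, (y j - Function.update (m y) i 0 j) ^ 2 = ∑ j, (y j - m y j) ^ 2 + y i ^ 2 := by
    rw [← Finset.add_sum_erase _ _ (Finset.mem_univ i),
      ← Finset.add_sum_erase Finset.univ (fun j => (y j - m y j) ^ 2) (Finset.mem_univ i)]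
    have : ∑ x ∈ Finset.univ.erase i, (y x - Function.update (m y) i 0 x) ^ 2
        = ∑ x ∈ Finset.univ.erase i, (y x - m y x) ^ 2 := by
      refine Finset.sum_congr rfl fun j hj => ?_
      rw [Function.update_of_ne (Finset.ne_of_mem_erase hj)]
    rw [this, h.eq_of_ne_zero y hi]; simp; ring
  linarith

/-- Adding coordinates to the support of a minimizer cannot pay. -/
theorem sum_sq_le_penSum_sub (h : IsPenalizedFDR q m) (y : Fin n → ℝ) {M : Finset (Fin n)}
    (hM : ∀ i ∈ M, m y i = 0) :
    ∑ i ∈ M, y i ^ 2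
      ≤ penSum n q (hammingNorm (m y) + M.card) - penSum n q (hammingNorm (m y)) := by
  classical
  set x : Fin n → ℝ := fun i => if i ∈ M then y i else m y i with hx
  have h1 := h.minimizes y x
  simp only [complexity, fdrPen_eq_penSum] at h1
  have h2 : hammingNorm x ≤ hammingNorm (m y) + M.card := by
    unfold hammingNorm
    refine (Finset.card_le_card (t := Finset.univ.filter (fun i => m y i ≠ 0) ∪ M) ?_).trans
      (Finset.card_union_le _ _)
    intro i
    simp only [Finset.mem_filter, Finset.mem_univ, true_and, hx, Finset.mem_union]
    intro hi
    by_cases hiM : i ∈ M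
    · exact Or.inr hiM
    · left; simpa [hiM] using hi
  have h3 := penSum_mono n q h2
  have h4 : ∑ i, (y i - m y i) ^ 2 - ∑ i, (y i - x i) ^ 2 = ∑ i ∈ M, y i ^ 2 := by
    rw [← Finset.sum_sub_distrib, ← Finset.sum_filter_add_sum_filter_not Finset.univ (· ∈ M)]
    rw [Finset.sum_eq_zero (s := Finset.univ.filter (fun i => i ∉ M))]
    · rw [add_zero, Finset.filter_mem_eq_inter, Finset.univ_inter]
      refine Finset.sum_congr rfl fun i hi => ?_
      simp [hx, hi, hM i hi]
    · intro i hi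
      simp only [Finset.mem_filter, Finset.mem_univ, true_and] at hi
      simp [hx, hi]
  linarith

theorem sq_le_boundary (h : IsPenalizedFDR q m) (y : Fin n → ℝ) {i : Fin n} (hi : m y i = 0) :
    y i ^ 2 ≤ fdrBoundary n q (hammingNorm (m y) + 1) ^ 2 := by
  have := h.sum_sq_le_penSum_sub y (M := {i}) (by simpa using hi)
  rw [Finset.card_singleton, penSum_succ] at this
  simpa using this

/-- A vanishing estimate forces at least one vacant rank. -/
theorem hammingNorm_lt {x : Fin n → ℝ} {i : Fin n} (hi : x i = 0) : hammingNorm x < n := by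
  have : hammingNorm x < (Finset.univ : Finset (Fin n)).card :=
    Finset.card_lt_card ⟨Finset.filter_subset _ _, fun hsub => by
      have := hsub (Finset.mem_univ i); simp [hi] at this⟩
  simpa using this

theorem thr_le_abs (h : IsPenalizedFDR q m) (y : Fin n → ℝ) {i : Fin n} (hi : m y i ≠ 0) :
    thr n q (hammingNorm (m y)) ≤ |y i| := by
  have h1 := h.sq_boundary_le y hi
  rw [fdrBoundary_eq_thr] at h1
  have := sq_le_sq.1 h1
  exact (le_abs_self _).trans this

theorem abs_le_thr (h : IsPenalizedFDR q m) (hq : 0 < q) (hq1 : q < 1) (y : Fin n → ℝ)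
    {i : Fin n} (hi : m y i = 0) : |y i| ≤ thr n q ((hammingNorm (m y) : ℝ) + 1) := by
  have hn : 0 < n := i.pos
  have h1 := h.sq_le_boundary y hi
  rw [fdrBoundary_eq_thr] at h1
  have h2 := sq_le_sq.1 h1
  have h3 : ((hammingNorm (m y) + 1 : ℕ) : ℝ) ≤ n := by exact_mod_cast hammingNorm_lt hi
  rw [abs_of_nonneg (thr_nonneg hn hq (by positivity) (by nlinarith))] at h2
  push_cast at h2
  exact h2

theorem abs_le_thr_one (h : IsPenalizedFDR q m) (hq : 0 < q) (hq1 : q < 1) (y : Fin n → ℝ)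
    {i : Fin n} (hi : m y i = 0) : |y i| ≤ thr n q 1 := by
  have hn : 0 < n := i.pos
  have h3 : ((hammingNorm (m y) + 1 : ℕ) : ℝ) ≤ n := by exact_mod_cast hammingNorm_lt hi
  push_cast at h3
  exact (h.abs_le_thr hq hq1 y hi).trans (thr_le hn hq one_pos (by simp) (by nlinarith))

theorem ne_zero_of_thr_le (h : IsPenalizedFDR q m) (hq : 0 < q) (hq1 : q < 1) (y : Fin n → ℝ)
    {i : Fin n} {x : ℝ} (hx : 0 < x) (hxk : x ≤ hammingNorm (m y))
    (hy : thr n q x ≤ |y i|) : m y i ≠ 0 := by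
  intro hi
  have hn : 0 < n := i.pos
  have h3 : ((hammingNorm (m y) + 1 : ℕ) : ℝ) ≤ n := by exact_mod_cast hammingNorm_lt hi
  push_cast at h3
  -- A discarded coordinate satisfies |y_i| ≤ t_{k+1}, and strict monotonicity gives t_{k+1} < t_x.
  have h4 := thr_lt hn hq hx (show x < (hammingNorm (m y) : ℝ) + 1 by linarith) (by nlinarith)
  linarith [h.abs_le_thr hq hq1 y hi]

end IsPenalizedFDR

/-! ### Sums over independent coordinates and their deviations -/

instance {n : ℕ} (μ : Fin n → ℝ) : IsProbabilityMeasure (gaussShift μ) := by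
  unfold gaussShift; infer_instance

theorem measurePreserving_gaussShift {n : ℕ} (μ : Fin n → ℝ) (i : Fin n) :
    MeasurePreserving (fun y : Fin n → ℝ => y i) (gaussShift μ) (gaussianReal (μ i) 1) :=
  measurePreserving_eval (fun i => gaussianReal (μ i) 1) i

theorem integrable_gaussShift_eval {n : ℕ} {μ : Fin n → ℝ} {i : Fin n} {f : ℝ → ℝ}
    (hf : Integrable f (gaussianReal (μ i) 1)) : Integrable (fun y => f (y i)) (gaussShift μ) :=
  (measurePreserving_gaussShift μ i).integrable_comp_of_integrable hf

theorem integral_gaussShift_eval {n : ℕ} {μ : Fin n → ℝ} {i : Fin n} {f : ℝ → ℝ}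
    (hf : AEStronglyMeasurable f (gaussianReal (μ i) 1)) :
    ∫ y, f (y i) ∂gaussShift μ = ∫ y, f y ∂gaussianReal (μ i) 1 := by
  rw [← (measurePreserving_gaussShift μ i).map_eq] at hf ⊢
  exact (integral_map (measurable_pi_apply i).aemeasurable hf).symm

/-- The excess over `s` of the deviation of `∑ i ∈ G, g i (y i)` from its mean. -/
def deviation {n : ℕ} (μ : Fin n → ℝ) (G : Finset (Fin n)) (g : Fin n → ℝ → ℝ) (s : ℝ)
    (y : Fin n → ℝ) : ℝ :=
  max 0 (|∑ i ∈ G, g i (y i) - ∑ i ∈ G, ∫ x, g i x ∂gaussianReal (μ i) 1| - s)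

section Deviation

variable {n : ℕ} {μ : Fin n → ℝ} {G : Finset (Fin n)} {g : Fin n → ℝ → ℝ} {s : ℝ}

theorem deviation_nonneg (y : Fin n → ℝ) : 0 ≤ deviation μ G g s y := le_max_left _ _

theorem sum_le_deviation (y : Fin n → ℝ) : ∑ i ∈ G, g i (y i)
    ≤ ∑ i ∈ G, ∫ x, g i x ∂gaussianReal (μ i) 1 + s + deviation μ G g s y := by
  have h1 := le_max_right 0 (|∑ i ∈ G, g i (y i) - ∑ i ∈ G, ∫ x, g i x ∂gaussianReal (μ i) 1| - s)
  have h2 := le_abs_self (∑ i ∈ G, g i (y i) - ∑ i ∈ G, ∫ x, g i x ∂gaussianReal (μ i) 1)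
  unfold deviation; linarith

theorem deviation_le_sum (y : Fin n → ℝ) :
    ∑ i ∈ G, ∫ x, g i x ∂gaussianReal (μ i) 1 - s - deviation μ G g s y
      ≤ ∑ i ∈ G, g i (y i) := by
  have h1 := le_max_right 0 (|∑ i ∈ G, g i (y i) - ∑ i ∈ G, ∫ x, g i x ∂gaussianReal (μ i) 1| - s)
  have h2 := neg_abs_le (∑ i ∈ G, g i (y i) - ∑ i ∈ G, ∫ x, g i x ∂gaussianReal (μ i) 1)
  unfold deviation; linarith

theorem integrable_deviation (hg : ∀ i ∈ G, MemLp (g i) 2 (gaussianReal (μ i) 1)) :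
    Integrable (deviation μ G g s) (gaussShift μ) := by
  have h1 : Integrable (fun y => ∑ i ∈ G, g i (y i)) (gaussShift μ) :=
    integrable_finsetSum _ fun i hi => integrable_gaussShift_eval ((hg i hi).integrable (by norm_num))
  have h2 := ((h1.sub (integrable_const
    (∑ i ∈ G, ∫ x, g i x ∂gaussianReal (μ i) 1))).abs.sub (integrable_const s))
  have h3 := h2.pos_part
  refine h3.congr (ae_of_all _ fun y => ?_)
  simp [deviation, max_comm]

/-- The elementary bound (|a| - s)₊ ≤ a²/(4s), equivalent to (|a| - 2s)² ≥ 0 off the trivial range,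
turns a variance into an expected excess. Expected excesses, unlike small probabilities, can be
summed over a grid and multiplied by the size of the penalty without further tail estimates. -/
theorem integral_deviation_le (hg : ∀ i ∈ G, MemLp (g i) 2 (gaussianReal (μ i) 1)) (hs : 0 < s)
    {V : ℝ} (hV : ∑ i ∈ G, ∫ x, g i x ^ 2 ∂gaussianReal (μ i) 1 ≤ V) :
    ∫ y, deviation μ G g s y ∂gaussShift μ ≤ V / (4 * s) := by
  classical
  set X : (Fin n → ℝ) → ℝ := ∑ i ∈ G, fun y => g i (y i) with hX
  have hXy : ∀ y, X y = ∑ i ∈ G, g i (y i) := fun y => by simp [hX]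
  have hmem : ∀ i ∈ G, MemLp (fun y : Fin n → ℝ => g i (y i)) 2 (gaussShift μ) := fun i hi =>
    (hg i hi).comp_measurePreserving (measurePreserving_gaussShift μ i)
  have hXm : MemLp X 2 (gaussShift μ) := memLp_finsetSum' _ hmem
  have hEX : ∫ y, X y ∂gaussShift μ = ∑ i ∈ G, ∫ x, g i x ∂gaussianReal (μ i) 1 := by
    simp only [hXy]
    rw [integral_finsetSum _ fun i hi => (hmem i hi).integrable (by norm_num)]
    exact Finset.sum_congr rfl fun i hi =>
      integral_gaussShift_eval (hg i hi).aestronglyMeasurable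
  have hvar : Var[X; gaussShift μ] ≤ V := by
    have hind : Set.Pairwise (G : Set (Fin n)) fun i j =>
        (fun y : Fin n → ℝ => g i (y i)) ⟂ᵢ[gaussShift μ] (fun y => g j (y j)) := by
      intro i hi j hj hij
      -- The functions are extended by 0 off G, since measurability is only known on G.
      have h1 : iIndepFun (fun i (y : Fin n → ℝ) => if i ∈ G then g i (y i) else 0)
          (gaussShift μ) := by
        refine iIndepFun_pi (X := fun i x => if i ∈ G then g i x else 0) fun i => ?_
        by_cases hi : i ∈ G
        · simpa [hi] using (hg i hi).aestronglyMeasurable.aemeasurable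
        · simp [hi]
      have h2 := h1.indepFun hij
      simpa [Finset.mem_coe.1 hi, Finset.mem_coe.1 hj] using h2
    rw [hX, IndepFun.variance_sum hmem hind]
    refine le_trans (Finset.sum_le_sum fun i hi => ?_) hV
    refine (variance_le_expectation_sq (hmem i hi).aestronglyMeasurable).trans (le_of_eq ?_)
    exact integral_gaussShift_eval (f := fun x => g i x ^ 2)
      ((hg i hi).aestronglyMeasurable.pow 2)
  have hsq : Integrable (fun y => (X y - ∫ y, X y ∂gaussShift μ) ^ 2) (gaussShift μ) :=
    (hXm.sub (memLp_const _)).integrable_sq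
  calc ∫ y, deviation μ G g s y ∂gaussShift μ
      ≤ ∫ y, (X y - ∫ y, X y ∂gaussShift μ) ^ 2 / (4 * s) ∂gaussShift μ := by
        refine integral_mono (integrable_deviation hg) (hsq.div_const _) fun y => ?_
        simp only [deviation, hXy, ← hEX]
        have hsq0 : ∀ a : ℝ, max 0 (|a| - s) ≤ a ^ 2 / (4 * s) := by
          intro a
          rw [max_le_iff]
          refine ⟨by positivity, ?_⟩
          rw [le_div_iff₀ (by positivity), ← sq_abs a]
          nlinarith [sq_nonneg (|a| - 2 * s)]
        exact hsq0 _
    _ = Var[X; gaussShift μ] / (4 * s) := by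
        rw [integral_div, variance_eq_integral hXm.aestronglyMeasurable.aemeasurable]
    _ ≤ V / (4 * s) := by gcongr

end Deviation

/-! ### Tail counts and tail energies of a single shifted coordinate -/

/-- The weight `(y² + z²) / 2`, with `z = y - m`, which dominates `y z`. -/
def meanSq (m y : ℝ) : ℝ := (y ^ 2 + (y - m) ^ 2) / 2

theorem meanSq_nonneg (m y : ℝ) : 0 ≤ meanSq m y := by unfold meanSq; positivity

theorem mul_le_meanSq (m y : ℝ) : (y - m) * y ≤ meanSq m y := by
  unfold meanSq; nlinarith [sq_nonneg (y - (y - m))]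

theorem integrable_meanSq (m a : ℝ) : Integrable (meanSq m) (gaussianReal a 1) := by
  have := integrable_polynomial_gaussianReal a
    (Polynomial.C (1 / 2) * (Polynomial.X ^ 2 + (Polynomial.X - Polynomial.C m) ^ 2))
  refine this.congr (ae_of_all _ fun y => ?_)
  simp [meanSq]; ring

theorem measurable_meanSq (m : ℝ) : Measurable (meanSq m) := by
  unfold meanSq; fun_prop

/-- The upper part of `1 + y ^ 4`. -/
def tailQuartic (m t : ℝ) : ℝ :=
  ∫ y, (absGe t).indicator (fun y => 1 + y ^ 4) y ∂gaussianReal m 1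

theorem integrable_tailQuartic (a t : ℝ) :
    Integrable ((absGe t).indicator fun y : ℝ => 1 + y ^ 4) (gaussianReal a 1) :=
  ((integrable_const 1).add (integrable_pow_gaussianReal a 4)).indicator (measurableSet_absGe t)

theorem indicator_absGe_neg (t : ℝ) {W : ℝ → ℝ} (hW : ∀ y, W (-y) = W y) (y : ℝ) :
    (absGe t).indicator W (-y) = (absGe t).indicator W y := by
  have : -y ∈ absGe t ↔ y ∈ absGe t := by simp [absGe]
  by_cases h : y ∈ absGe t
  · rw [Set.indicator_of_mem h, Set.indicator_of_mem (this.2 h), hW]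
  · rw [Set.indicator_of_notMem h, Set.indicator_of_notMem (this.not.2 h)]

/-- The indicator of |y| ≥ t is even, so the shift acts only to second order; the factor y² it
produces is dominated by 1 + y⁴. -/
theorem tailCount_le (m t : ℝ) :
    (gaussianReal m 1).real (absGe t)
      ≤ (gaussianReal 0 1).real (absGe t) + m ^ 2 / 2 * tailQuartic m t := by
  have h := integral_shift_sub_le m (W := (absGe t).indicator fun _ => 1)
    (fun _ => Set.indicator_nonneg (fun _ _ => zero_le_one) _)
    (indicator_absGe_neg t fun _ => rfl) (fun a => integrable_absGe_const a t 1)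
    (fun a => by
      refine ((integrable_pow_gaussianReal a 2).indicator (measurableSet_absGe t)).congr
        (ae_of_all _ fun y => ?_)
      by_cases hy : y ∈ absGe t <;> simp [Set.indicator, hy])
  rw [integral_absGe_const, integral_absGe_const, one_mul, one_mul] at h
  have h2 : ∫ y, y ^ 2 * (absGe t).indicator (fun _ => 1) y ∂gaussianReal m 1
      ≤ tailQuartic m t := by
    refine integral_mono ?_ (integrable_tailQuartic m t) fun y => ?_
    · refine ((integrable_pow_gaussianReal m 2).indicator (measurableSet_absGe t)).congr
        (ae_of_all _ fun y => ?_)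
      by_cases hy : y ∈ absGe t <;> simp [Set.indicator, hy]
    · by_cases hy : y ∈ absGe t
      · simp only [Set.indicator_of_mem hy]; nlinarith [sq_nonneg (y ^ 2 - 1)]
      · simp only [Set.indicator_of_notMem hy]; simp
  nlinarith [mul_le_mul_of_nonneg_left h2 (by positivity : 0 ≤ m ^ 2 / 2)]

/-- Expand (y² + (y - m)²)/2 = y² - m y + m²/2. The first term is even and compares with the centred
one, the second has nonpositive expectation because m y is positively biased under the shift, and
the third is m²/2 times the count. This is why the symmetric weight replaces the product y z. -/
theorem tailMeanSq_le (m t : ℝ) :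
    ∫ y, (absGe t).indicator (meanSq m) y ∂gaussianReal m 1
      ≤ tailEnergy t + m ^ 2 / 2 * tailQuartic m t := by
  have hsq : ∀ a, Integrable ((absGe t).indicator fun y : ℝ => y ^ 2) (gaussianReal a 1) :=
    fun a => (integrable_pow_gaussianReal a 2).indicator (measurableSet_absGe t)
  have h4 : ∀ a, Integrable ((absGe t).indicator fun y : ℝ => y ^ 4) (gaussianReal a 1) :=
    fun a => (integrable_pow_gaussianReal a 4).indicator (measurableSet_absGe t)
  have e4 : ∀ y : ℝ, y ^ 2 * (absGe t).indicator (fun y => y ^ 2) y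
      = (absGe t).indicator (fun y => y ^ 4) y := by
    intro y; by_cases hy : y ∈ absGe t <;> simp [Set.indicator, hy]; ring
  have e1 : ∀ y : ℝ, y * (absGe t).indicator (fun _ => 1) y
      = (absGe t).indicator (fun y => y) y := by
    intro y; by_cases hy : y ∈ absGe t <;> simp [Set.indicator, hy]
  have h1 : ∀ a, Integrable ((absGe t).indicator fun y : ℝ => y) (gaussianReal a 1) :=
    fun a => by simpa using (integrable_pow_gaussianReal a 1).indicator (measurableSet_absGe t)
  have hA := integral_shift_sub_le m (W := (absGe t).indicator fun y => y ^ 2)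
    (fun _ => Set.indicator_nonneg (fun _ _ => sq_nonneg _) _)
    (indicator_absGe_neg t fun _ => by ring) hsq (fun a => by simpa only [e4] using h4 a)
  have hB := integral_shift_odd_nonneg m (W := (absGe t).indicator fun _ => 1)
    (fun _ => Set.indicator_nonneg (fun _ _ => zero_le_one) _)
    (indicator_absGe_neg t fun _ => rfl) (fun a => by simpa only [e1] using h1 a)
  simp only [e4, e1, integral_const_mul] at hA hB
  have hsplit : ∫ y, (absGe t).indicator (meanSq m) y ∂gaussianReal m 1
      = ∫ y, (absGe t).indicator (fun y => y ^ 2) y ∂gaussianReal m 1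
        - m * ∫ y, (absGe t).indicator (fun y => y) y ∂gaussianReal m 1
        + m ^ 2 / 2 * ∫ y, (absGe t).indicator (fun _ => 1) y ∂gaussianReal m 1 := by
    have i12 : Integrable (fun y => (absGe t).indicator (fun y => y ^ 2) y
        - m * (absGe t).indicator (fun y => y) y) (gaussianReal m 1) :=
      (hsq m).sub ((h1 m).const_mul m)
    rw [← integral_const_mul, ← integral_const_mul, ← integral_sub (hsq m) ((h1 m).const_mul m),
      ← integral_add i12 ((integrable_absGe_const m t 1).const_mul _)]
    refine integral_congr_ae (ae_of_all _ fun y => ?_)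
    by_cases hy : y ∈ absGe t
    · simp only [Set.indicator_of_mem hy, meanSq]; ring
    · simp only [Set.indicator_of_notMem hy]; ring
  have hT : tailQuartic m t = ∫ y, (absGe t).indicator (fun _ => 1) y ∂gaussianReal m 1
      + ∫ y, (absGe t).indicator (fun y => y ^ 4) y ∂gaussianReal m 1 := by
    rw [← integral_add (integrable_absGe_const m t 1) (h4 m)]
    refine integral_congr_ae (ae_of_all _ fun y => ?_)
    by_cases hy : y ∈ absGe t
    · simp only [Set.indicator_of_mem hy]
    · simp only [Set.indicator_of_notMem hy]; ring
  rw [hsplit, hT]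
  unfold tailEnergy
  nlinarith

/-- If |m| ≤ a and |y| ≥ a + s then the noise satisfies |z| ≥ s: the gap s between mean and
threshold yields the Gaussian factor. -/
theorem tailQuartic_le {m t a s : ℝ} (hs : 0 ≤ s) (hm : |m| ≤ a) (ht : a + s ≤ t) :
    tailQuartic m t ≤ 400 * (2 + a ^ 4) * Real.exp (1 / 2 + s - s ^ 2 / 2) := by
  have ha : 0 ≤ a := (abs_nonneg m).trans hm
  have h0 := integral_pow_tail_le 0 hs
  have h4 := integral_pow_tail_le 4 hs
  have i4 : Integrable (fun z : ℝ => (absGe s).indicator (fun z => |z| ^ 4) z)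
      (gaussianReal 0 1) := by
    refine Integrable.indicator ?_ (measurableSet_absGe s)
    simpa [abs_pow] using (integrable_pow_gaussianReal 0 4).abs
  have i0 : Integrable (fun z : ℝ => (absGe s).indicator (fun z => |z| ^ 0) z)
      (gaussianReal 0 1) := by
    refine Integrable.indicator ?_ (measurableSet_absGe s)
    simp
  unfold tailQuartic
  have hi := integrable_tailQuartic m t
  rw [integral_gaussianReal_shift]
  have : ∫ z, (absGe t).indicator (fun y => 1 + y ^ 4) (z + m) ∂gaussianReal 0 1
      ≤ ∫ z, ((1 + 8 * a ^ 4) * (absGe s).indicator (fun z => |z| ^ 0) z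
        + 8 * (absGe s).indicator (fun z => |z| ^ 4) z) ∂gaussianReal 0 1 := by
    refine integral_mono_of_nonneg (ae_of_all _ fun z => ?_)
      ((i0.const_mul _).add (i4.const_mul _)) (ae_of_all _ fun z => ?_)
    · exact Set.indicator_nonneg (fun _ _ => by positivity) _
    · by_cases hz : z + m ∈ absGe t
      · have hz' : t ≤ |z + m| := hz
        have hz2 : |z + m| ≤ |z| + a := (abs_add_le z m).trans (by linarith)
        have hzs : z ∈ absGe s := show s ≤ |z| by linarith
        simp only [Set.indicator_of_mem hz, Set.indicator_of_mem hzs, pow_zero]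
        have e : (z + m) ^ 4 = |z + m| ^ 4 := by rw [← abs_pow]; exact (abs_of_nonneg (by positivity)).symm
        rw [e]
        have h1 : |z + m| ^ 4 ≤ (|z| + a) ^ 4 := by gcongr
        have h2 : (|z| + a) ^ 4 ≤ 8 * (|z| ^ 4 + a ^ 4) := by
          nlinarith [sq_nonneg (|z| - a), sq_nonneg (|z| ^ 2 - a ^ 2), sq_nonneg (|z| + a),
            mul_nonneg (sq_nonneg (|z| - a)) (sq_nonneg (|z| + a)), abs_nonneg z,
            mul_nonneg (abs_nonneg z) ha, mul_nonneg (sq_nonneg (|z| - a)) (mul_nonneg (abs_nonneg z) ha),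
            mul_nonneg (sq_nonneg (|z| - a)) (sq_nonneg (|z| - a))]
        linarith
      · simp only [Set.indicator_of_notMem hz]
        exact add_nonneg (mul_nonneg (by positivity) (Set.indicator_nonneg (fun _ _ => by positivity) _))
          (mul_nonneg (by positivity) (Set.indicator_nonneg (fun _ _ => by positivity) _))
  rw [integral_add (i0.const_mul _) (i4.const_mul _), integral_const_mul, integral_const_mul] at this
  have hE := Real.exp_pos (1 / 2 + s - s ^ 2 / 2)
  norm_num [Nat.factorial] at h0 h4
  have h0' := mul_le_mul_of_nonneg_left h0 (by positivity : 0 ≤ 1 + 8 * a ^ 4)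
  have ha4 : 0 ≤ a ^ 4 := by positivity
  norm_num at this
  nlinarith [mul_nonneg ha4 hE.le]

theorem tailQuartic_le_of_abs_le_one {m t : ℝ} (ht : 0 ≤ t) (hm : |m| ≤ 1) :
    tailQuartic m t ≤ 4800 := by
  have h1 : tailQuartic m t ≤ tailQuartic m 0 := by
    refine integral_mono (integrable_tailQuartic m t) (integrable_tailQuartic m 0) fun y => ?_
    exact Set.indicator_le_indicator_of_subset (absGe_anti ht) (fun _ => by positivity) y
  have h2 : tailQuartic m 0 ≤ ∫ y, (1 + y ^ 4) ∂gaussianReal m 1 := by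
    refine integral_mono (integrable_tailQuartic m 0)
      ((integrable_const 1).add (integrable_pow_gaussianReal m 4)) fun y => ?_
    exact Set.indicator_le_self' (fun _ _ => by positivity) y
  have h4 := integral_pow_tail_le 4 le_rfl
  have hi4 : Integrable (fun z : ℝ => |z| ^ 4) (gaussianReal 0 1) := by
    simpa [abs_pow] using (integrable_pow_gaussianReal 0 4).abs
  have e0 : absGe (0:ℝ) = Set.univ := by ext; simp
  rw [e0] at h4
  simp only [Set.indicator_univ] at h4
  rw [integral_gaussianReal_shift] at h2
  have h3 : ∫ z, (1 + (z + m) ^ 4) ∂gaussianReal 0 1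
      ≤ ∫ z, (9 + 8 * |z| ^ 4) ∂gaussianReal 0 1 := by
    refine integral_mono_of_nonneg (ae_of_all _ fun z => by positivity)
      ((integrable_const _).add (hi4.const_mul 8)) (ae_of_all _ fun z => ?_)
    have hz2 : |z + m| ≤ |z| + 1 := (abs_add_le z m).trans (by linarith)
    have e : (z + m) ^ 4 = |z + m| ^ 4 := by rw [← abs_pow]; exact (abs_of_nonneg (by positivity)).symm
    have h1 : |z + m| ^ 4 ≤ (|z| + 1) ^ 4 := by gcongr
    have h2 : (|z| + 1) ^ 4 ≤ 8 * (|z| ^ 4 + 1) := by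
      nlinarith [sq_nonneg (|z| - 1), sq_nonneg (|z| ^ 2 - 1), abs_nonneg z,
        mul_nonneg (sq_nonneg (|z| - 1)) (abs_nonneg z),
        mul_nonneg (sq_nonneg (|z| - 1)) (sq_nonneg (|z| - 1)),
        mul_nonneg (sq_nonneg (|z| - 1)) (sq_nonneg (|z| + 1))]
    simp only
    rw [e]; linarith
  rw [integral_add (integrable_const _) (hi4.const_mul 8), integral_const_mul] at h3
  have he : Real.exp (1 / 2) ≤ 3 := by
    have := Real.exp_one_lt_d9
    have h := Real.exp_le_exp.2 (show (1/2:ℝ) ≤ 1 by norm_num)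
    linarith
  norm_num [Nat.factorial] at h4 h3 he
  linarith

theorem integral_sq_std : ∫ z, z ^ 2 ∂gaussianReal 0 1 = 1 := by
  have h := variance_fun_id_gaussianReal (μ := 0) (v := 1)
  rw [variance_eq_integral (by fun_prop), integral_id_gaussianReal] at h
  simpa using h

theorem integral_std : ∫ z, z ∂gaussianReal 0 1 = 0 := integral_id_gaussianReal

/-- The excess count and energy of a shifted coordinate are at most of second order. -/
theorem tail_excess_le_sq {m t : ℝ} (ht : 0 ≤ t) :
    (gaussianReal m 1).real (absGe t)
        ≤ (gaussianReal 0 1).real (absGe t) + 2400 * m ^ 2 ∧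
      ∫ y, (absGe t).indicator (meanSq m) y ∂gaussianReal m 1
        ≤ tailEnergy t + 2400 * m ^ 2 := by
  rcases le_or_gt |m| 1 with hm | hm
  · have h := tailQuartic_le_of_abs_le_one ht hm
    have h2 := mul_le_mul_of_nonneg_left h (by positivity : 0 ≤ m ^ 2 / 2)
    exact ⟨by linarith [tailCount_le m t], by linarith [tailMeanSq_le m t]⟩
  -- For |m| > 1 no cancellation is needed: the count is at most 1 and the full energy is 1 + m²/2,
  -- both at most a multiple of m².
  · have hm2 : 1 ≤ m ^ 2 := by rw [← sq_abs]; nlinarith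
    constructor
    · have h1 : (gaussianReal m 1).real (absGe t) ≤ 1 := measureReal_le_one
      have h2 : 0 ≤ (gaussianReal 0 1).real (absGe t) := measureReal_nonneg
      linarith
    · have h1 : ∫ y, (absGe t).indicator (meanSq m) y ∂gaussianReal m 1
          ≤ ∫ y, meanSq m y ∂gaussianReal m 1 :=
        integral_mono ((integrable_meanSq m m).indicator (measurableSet_absGe t))
          (integrable_meanSq m m) fun y => Set.indicator_le_self' (fun _ _ => meanSq_nonneg _ _) y
      have h2 : ∫ y, meanSq m y ∂gaussianReal m 1 = m ^ 2 / 2 + 1 := by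
        rw [integral_gaussianReal_shift]
        have : ∀ z : ℝ, meanSq m (z + m) = z ^ 2 + (m * z + m ^ 2 / 2) := by
          intro z; simp [meanSq]; ring
        simp only [this]
        have i1 : Integrable (fun z : ℝ => z) (gaussianReal 0 1) := by
          simpa using integrable_pow_gaussianReal 0 1
        have i2 : Integrable (fun z : ℝ => m * z + m ^ 2 / 2) (gaussianReal 0 1) :=
          (i1.const_mul m).add (integrable_const _)
        rw [integral_add (integrable_pow_gaussianReal 0 2) i2,
          integral_add (i1.const_mul m) (integrable_const _), integral_const_mul, integral_sq_std,
          integral_std]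
        simp; ring
      have := tailEnergy_nonneg t
      linarith

theorem memLp_indicator_meanSq (m t a : ℝ) :
    MemLp ((absGe t).indicator (meanSq m)) 2 (gaussianReal a 1) := by
  rw [memLp_two_iff_integrable_sq
    ((measurable_meanSq m).indicator (measurableSet_absGe t)).aestronglyMeasurable]
  have := integrable_polynomial_gaussianReal a
    ((Polynomial.C (1 / 2) * (Polynomial.X ^ 2 + (Polynomial.X - Polynomial.C m) ^ 2)) ^ 2)
  refine (this.indicator (measurableSet_absGe t)).congr (ae_of_all _ fun y => ?_)
  by_cases hy : y ∈ absGe t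
  · simp only [Set.indicator_of_mem hy]; simp [meanSq]; ring
  · simp only [Set.indicator_of_notMem hy]; simp

/-- If |z| < T then |y| ≤ 2T and the weight is at most 3T²; if |z| ≥ T it is at most 3z². The second
case costs 9 times the fourth moment beyond T, and 9 · 48 = 432. -/
theorem integral_indicator_meanSq_sq_le {m t T : ℝ} (hT : 0 ≤ T) (hm : |m| ≤ T) :
    ∫ y, (absGe t).indicator (meanSq m) y ^ 2 ∂gaussianReal m 1
      ≤ 9 * T ^ 4 * (gaussianReal m 1).real (absGe t)
        + 432 * Real.exp (1 / 2 + T - T ^ 2 / 2) := by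
  have h4 := integral_pow_tail_le 4 hT
  have i4 : Integrable ((absGe T).indicator fun z : ℝ => |z| ^ 4) (gaussianReal 0 1) := by
    refine Integrable.indicator ?_ (measurableSet_absGe T)
    simpa [abs_pow] using (integrable_pow_gaussianReal 0 4).abs
  have i4' : Integrable (fun y => (absGe T).indicator (fun z : ℝ => |z| ^ 4) (y - m))
      (gaussianReal m 1) := by
    refine (integrable_polynomial_gaussianReal m
      ((Polynomial.X - Polynomial.C m) ^ 4)).mono' ?_ (ae_of_all _ fun y => ?_)
    · exact (Measurable.indicator (by fun_prop) (measurableSet_absGe T)).comp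
        (measurable_id.sub_const m) |>.aestronglyMeasurable
    · have h : (0:ℝ) ≤ (y - m) ^ 4 := by positivity
      by_cases hy : y - m ∈ absGe T
      · simp only [Set.indicator_of_mem hy]
        rw [← abs_pow, abs_of_nonneg h, Real.norm_of_nonneg h]
        simp
      · simp only [Set.indicator_of_notMem hy]; simpa using h
  have hle : ∫ y, (absGe t).indicator (meanSq m) y ^ 2 ∂gaussianReal m 1
      ≤ ∫ y, ((absGe t).indicator (fun _ => 9 * T ^ 4) y
        + 9 * (absGe T).indicator (fun z : ℝ => |z| ^ 4) (y - m)) ∂gaussianReal m 1 := by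
    refine integral_mono (memLp_indicator_meanSq m t m).integrable_sq
      ((integrable_absGe_const m t _).add (i4'.const_mul 9)) fun y => ?_
    by_cases hy : y ∈ absGe t
    · simp only [Set.indicator_of_mem hy]
      have hy1 : |y| ≤ |y - m| + |m| := by
        have := abs_add_le (y - m) m; simpa using this
      have key : ∀ R : ℝ, |m| ≤ R → |y - m| ≤ R → meanSq m y ^ 2 ≤ 9 * R ^ 4 := by
        intro R h1 h2
        have hR : 0 ≤ R := (abs_nonneg _).trans h1
        have h3 : meanSq m y ≤ 3 * R ^ 2 := by
          unfold meanSq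
          rw [← sq_abs y, ← sq_abs (y - m)]
          have a1 : |y| ^ 2 ≤ (2 * R) ^ 2 := by gcongr; linarith
          have a2 : |y - m| ^ 2 ≤ R ^ 2 := by gcongr
          nlinarith
        calc meanSq m y ^ 2 ≤ (3 * R ^ 2) ^ 2 := by gcongr; exact meanSq_nonneg _ _
          _ = 9 * R ^ 4 := by ring
      by_cases hz : y - m ∈ absGe T
      · simp only [Set.indicator_of_mem hz]
        have hz' : T ≤ |y - m| := hz
        have := key |y - m| (hm.trans hz') le_rfl
        have : 0 ≤ 9 * T ^ 4 := by positivity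
        linarith
      · simp only [Set.indicator_of_notMem hz]
        have hz' : |y - m| < T := not_le.1 hz
        have := key T hm hz'.le
        linarith
    · simp only [Set.indicator_of_notMem hy]
      have : 0 ≤ (absGe T).indicator (fun z : ℝ => |z| ^ 4) (y - m) :=
        Set.indicator_nonneg (fun _ _ => by positivity) _
      simpa using this
  rw [integral_add (integrable_absGe_const m t _) (i4'.const_mul 9), integral_absGe_const,
    integral_const_mul,
    integral_gaussianReal_centered m ((absGe T).indicator fun z : ℝ => |z| ^ 4)] at hle
  norm_num [Nat.factorial] at h4 hle
  linarith

/-! ### A geometric grid of support sizes -/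

/-- The exponents `j` with `(1 + δ) ^ j ≤ n`. -/
def levels (n : ℕ) (δ : ℝ) : Finset ℕ := Finset.range (⌊Real.log n / Real.log (1 + δ)⌋₊ + 1)

theorem mem_levels {n : ℕ} {δ : ℝ} (hn : 0 < n) (hδ : 0 < δ) {j : ℕ} :
    j ∈ levels n δ ↔ (1 + δ) ^ j ≤ n := by
  have hl : 0 < Real.log (1 + δ) := Real.log_pos (by linarith)
  have hn' : (0:ℝ) < n := by exact_mod_cast hn
  have hn1 : (1:ℝ) ≤ n := by exact_mod_cast hn
  rw [levels, Finset.mem_range, Nat.lt_succ_iff, Nat.le_floor_iff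
    (div_nonneg (Real.log_nonneg hn1) hl.le), le_div_iff₀ hl, ← Real.log_pow,
    Real.log_le_log_iff (by positivity) hn']

/-- This replaces the random support size by one of O(log n) deterministic ranks, at the price of a
factor 1 + δ. -/
theorem exists_level {n : ℕ} {δ : ℝ} (hδ : 0 < δ) {k : ℕ} (hk : 1 ≤ k) (hkn : k ≤ n) :
    ∃ j ∈ levels n δ, (1 + δ) ^ j ≤ k ∧ (k : ℝ) ≤ (1 + δ) ^ (j + 1) := by
  obtain ⟨j, h1, h2⟩ := exists_nat_pow_near (show (1:ℝ) ≤ k by exact_mod_cast hk)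
    (show 1 < 1 + δ by linarith)
  have hkn' : (k:ℝ) ≤ n := by exact_mod_cast hkn
  exact ⟨j, (mem_levels (by omega) hδ).2 (h1.trans hkn'), h1, h2.le⟩

theorem card_levels_le {n : ℕ} {δ : ℝ} (hn : 0 < n) (hδ : 0 < δ) :
    ((levels n δ).card : ℝ) ≤ Real.log n / Real.log (1 + δ) + 1 := by
  have hl : 0 < Real.log (1 + δ) := Real.log_pos (by linarith)
  have hn1 : (1:ℝ) ≤ n := by exact_mod_cast hn
  simp only [levels, Finset.card_range, Nat.cast_add, Nat.cast_one, add_le_add_iff_right]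
  exact Nat.floor_le (div_nonneg (Real.log_nonneg hn1) hl.le)

/-- The total excess deviation over the grid. -/
def levelDev {n : ℕ} (μ : Fin n → ℝ) (G : Finset (Fin n)) (g : ℝ → Fin n → ℝ → ℝ) (s : ℝ → ℝ)
    (δ : ℝ) (e : ℕ) (y : Fin n → ℝ) : ℝ :=
  ∑ j ∈ levels n δ, deviation μ G (g ((1 + δ) ^ (j + e))) (s ((1 + δ) ^ (j + e))) y

section LevelDev

variable {n : ℕ} {μ : Fin n → ℝ} {G : Finset (Fin n)} {g : ℝ → Fin n → ℝ → ℝ} {s : ℝ → ℝ}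
  {δ : ℝ} {e : ℕ}

theorem levelDev_nonneg (y : Fin n → ℝ) : 0 ≤ levelDev μ G g s δ e y :=
  Finset.sum_nonneg fun _ _ => deviation_nonneg y

theorem deviation_le_levelDev (y : Fin n → ℝ) {j : ℕ} (hj : j ∈ levels n δ) :
    deviation μ G (g ((1 + δ) ^ (j + e))) (s ((1 + δ) ^ (j + e))) y ≤ levelDev μ G g s δ e y :=
  Finset.single_le_sum (f := fun j => deviation μ G (g ((1 + δ) ^ (j + e)))
    (s ((1 + δ) ^ (j + e))) y) (fun _ _ => deviation_nonneg y) hj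

theorem integrable_levelDev (hg : ∀ x, ∀ i ∈ G, MemLp (g x i) 2 (gaussianReal (μ i) 1)) :
    Integrable (levelDev μ G g s δ e) (gaussShift μ) :=
  integrable_finsetSum _ fun _ _ => integrable_deviation (hg _)

theorem integral_levelDev_le (hg : ∀ x, ∀ i ∈ G, MemLp (g x i) 2 (gaussianReal (μ i) 1)) {r : ℝ}
    (hs : ∀ j ∈ levels n δ, 0 < s ((1 + δ) ^ (j + e)))
    (hV : ∀ j ∈ levels n δ, ∑ i ∈ G, ∫ x, g ((1 + δ) ^ (j + e)) i x ^ 2 ∂gaussianReal (μ i) 1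
      ≤ r * (4 * s ((1 + δ) ^ (j + e)))) :
    ∫ y, levelDev μ G g s δ e y ∂gaussShift μ ≤ (levels n δ).card * r := by
  unfold levelDev
  rw [integral_finsetSum _ fun _ _ => integrable_deviation (hg _), ← nsmul_eq_mul]
  refine Finset.sum_le_card_nsmul _ _ _ fun j hj => ?_
  refine (integral_deviation_le (hg _) (hs j hj) (hV j hj)).trans (le_of_eq ?_)
  have := hs j hj
  field_simp

end LevelDev

/-! ### Measurability and integrability of functionals of the estimator -/

namespace IsPenalizedFDR

variable {n : ℕ} {q : ℝ} {m : (Fin n → ℝ) → Fin n → ℝ}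

theorem measurable_hammingNorm (h : IsPenalizedFDR q m) :
    Measurable fun y => hammingNorm (m y) := by
  have : ∀ y, hammingNorm (m y) = ∑ i, if m y i ≠ 0 then 1 else 0 := fun y => by
    rw [hammingNorm, Finset.card_filter]
  simp only [this]
  refine Finset.measurable_sum _ fun i _ => ?_
  have hm : Measurable fun y => m y i := (measurable_pi_apply i).comp h.measurable
  exact Measurable.ite (hm (measurableSet_singleton (0:ℝ)).compl) measurable_const measurable_const

theorem integrable_comp_hammingNorm (h : IsPenalizedFDR q m) (f : ℕ → ℝ) (μ : Fin n → ℝ) :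
    Integrable (fun y => f (hammingNorm (m y))) (gaussShift μ) := by
  have hmeas : Measurable fun y => f (hammingNorm (m y)) :=
    (measurable_of_countable f).comp h.measurable_hammingNorm
  refine Integrable.of_bound hmeas.aestronglyMeasurable
    (∑ k ∈ Finset.range (n + 1), ‖f k‖) (ae_of_all _ fun y => ?_)
  exact Finset.single_le_sum (f := fun k => ‖f k‖) (fun _ _ => norm_nonneg _)
    (Finset.mem_range.2 (Nat.lt_succ_of_le (hammingNorm_le_card (m y))))

theorem abs_le (h : IsPenalizedFDR q m) (y : Fin n → ℝ) (i : Fin n) : |m y i| ≤ |y i| := by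
  by_cases hi : m y i = 0
  · simp [hi]
  · rw [h.eq_of_ne_zero y hi]

theorem integrable_cross (h : IsPenalizedFDR q m) (μ : Fin n → ℝ) :
    Integrable (fun y => ∑ i, (y i - μ i) * (m y i - μ i)) (gaussShift μ) := by
  refine integrable_finsetSum _ fun i _ => ?_
  have hm : Measurable fun y => m y i := (measurable_pi_apply i).comp h.measurable
  have hi : Integrable (fun x => (x - μ i) ^ 2 + (x ^ 2 + μ i ^ 2)) (gaussianReal (μ i) 1) := by
    have := integrable_polynomial_gaussianReal (μ i)
      ((Polynomial.X - Polynomial.C (μ i)) ^ 2 + (Polynomial.X ^ 2 + Polynomial.C (μ i) ^ 2))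
    simpa using this
  refine (integrable_gaussShift_eval (μ := μ) hi).mono' (by fun_prop) (ae_of_all _ fun y => ?_)
  have h1 := h.abs_le y i
  rw [Real.norm_eq_abs, abs_mul]
  have h2 : |m y i - μ i| ≤ |y i| + |μ i| := (abs_sub _ _).trans (by linarith)
  rw [← sq_abs (y i - μ i), ← sq_abs (y i), ← sq_abs (μ i)]
  have h3 : |y i - μ i| * |m y i - μ i| ≤ |y i - μ i| * (|y i| + |μ i|) := by gcongr
  nlinarith [sq_nonneg (|y i - μ i| - (|y i| + |μ i|) / 2), sq_nonneg (|y i| - |μ i|),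
    sq_nonneg (|y i - μ i|)]

end IsPenalizedFDR

/-! ### Upper bounds for the support size and the cross term -/

section Upper

variable {n : ℕ} {q : ℝ} {m : (Fin n → ℝ) → Fin n → ℝ}

/-- The indicators of exceeding the boundary at `x`. -/
def countFun (n : ℕ) (q x : ℝ) (_ : Fin n) : ℝ → ℝ := (absGe (thr n q x)).indicator fun _ => 1

/-- The weights `(y² + z²) / 2` above the boundary at `x`. -/
def energyFun (q : ℝ) (μ : Fin n → ℝ) (x : ℝ) (i : Fin n) : ℝ → ℝ :=
  (absGe (thr n q x)).indicator (meanSq (μ i))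

theorem memLp_countFun (x : ℝ) (i : Fin n) (a : ℝ) :
    MemLp (countFun n q x i) 2 (gaussianReal a 1) :=
  (memLp_const 1).indicator (measurableSet_absGe _)

theorem memLp_energyFun (μ : Fin n → ℝ) (x : ℝ) (i : Fin n) (a : ℝ) :
    MemLp (energyFun q μ x i) 2 (gaussianReal a 1) := memLp_indicator_meanSq _ _ _

theorem integral_countFun (x : ℝ) (i : Fin n) (a : ℝ) :
    ∫ y, countFun n q x i y ∂gaussianReal a 1 = (gaussianReal a 1).real (absGe (thr n q x)) := by
  unfold countFun; rw [integral_absGe_const, one_mul]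

theorem integral_countFun_sq (x : ℝ) (i : Fin n) (a : ℝ) :
    ∫ y, countFun n q x i y ^ 2 ∂gaussianReal a 1
      = (gaussianReal a 1).real (absGe (thr n q x)) := by
  rw [← integral_countFun x i]
  refine integral_congr_ae (ae_of_all _ fun y => ?_)
  by_cases hy : y ∈ absGe (thr n q x) <;> simp [countFun, hy]

/-- The grid point just above a support size may exceed n by the factor 1 + δ. The condition q(1 +
δ) ≤ 1 keeps it in the range where the boundary is nonnegative and calibrated. -/
theorem level_mul_le {δ : ℝ} (hn : 0 < n) (hδ : 0 < δ) (hqδ : q * (1 + δ) ≤ 1) {j : ℕ}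
    (hj : j ∈ levels n δ) : q * (1 + δ) ^ (j + 1) ≤ n := by
  have h1 := (mem_levels hn hδ).1 hj
  have : 0 < (1 + δ) ^ j := by positivity
  rw [pow_succ]; nlinarith

/-- Kept coordinates exceed t_k, hence the boundary at the next grid point x ≤ (1 + δ)k. Inside G
such exceedances number about q x. The support size thus appears on both sides with coefficient near
q on the right, and solving for it later produces the factor 1/(1 - q). -/
theorem card_support_le (h : IsPenalizedFDR q m) (hn : 0 < n) (hq : 0 < q) {δ κ : ℝ} (hδ : 0 < δ)
    (hqδ : q * (1 + δ) ≤ 1) (hκ : 0 ≤ κ) (μ : Fin n → ℝ) (G : Finset (Fin n))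
    (hmean : ∀ x, 0 < x → q * x ≤ n →
      ∑ i ∈ G, (gaussianReal (μ i) 1).real (absGe (thr n q x)) ≤ q * x + δ * (κ + x))
    (y : Fin n → ℝ) :
    (hammingNorm (m y) : ℝ) ≤ Gᶜ.card + (q + 2 * δ) * (1 + δ) * hammingNorm (m y) + 2 * δ * κ
      + levelDev μ G (countFun n q) (fun x => δ * (κ + x)) δ 1 y := by
  classical
  set k := hammingNorm (m y) with hk
  have hF := levelDev_nonneg (μ := μ) (G := G) (g := countFun n q) (s := fun x => δ * (κ + x))
    (δ := δ) (e := 1) y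
  rcases Nat.eq_zero_or_pos k with h0 | h0
  · rw [h0]; simp only [Nat.cast_zero, mul_zero, add_zero]; positivity
  obtain ⟨j, hj, hj1, hj2⟩ := exists_level (n := n) hδ h0 (IsPenalizedFDR.hammingNorm_le_card (m y))
  -- Shift 1: the grid point above k has the lower boundary, so every kept coordinate is counted.
  set x := (1 + δ) ^ (j + 1) with hx
  have hx0 : 0 < x := by positivity
  have hxn : q * x ≤ n := level_mul_le hn hδ hqδ hj
  have hxk : x ≤ (1 + δ) * k := by rw [hx, pow_succ, mul_comm]; gcongr
  have h1 : (k : ℝ) ≤ Gᶜ.card + ∑ i ∈ G, countFun n q x i (y i) := by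
    have e1 : k ≤ (Gᶜ ∪ G.filter fun i => m y i ≠ 0).card := by
      refine Finset.card_le_card fun i => ?_
      simp only [Finset.mem_filter, Finset.mem_univ, true_and, Finset.mem_union,
        Finset.mem_compl]
      tauto
    have e2 := e1.trans (Finset.card_union_le _ _)
    have e3 : ((G.filter fun i => m y i ≠ 0).card : ℝ) ≤ ∑ i ∈ G, countFun n q x i (y i) := by
      rw [Finset.card_filter]; push_cast
      refine Finset.sum_le_sum fun i _ => ?_
      by_cases hi : m y i = 0
      · simp only [hi, ne_eq, not_true, if_false]
        exact Set.indicator_nonneg (fun _ _ => zero_le_one) _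
      · have : y i ∈ absGe (thr n q x) :=
          (thr_le hn hq (by positivity) hj2 hxn).trans (h.thr_le_abs y hi)
        simp [countFun, hi, Set.indicator_of_mem this]
    have e2' : (k : ℝ) ≤ Gᶜ.card + (G.filter fun i => m y i ≠ 0).card := by exact_mod_cast e2
    linarith
  have h2 := sum_le_deviation (μ := μ) (G := G) (g := countFun n q x) (s := δ * (κ + x)) y
  simp only [integral_countFun] at h2
  have h3 := hmean x hx0 hxn
  have h4 := deviation_le_levelDev (μ := μ) (G := G) (g := countFun n q)
    (s := fun x => δ * (κ + x)) (e := 1) y hj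
  simp only [← hx] at h4
  have h5 : (q + 2 * δ) * x ≤ (q + 2 * δ) * ((1 + δ) * k) := by gcongr
  linarith

/-- For indicators the second moment equals the mean, here at most 2(κ + x), which is 1/(2δ) times
4δ(κ + x). Every level therefore costs a constant. -/
theorem integral_countDev_le (hq1 : q < 1) {δ κ : ℝ} (hδ : 0 < δ) (hδ1 : δ < 1)
    (hκ : 0 ≤ κ) (μ : Fin n → ℝ) (G : Finset (Fin n)) {e : ℕ}
    (hlev : ∀ j ∈ levels n δ, q * (1 + δ) ^ (j + e) ≤ n)
    (hmean : ∀ x, 0 < x → q * x ≤ n →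
      ∑ i ∈ G, (gaussianReal (μ i) 1).real (absGe (thr n q x)) ≤ q * x + δ * (κ + x)) :
    ∫ y, levelDev μ G (countFun n q) (fun x => δ * (κ + x)) δ e y ∂gaussShift μ
      ≤ (levels n δ).card * (1 / (2 * δ)) := by
  refine integral_levelDev_le (fun x i _ => memLp_countFun x i _)
    (fun j _ => by positivity) fun j hj => ?_
  simp only [integral_countFun_sq]
  have hx : 0 < (1 + δ) ^ (j + e) := by positivity
  refine (hmean _ hx (hlev j hj)).trans ?_
  have : 1 / (2 * δ) * (4 * (δ * (κ + (1 + δ) ^ (j + e)))) = 2 * (κ + (1 + δ) ^ (j + e)) := by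
    field_simp; ring
  rw [this]
  nlinarith

/-- On G a kept coordinate contributes z y ≤ (y² + z²)/2 above the boundary, whose sum is noise
energy, that is about q Pen, plus a fluctuation; the remaining term z μ has mean zero and is carried
along untouched. On the few coordinates outside G a crude bound with t_1 suffices. -/
theorem cross_le (h : IsPenalizedFDR q m) (hn : 0 < n) (hq : 0 < q) (hq1 : q < 1) {δ l : ℝ}
    (hδ : 0 < δ) (hδ1 : δ < 1) (hqδ : q * (1 + δ) ≤ 1) (hl : 0 ≤ l) (μ : Fin n → ℝ)
    (G : Finset (Fin n))
    (hmean : ∀ x, 0 < x → q * x ≤ n →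
      ∑ i ∈ G, ∫ y, energyFun q μ x i y ∂gaussianReal (μ i) 1 ≤ noiseEnergy n q x + δ * (l + x))
    (y : Fin n → ℝ) :
    ∑ i, (y i - μ i) * (m y i - μ i)
      ≤ ∑ i ∈ Gᶜ, ((y i - μ i) ^ 2 + |y i - μ i| * thr n q 1)
        + ((1 + δ) * (q * fdrPen q (m y) + noiseEnergy n q 1) + 2 * δ * l
          + 4 * δ * hammingNorm (m y) + levelDev μ G (energyFun q μ) (fun x => δ * (l + x)) δ 1 y)
        - ∑ i ∈ G, (y i - μ i) * μ i := by
  classical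
  rw [fdrPen_eq_penSum]
  set k := hammingNorm (m y) with hk
  set F := levelDev μ G (energyFun q μ) (fun x => δ * (l + x)) δ 1 y with hF
  have hF0 : 0 ≤ F := levelDev_nonneg y
  have hB : ∑ i ∈ Gᶜ, (y i - μ i) * (m y i - μ i)
      ≤ ∑ i ∈ Gᶜ, ((y i - μ i) ^ 2 + |y i - μ i| * thr n q 1) := by
    refine Finset.sum_le_sum fun i _ => ?_
    by_cases hi : m y i = 0
    -- For a discarded coordinate z(0 - μ) = z² - z y with |y| ≤ t_1.
    · have h1 := h.abs_le_thr_one hq hq1 y hi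
      rw [hi]
      have h2 : -((y i - μ i) * y i) ≤ |y i - μ i| * thr n q 1 := by
        calc -((y i - μ i) * y i) ≤ |(y i - μ i) * y i| := neg_le_abs _
          _ = |y i - μ i| * |y i| := abs_mul _ _
          _ ≤ _ := by gcongr
      nlinarith
    · rw [h.eq_of_ne_zero y hi]
      have : 0 ≤ thr n q 1 := by
        refine thr_nonneg hn hq one_pos ?_
        have : (1:ℝ) ≤ n := by exact_mod_cast hn
        linarith
      have := mul_nonneg (abs_nonneg (y i - μ i)) this
      nlinarith
  have hG : ∑ i ∈ G, (y i - μ i) * (m y i - μ i)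
      ≤ ((1 + δ) * (q * penSum n q k + noiseEnergy n q 1) + 2 * δ * l
          + 4 * δ * k + F) - ∑ i ∈ G, (y i - μ i) * μ i := by
    have e1 : ∑ i ∈ G, (y i - μ i) * (m y i - μ i)
        = ∑ i ∈ G, (y i - μ i) * m y i - ∑ i ∈ G, (y i - μ i) * μ i := by
      rw [← Finset.sum_sub_distrib]; exact Finset.sum_congr rfl fun i _ => by ring
    rw [e1]
    gcongr
    rcases Nat.eq_zero_or_pos k with h0 | h0
    · have hm : m y = 0 := hammingNorm_eq_zero.1 h0
      rw [h0, hm, penSum_zero]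
      have := noiseEnergy_nonneg n q 1
      simp only [Pi.zero_apply, mul_zero, Finset.sum_const_zero, Nat.cast_zero, zero_add, add_zero]
      positivity
    obtain ⟨j, hj, hj1, hj2⟩ := exists_level (n := n) hδ h0
      (IsPenalizedFDR.hammingNorm_le_card (m y))
    set x := (1 + δ) ^ (j + 1) with hx
    have hx0 : 0 < x := by positivity
    have hxn : q * x ≤ n := level_mul_le hn hδ hqδ hj
    have hxj : x = (1 + δ) * (1 + δ) ^ j := by rw [hx, pow_succ, mul_comm]
    have hxk : x ≤ (1 + δ) * k := by rw [hxj]; gcongr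
    have hkn : (k:ℝ) ≤ n := by exact_mod_cast IsPenalizedFDR.hammingNorm_le_card (m y)
    have hqk : q * (k:ℝ) ≤ n := by nlinarith [Nat.cast_nonneg (α := ℝ) k]
    have h1 : ∑ i ∈ G, (y i - μ i) * m y i ≤ ∑ i ∈ G, energyFun q μ x i (y i) := by
      refine Finset.sum_le_sum fun i _ => ?_
      by_cases hi : m y i = 0
      · rw [hi, mul_zero]
        exact Set.indicator_nonneg (fun _ _ => meanSq_nonneg _ _) _
      · have : y i ∈ absGe (thr n q x) :=
          (thr_le hn hq (by positivity) hj2 hxn).trans (h.thr_le_abs y hi)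
        rw [h.eq_of_ne_zero y hi, energyFun, Set.indicator_of_mem this]
        exact mul_le_meanSq _ _
    have h2 := sum_le_deviation (μ := μ) (G := G) (g := energyFun q μ x) (s := δ * (l + x)) y
    have h3 := hmean x hx0 hxn
    have h4 := deviation_le_levelDev (μ := μ) (G := G) (g := energyFun q μ)
      (s := fun x => δ * (l + x)) (e := 1) y hj
    simp only [← hx, ← hF] at h4
    have hxj0 : (0:ℝ) < (1 + δ) ^ j := by positivity
    have h5 := noiseEnergy_mul_le hn hq hxj0 (x' := x) (a := 1 + δ)
      (by rw [hxj]; nlinarith) hxj.le hxn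
    have h6 := noiseEnergy_mono hn hq hxj0 hj1 hqk
    have h7 := noiseEnergy_le_penSum hn hq h0 hqk
    have h8 : noiseEnergy n q x ≤ (1 + δ) * (q * penSum n q k + noiseEnergy n q 1) :=
      h5.trans (by gcongr; exact h6.trans h7)
    have h9 : δ * x ≤ δ * (2 * k) := by
      gcongr; exact hxk.trans (by gcongr; linarith)
    linarith
  rw [← Finset.sum_compl_add_sum G]
  linarith

theorem integral_abs_std_le : ∫ z, |z| ∂gaussianReal 0 1 ≤ 1 := by
  have hi : Integrable (fun z : ℝ => (1 + z ^ 2) / 2) (gaussianReal 0 1) :=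
    ((integrable_const 1).add (integrable_pow_gaussianReal 0 2)).div_const 2
  have h : ∫ z, |z| ∂gaussianReal 0 1 ≤ ∫ z, (1 + z ^ 2) / 2 ∂gaussianReal 0 1 := by
    refine integral_mono ?_ hi fun z => ?_
    · simpa using (integrable_pow_gaussianReal 0 1).abs
    · simp only
      rw [← sq_abs z]; nlinarith [sq_nonneg (|z| - 1)]
  rw [integral_div, integral_add (integrable_const 1) (integrable_pow_gaussianReal 0 2),
    integral_sq_std] at h
  simpa using h

theorem integrable_eval_sub_pow (μ : Fin n → ℝ) (i : Fin n) (k : ℕ) :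
    Integrable (fun y : Fin n → ℝ => (y i - μ i) ^ k) (gaussShift μ) := by
  have := integrable_polynomial_gaussianReal (μ i) ((Polynomial.X - Polynomial.C (μ i)) ^ k)
  exact integrable_gaussShift_eval (f := fun x => (x - μ i) ^ k) (by simpa using this)

theorem integrable_eval_sub_abs (μ : Fin n → ℝ) (i : Fin n) :
    Integrable (fun y : Fin n → ℝ => |y i - μ i|) (gaussShift μ) := by
  simpa using (integrable_eval_sub_pow μ i 1).abs

theorem integral_eval_sub_sq (μ : Fin n → ℝ) (i : Fin n) :
    ∫ y : Fin n → ℝ, (y i - μ i) ^ 2 ∂gaussShift μ = 1 := by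
  rw [integral_gaussShift_eval (f := fun x => (x - μ i) ^ 2) (by fun_prop),
    integral_gaussianReal_centered (μ i) fun z => z ^ 2, integral_sq_std]

theorem integral_eval_sub_abs_le (μ : Fin n → ℝ) (i : Fin n) :
    ∫ y : Fin n → ℝ, |y i - μ i| ∂gaussShift μ ≤ 1 := by
  rw [integral_gaussShift_eval (f := fun x => |x - μ i|) (by fun_prop),
    integral_gaussianReal_centered (μ i) fun z => |z|]
  exact integral_abs_std_le

theorem integral_eval_sub (μ : Fin n → ℝ) (i : Fin n) :
    ∫ y : Fin n → ℝ, (y i - μ i) ∂gaussShift μ = 0 := by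
  rw [integral_gaussShift_eval (f := fun x => x - μ i) (by fun_prop),
    integral_gaussianReal_centered (μ i) fun z => z, integral_std]

/-- Expectation of `cross_le`: the linear term in the noise disappears, each coordinate outside G
costs at most 1 + t_1, and each grid level costs V/(4δ). -/
theorem err₂_le (h : IsPenalizedFDR q m) (hn : 0 < n) (hq : 0 < q) (hq1 : q < 1) {δ l V : ℝ}
    (hδ : 0 < δ) (hδ1 : δ < 1) (hqδ : q * (1 + δ) ≤ 1) (hl : 0 ≤ l) (μ : Fin n → ℝ)
    (G : Finset (Fin n))
    (hmean : ∀ x, 0 < x → q * x ≤ n →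
      ∑ i ∈ G, ∫ y, energyFun q μ x i y ∂gaussianReal (μ i) 1 ≤ noiseEnergy n q x + δ * (l + x))
    (hvar : ∀ x, 0 < x → q * x ≤ n →
      ∑ i ∈ G, ∫ y, energyFun q μ x i y ^ 2 ∂gaussianReal (μ i) 1 ≤ V * (l + x)) :
    err₂ q m μ ≤ 2 * (Gᶜ.card * (1 + thr n q 1)
        + (1 + δ) * (q * ∫ y, fdrPen q (m y) ∂gaussShift μ + noiseEnergy n q 1) + 2 * δ * l
        + 4 * δ * ∫ y, (hammingNorm (m y) : ℝ) ∂gaussShift μ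
        + (levels n δ).card * (V / (4 * δ)))
      - ∫ y, fdrPen q (m y) ∂gaussShift μ := by
  have iP : Integrable (fun y => fdrPen q (m y)) (gaussShift μ) :=
    h.integrable_comp_hammingNorm (penSum n q) μ
  have iK : Integrable (fun y => (hammingNorm (m y) : ℝ)) (gaussShift μ) :=
    h.integrable_comp_hammingNorm (fun k => (k:ℝ)) μ
  have iF : Integrable (levelDev μ G (energyFun q μ) (fun x => δ * (l + x)) δ 1) (gaussShift μ) :=
    integrable_levelDev fun x i _ => memLp_energyFun μ x i _
  have t0 : 0 ≤ thr n q 1 := by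
    refine thr_nonneg hn hq one_pos ?_
    have : (1:ℝ) ≤ n := by exact_mod_cast hn
    linarith
  have iB1 : ∀ i : Fin n, Integrable (fun y : Fin n → ℝ =>
      (y i - μ i) ^ 2 + |y i - μ i| * thr n q 1) (gaussShift μ) := fun i =>
    (integrable_eval_sub_pow μ i 2).add ((integrable_eval_sub_abs μ i).mul_const _)
  have iB : Integrable (fun y : Fin n → ℝ => ∑ i ∈ Gᶜ,
      ((y i - μ i) ^ 2 + |y i - μ i| * thr n q 1)) (gaussShift μ) :=
    integrable_finsetSum _ fun i _ => iB1 i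
  have iC1 : ∀ i : Fin n, Integrable (fun y : Fin n → ℝ => (y i - μ i) * μ i) (gaussShift μ) :=
    fun i => by simpa using (integrable_eval_sub_pow μ i 1).mul_const (μ i)
  have iC : Integrable (fun y : Fin n → ℝ => ∑ i ∈ G, (y i - μ i) * μ i) (gaussShift μ) :=
    integrable_finsetSum _ fun i _ => iC1 i
  have iD1 : Integrable (fun y => q * fdrPen q (m y) + noiseEnergy n q 1) (gaussShift μ) :=
    (iP.const_mul q).add (integrable_const _)
  have iD2 : Integrable (fun y => (1 + δ) * (q * fdrPen q (m y) + noiseEnergy n q 1) + 2 * δ * l)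
    (gaussShift μ) := (iD1.const_mul _).add (integrable_const _)
  have iD3 : Integrable (fun y => (1 + δ) * (q * fdrPen q (m y) + noiseEnergy n q 1) + 2 * δ * l
    + 4 * δ * hammingNorm (m y)) (gaussShift μ) := iD2.add (iK.const_mul _)
  have iD : Integrable (fun y => (1 + δ) * (q * fdrPen q (m y) + noiseEnergy n q 1) + 2 * δ * l
    + 4 * δ * hammingNorm (m y)
    + levelDev μ G (energyFun q μ) (fun x => δ * (l + x)) δ 1 y) (gaussShift μ) := iD3.add iF
  have iBD : Integrable (fun y => ∑ i ∈ Gᶜ, ((y i - μ i) ^ 2 + |y i - μ i| * thr n q 1)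
    + ((1 + δ) * (q * fdrPen q (m y) + noiseEnergy n q 1) + 2 * δ * l
    + 4 * δ * hammingNorm (m y)
    + levelDev μ G (energyFun q μ) (fun x => δ * (l + x)) δ 1 y)) (gaussShift μ) := iB.add iD
  have hle := integral_mono (h.integrable_cross μ) (iBD.sub iC) fun y =>
    cross_le h hn hq hq1 hδ hδ1 hqδ hl μ G hmean y
  simp only [Pi.sub_apply] at hle
  rw [integral_sub iBD iC, integral_add iB iD, integral_add iD3 iF,
    integral_add iD2 (iK.const_mul _), integral_add (iD1.const_mul _) (integrable_const _),
    integral_const_mul (1 + δ), integral_add (iP.const_mul q) (integrable_const _),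
    integral_const_mul q, integral_const_mul (4 * δ),
    integral_finsetSum _ (fun i _ => iB1 i), integral_finsetSum _ (fun i _ => iC1 i)] at hle
  have hb : ∑ i ∈ Gᶜ, ∫ y, ((y i - μ i) ^ 2 + |y i - μ i| * thr n q 1) ∂gaussShift μ
      ≤ Gᶜ.card * (1 + thr n q 1) := by
    rw [← nsmul_eq_mul]
    refine Finset.sum_le_card_nsmul _ _ _ fun i _ => ?_
    rw [integral_add (integrable_eval_sub_pow μ i 2) ((integrable_eval_sub_abs μ i).mul_const _),
      integral_mul_const, integral_eval_sub_sq]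
    have := integral_eval_sub_abs_le μ i
    nlinarith
  have hc : ∑ i ∈ G, ∫ y : Fin n → ℝ, (y i - μ i) * μ i ∂gaussShift μ = 0 :=
    Finset.sum_eq_zero fun i _ => by rw [integral_mul_const, integral_eval_sub, zero_mul]
  have hF := integral_levelDev_le (μ := μ) (G := G) (g := energyFun q μ)
    (s := fun x => δ * (l + x)) (δ := δ) (e := 1) (r := V / (4 * δ))
    (fun x i _ => memLp_energyFun μ x i _) (fun j _ => by positivity) fun j hj => by
      refine (hvar _ (by positivity) (level_mul_le hn hδ hqδ hj)).trans (le_of_eq ?_)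
      field_simp
  rw [hc] at hle
  simp only [integral_const, probReal_univ, one_smul] at hle
  unfold err₂
  linarith

end Upper

/-! ### Lower bounds for a vector of spikes -/

section Lower

variable {n : ℕ} {q : ℝ} {m : (Fin n → ℝ) → Fin n → ℝ}

/-- Restoring the missed coordinates to the support must not pay, so their energy is at most a
penalty increment, and subadditivity bounds this increment by the penalty of the missed set alone,
whatever the current support. Since Pen(M) is about Mτ² for M comparable to κ, many missed values
above τ are impossible. -/
theorem penSum_missing (h : IsPenalizedFDR q m) (hn : 0 < n) (hq : 0 < q) (hq1 : q < 1)
    (A : Finset (Fin n)) {H : ℝ} (hH : 0 ≤ H) (y : Fin n → ℝ) :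
    ((A.filter fun i => m y i = 0 ∧ H ≤ |y i|).card : ℝ) * H ^ 2
      ≤ penSum n q (A.filter fun i => m y i = 0 ∧ H ≤ |y i|).card := by
  classical
  set M := A.filter fun i => m y i = 0 ∧ H ≤ |y i| with hM
  have h1 := h.sum_sq_le_penSum_sub y (M := M) (by intro i hi; rw [hM] at hi; simp at hi; exact hi.2.1)
  have h2 : (M.card : ℝ) * H ^ 2 ≤ ∑ i ∈ M, y i ^ 2 := by
    rw [← nsmul_eq_mul]
    refine Finset.card_nsmul_le_sum _ _ _ fun i hi => ?_
    rw [hM] at hi; simp at hi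
    rw [← sq_abs (y i)]
    gcongr; exact hi.2.2
  have h3 : hammingNorm (m y) + M.card ≤ n := by
    have : Disjoint (Finset.univ.filter fun i => m y i ≠ 0) M := by
      rw [Finset.disjoint_left]
      intro i hi hi'
      rw [hM] at hi'; simp at hi hi'; exact hi hi'.2.1
    have h4 := Finset.card_union_of_disjoint this
    have h5 := Finset.card_le_univ ((Finset.univ.filter fun i => m y i ≠ 0) ∪ M)
    rw [h4, Fintype.card_fin] at h5
    exact h5
  have h3' : ((hammingNorm (m y) + M.card : ℕ) : ℝ) ≤ n := by exact_mod_cast h3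
  have h4 := penSum_add_le hn hq (hammingNorm (m y)) M.card
    (by nlinarith [Nat.cast_nonneg (α := ℝ) (hammingNorm (m y) + M.card)])
  linarith

/-- Converse of `card_support_le` at a spike vector: null coordinates above the boundary at a grid
point not exceeding k must all be kept, and there are about q k of them. The factor 1 - |A|/n
accounts for the coordinates that are not null. -/
theorem le_card_support (h : IsPenalizedFDR q m) (hn : 0 < n) (hq : 0 < q) (hq1 : q < 1)
    {δ κ : ℝ} (hδ : 0 < δ) (hκ : 0 ≤ κ) (μ : Fin n → ℝ) (A : Finset (Fin n))
    (hμ : ∀ i ∈ Aᶜ, μ i = 0) (y : Fin n → ℝ) :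
    (A.card : ℝ) - (A.filter fun i => m y i = 0).card
      + ((1 - A.card / n) * q / (1 + δ) - δ) * hammingNorm (m y) - δ * κ
      - levelDev μ Aᶜ (countFun n q) (fun x => δ * (κ + x)) δ 0 y ≤ hammingNorm (m y) := by
  classical
  set k := hammingNorm (m y) with hk
  have hF := levelDev_nonneg (μ := μ) (G := Aᶜ) (g := countFun n q) (s := fun x => δ * (κ + x))
    (δ := δ) (e := 0) y
  have hn' : (0:ℝ) < n := by exact_mod_cast hn
  have hcardA : (A.card : ℝ) ≤ n := by
    exact_mod_cast (by simpa using Finset.card_le_univ A : A.card ≤ n)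
  have hk1 : (k : ℝ) = (A.card : ℝ) - (A.filter fun i => m y i = 0).card
      + (Aᶜ.filter fun i => m y i ≠ 0).card := by
    have e1 : k = (A.filter fun i => m y i ≠ 0).card + (Aᶜ.filter fun i => m y i ≠ 0).card := by
      rw [hk, hammingNorm, ← Finset.card_union_of_disjoint, ← Finset.filter_union,
        Finset.union_compl]
      exact Finset.disjoint_filter_filter disjoint_compl_right
    have e2 := Finset.card_filter_add_card_filter_not (s := A) (fun i => m y i = 0)
    have e2' : ((A.filter fun i => m y i = 0).card : ℝ) + (A.filter fun i => m y i ≠ 0).card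
        = A.card := by exact_mod_cast e2
    have e1' : (k:ℝ) = (A.filter fun i => m y i ≠ 0).card
      + (Aᶜ.filter fun i => m y i ≠ 0).card := by exact_mod_cast e1
    linarith
  rcases Nat.eq_zero_or_pos k with h0 | h0
  · have : (0:ℝ) ≤ (Aᶜ.filter fun i => m y i ≠ 0).card := Nat.cast_nonneg _
    rw [h0] at hk1 ⊢
    push_cast at hk1 ⊢
    have := mul_nonneg hδ.le hκ
    linarith
  obtain ⟨j, hj, hj1, hj2⟩ := exists_level (n := n) hδ h0 (IsPenalizedFDR.hammingNorm_le_card (m y))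
  -- Shift 0: the grid point below k has the higher boundary, so every coordinate counted is kept.
  set x := (1 + δ) ^ j with hx
  have hx0 : 0 < x := by positivity
  have hxn' : x ≤ n := (mem_levels hn hδ).1 hj
  have hxn : q * x ≤ n := by nlinarith
  have hxk : (k:ℝ) / (1 + δ) ≤ x := by
    rw [div_le_iff₀ (by positivity), hx, ← pow_succ]; exact hj2
  have h1 : ∑ i ∈ Aᶜ, countFun n q x i (y i) ≤ (Aᶜ.filter fun i => m y i ≠ 0).card := by
    rw [Finset.card_filter]; push_cast
    refine Finset.sum_le_sum fun i _ => ?_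
    by_cases hi : y i ∈ absGe (thr n q x)
    · have : m y i ≠ 0 := h.ne_zero_of_thr_le hq hq1 y hx0 hj1 hi
      simp [countFun, this, Set.indicator_of_mem hi]
    · rw [countFun, Set.indicator_of_notMem hi]; split_ifs <;> norm_num
  have h2 := deviation_le_sum (μ := μ) (G := Aᶜ) (g := countFun n q x) (s := δ * (κ + x)) y
  have h3 : ∑ i ∈ Aᶜ, ∫ z, countFun n q x i z ∂gaussianReal (μ i) 1
      = (1 - A.card / n) * (q * x) := by
    rw [← two_tail_thr hn hq hx0 hxn, Finset.sum_congr rfl fun i hi => by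
      rw [integral_countFun, hμ i hi], Finset.sum_const, Finset.card_compl, Fintype.card_fin,
      nsmul_eq_mul, Nat.cast_sub (by simpa using Finset.card_le_univ A)]
    field_simp
  have h4 := deviation_le_levelDev (μ := μ) (G := Aᶜ) (g := countFun n q)
    (s := fun x => δ * (κ + x)) (e := 0) y hj
  simp only [add_zero, ← hx] at h4
  have h5 : (1 - A.card / n) * q * (k / (1 + δ)) ≤ (1 - A.card / n) * q * x := by
    have : 0 ≤ 1 - (A.card:ℝ) / n := sub_nonneg.2 ((div_le_one hn').2 hcardA)
    gcongr
  have h6 : δ * x ≤ δ * k := by gcongr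
  have h7 : (1 - A.card / n) * q / (1 + δ) * k = (1 - A.card / n) * q * (k / (1 + δ)) := by ring
  rw [h3] at h2
  rw [hk1] at h7 ⊢
  rw [← hk1] at h7 ⊢
  nlinarith

/-- On null coordinates the product is y² when kept and 0 otherwise, so it is bounded below by the
noise energy above the grid point. A spike contributes z² when kept and at worst -H|z| when missed.
-/
theorem le_cross (h : IsPenalizedFDR q m) (hn : 0 < n) (hq : 0 < q) (hq1 : q < 1) {δ l H : ℝ}
    (hδ : 0 < δ) (hl : 0 ≤ l) (μ : Fin n → ℝ) (A : Finset (Fin n))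
    (hμ : ∀ i ∈ Aᶜ, μ i = 0) (hμA : ∀ i ∈ A, |μ i| ≤ H) (y : Fin n → ℝ) :
    (1 - A.card / n) * q / (1 + δ) * fdrPen q (m y) - δ * l - δ * hammingNorm (m y)
        - levelDev μ Aᶜ (energyFun q μ) (fun x => δ * (l + x)) δ 0 y
        - ∑ i ∈ A, H * |y i - μ i|
      ≤ ∑ i, (y i - μ i) * (m y i - μ i) := by
  classical
  rw [fdrPen_eq_penSum]
  set k := hammingNorm (m y) with hk
  set F := levelDev μ Aᶜ (energyFun q μ) (fun x => δ * (l + x)) δ 0 y with hF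
  have hF0 : 0 ≤ F := levelDev_nonneg y
  have hn' : (0:ℝ) < n := by exact_mod_cast hn
  have hcardA : (A.card : ℝ) ≤ n := by
    exact_mod_cast (by simpa using Finset.card_le_univ A : A.card ≤ n)
  have hA : -∑ i ∈ A, H * |y i - μ i| ≤ ∑ i ∈ A, (y i - μ i) * (m y i - μ i) := by
    rw [← Finset.sum_neg_distrib]
    refine Finset.sum_le_sum fun i hi => ?_
    have hH := hμA i hi
    by_cases hi : m y i = 0
    · rw [hi]
      have : |(y i - μ i) * (0 - μ i)| ≤ H * |y i - μ i| := by
        rw [abs_mul, zero_sub, abs_neg, mul_comm]; gcongr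
      linarith [neg_abs_le ((y i - μ i) * (0 - μ i))]
    · rw [h.eq_of_ne_zero y hi]
      have := mul_nonneg ((abs_nonneg (μ i)).trans hH) (abs_nonneg (y i - μ i))
      nlinarith [sq_nonneg (y i - μ i)]
  have hAc0 : ∀ i ∈ Aᶜ, 0 ≤ (y i - μ i) * (m y i - μ i) := by
    intro i hi
    rw [hμ i hi]
    by_cases hi : m y i = 0
    · simp [hi]
    · rw [h.eq_of_ne_zero y hi]; simp only [sub_zero]; nlinarith [sq_nonneg (y i)]
  have hAc : (1 - A.card / n) * q / (1 + δ) * penSum n q k - δ * l - δ * k - F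
      ≤ ∑ i ∈ Aᶜ, (y i - μ i) * (m y i - μ i) := by
    rcases Nat.eq_zero_or_pos k with h0 | h0
    · have := Finset.sum_nonneg hAc0
      rw [h0, penSum_zero]
      push_cast
      have := mul_nonneg hδ.le hl
      linarith
    obtain ⟨j, hj, hj1, hj2⟩ := exists_level (n := n) hδ h0
      (IsPenalizedFDR.hammingNorm_le_card (m y))
    set x := (1 + δ) ^ j with hx
    have hx0 : 0 < x := by positivity
    have hxn' : x ≤ n := (mem_levels hn hδ).1 hj
    have hxn : q * x ≤ n := by nlinarith
    have hkn : (k:ℝ) ≤ n := by exact_mod_cast IsPenalizedFDR.hammingNorm_le_card (m y)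
    have hqk : q * (k:ℝ) ≤ n := by nlinarith [Nat.cast_nonneg (α := ℝ) k]
    have hxk : (k:ℝ) ≤ (1 + δ) * x := by rw [mul_comm, hx, ← pow_succ]; exact hj2
    have h1 : ∑ i ∈ Aᶜ, energyFun q μ x i (y i) ≤ ∑ i ∈ Aᶜ, (y i - μ i) * (m y i - μ i) := by
      refine Finset.sum_le_sum fun i hi => ?_
      by_cases hiy : y i ∈ absGe (thr n q x)
      · have : m y i ≠ 0 := h.ne_zero_of_thr_le hq hq1 y hx0 hj1 hiy
        rw [energyFun, Set.indicator_of_mem hiy, h.eq_of_ne_zero y this, hμ i hi, meanSq]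
        apply le_of_eq; ring
      · rw [energyFun, Set.indicator_of_notMem hiy]; exact hAc0 i hi
    have h2 := deviation_le_sum (μ := μ) (G := Aᶜ) (g := energyFun q μ x) (s := δ * (l + x)) y
    have h3 : ∑ i ∈ Aᶜ, ∫ z, energyFun q μ x i z ∂gaussianReal (μ i) 1
        = (1 - A.card / n) * noiseEnergy n q x := by
      have e : ∀ i ∈ Aᶜ, ∫ z, energyFun q μ x i z ∂gaussianReal (μ i) 1
          = tailEnergy (thr n q x) := by
        intro i hi
        have e0 : meanSq 0 = fun z => z ^ 2 := by ext z; simp [meanSq]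
        rw [energyFun, hμ i hi, e0, tailEnergy]
      rw [Finset.sum_congr rfl e, Finset.sum_const, Finset.card_compl, Fintype.card_fin,
        nsmul_eq_mul, Nat.cast_sub (by simpa using Finset.card_le_univ A), noiseEnergy]
      field_simp
    have h4 := deviation_le_levelDev (μ := μ) (G := Aᶜ) (g := energyFun q μ)
      (s := fun x => δ * (l + x)) (e := 0) y hj
    simp only [add_zero, ← hx, ← hF] at h4
    have h5 : q * penSum n q k / (1 + δ) ≤ noiseEnergy n q x := by
      rw [div_le_iff₀ (by positivity), mul_comm (noiseEnergy n q x)]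
      exact (penSum_le_noiseEnergy hn hq h0 hqk).trans (noiseEnergy_mul_le hn hq hx0 hj1 hxk hqk)
    have h6 : (1 - A.card / n) * (q * penSum n q k / (1 + δ))
        ≤ (1 - A.card / n) * noiseEnergy n q x := by
      have : 0 ≤ 1 - (A.card:ℝ) / n := sub_nonneg.2 ((div_le_one hn').2 hcardA)
      gcongr
    have h7 : δ * x ≤ δ * k := by gcongr
    have h8 : (1 - A.card / n) * q / (1 + δ) * penSum n q k
      = (1 - A.card / n) * (q * penSum n q k / (1 + δ)) := by ring
    rw [h3] at h2
    linarith
  rw [← Finset.sum_compl_add_sum A]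
  linarith

theorem le_err₂ (h : IsPenalizedFDR q m) (hn : 0 < n) (hq : 0 < q) (hq1 : q < 1) {δ l H V : ℝ}
    (hδ : 0 < δ) (hl : 0 ≤ l) (hH : 0 ≤ H) (μ : Fin n → ℝ)
    (A : Finset (Fin n))
    (hμ : ∀ i ∈ Aᶜ, μ i = 0) (hμA : ∀ i ∈ A, |μ i| ≤ H)
    (hvar : ∀ x, 0 < x → q * x ≤ n →
      ∑ i ∈ Aᶜ, ∫ y, energyFun q μ x i y ^ 2 ∂gaussianReal (μ i) 1 ≤ V * (l + x)) :
    2 * ((1 - A.card / n) * q / (1 + δ) * ∫ y, fdrPen q (m y) ∂gaussShift μ - δ * l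
        - δ * ∫ y, (hammingNorm (m y) : ℝ) ∂gaussShift μ
        - (levels n δ).card * (V / (4 * δ)) - A.card * H)
      - ∫ y, fdrPen q (m y) ∂gaussShift μ ≤ err₂ q m μ := by
  have iP : Integrable (fun y => fdrPen q (m y)) (gaussShift μ) :=
    h.integrable_comp_hammingNorm (penSum n q) μ
  have iK : Integrable (fun y => (hammingNorm (m y) : ℝ)) (gaussShift μ) :=
    h.integrable_comp_hammingNorm (fun k => (k:ℝ)) μ
  have iF : Integrable (levelDev μ Aᶜ (energyFun q μ) (fun x => δ * (l + x)) δ 0)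
    (gaussShift μ) := integrable_levelDev fun x i _ => memLp_energyFun μ x i _
  have iA1 : ∀ i : Fin n, Integrable (fun y : Fin n → ℝ => H * |y i - μ i|) (gaussShift μ) :=
    fun i => (integrable_eval_sub_abs μ i).const_mul _
  have iA : Integrable (fun y : Fin n → ℝ => ∑ i ∈ A, H * |y i - μ i|) (gaussShift μ) :=
    integrable_finsetSum _ fun i _ => iA1 i
  have i1 : Integrable (fun y => (1 - A.card / n) * q / (1 + δ) * fdrPen q (m y) - δ * l)
    (gaussShift μ) := (iP.const_mul _).sub (integrable_const _)
  have i2 : Integrable (fun y => (1 - A.card / n) * q / (1 + δ) * fdrPen q (m y) - δ * l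
    - δ * hammingNorm (m y)) (gaussShift μ) := i1.sub (iK.const_mul _)
  have i3 : Integrable (fun y => (1 - A.card / n) * q / (1 + δ) * fdrPen q (m y) - δ * l
    - δ * hammingNorm (m y) - levelDev μ Aᶜ (energyFun q μ) (fun x => δ * (l + x)) δ 0 y)
    (gaussShift μ) := i2.sub iF
  have hle := integral_mono (i3.sub iA) (h.integrable_cross μ) fun y =>
    le_cross h hn hq hq1 hδ hl μ A hμ hμA y
  simp only [Pi.sub_apply] at hle
  rw [integral_sub i3 iA, integral_sub i2 iF, integral_sub i1 (iK.const_mul _),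
    integral_sub (iP.const_mul _) (integrable_const _), integral_const_mul,
    integral_const_mul δ fun y => (hammingNorm (m y) : ℝ),
    integral_finsetSum _ (fun i _ => iA1 i)] at hle
  have hb : ∑ i ∈ A, ∫ y : Fin n → ℝ, H * |y i - μ i| ∂gaussShift μ ≤ A.card * H := by
    rw [← nsmul_eq_mul]
    refine Finset.sum_le_card_nsmul _ _ _ fun i _ => ?_
    rw [integral_const_mul]
    have := integral_eval_sub_abs_le μ i
    nlinarith
  have hF := integral_levelDev_le (μ := μ) (G := Aᶜ) (g := energyFun q μ)
    (s := fun x => δ * (l + x)) (δ := δ) (e := 0) (r := V / (4 * δ))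
    (fun x i _ => memLp_energyFun μ x i _) (fun j _ => by positivity) fun j hj => by
      refine (hvar _ (by positivity) ?_).trans (le_of_eq ?_)
      · have h1 := (mem_levels hn hδ).1 hj
        have : (0:ℝ) < (1 + δ) ^ j := by positivity
        simp only [add_zero]; nlinarith
      · field_simp
  simp only [integral_const, probReal_univ, one_smul] at hle
  unfold err₂
  linarith

/-- At the origin the error functional is nonnegative. -/
theorem err₂_zero_nonneg (h : IsPenalizedFDR q m) : 0 ≤ err₂ q m 0 := by
  have iP : Integrable (fun y => fdrPen q (m y)) (gaussShift (0 : Fin n → ℝ)) :=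
    h.integrable_comp_hammingNorm (penSum n q) 0
  unfold err₂
  rw [← integral_const_mul, ← integral_sub ((h.integrable_cross 0).const_mul 2) iP]
  refine integral_nonneg fun y => ?_
  -- Comparison with the zero vector gives Pen(m) ≤ ‖y‖² - ‖y - m‖² = ⟨y, m⟩, and ⟨y, m⟩ ≥ 0 because
  -- entries of m are 0 or y_i; hence 2⟨y, m⟩ - Pen(m) ≥ 0 pointwise.
  have h1 := h.minimizes y 0
  have h2 : fdrPen q (0 : Fin n → ℝ) = 0 := by
    rw [fdrPen_eq_penSum, hammingNorm_zero, penSum_zero]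
  simp only [complexity, h2, Pi.zero_apply, sub_zero, add_zero] at h1 ⊢
  have h3 : ∑ i, y i ^ 2 - ∑ i, (y i - m y i) ^ 2 = ∑ i, y i * m y i := by
    rw [← Finset.sum_sub_distrib]
    refine Finset.sum_congr rfl fun i _ => ?_
    by_cases hi : m y i = 0
    · simp [hi]
    · rw [h.eq_of_ne_zero y hi]; ring
  have h4 : 0 ≤ ∑ i, y i * m y i := Finset.sum_nonneg fun i _ => by
    by_cases hi : m y i = 0
    · simp [hi]
    · rw [h.eq_of_ne_zero y hi]; exact mul_self_nonneg _
  linarith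

end Lower

/-! ### The sparsity classes -/

theorem absRearr_antitone {n : ℕ} (μ : Fin n → ℝ) : Antitone (absRearr μ) := by
  intro i j hij
  have := Tuple.monotone_sort (fun i => -|μ i|) hij
  simpa [absRearr] using this

theorem sum_absRearr {n : ℕ} (μ : Fin n → ℝ) (f : ℝ → ℝ) :
    ∑ k, f (absRearr μ k) = ∑ i, f |μ i| :=
  Equiv.sum_comp (Tuple.sort fun i => -|μ i|) fun i => f |μ i|

theorem card_lt_absRearr {n : ℕ} (μ : Fin n → ℝ) (x : ℝ) :
    (Finset.univ.filter fun k => x < absRearr μ k).card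
      = (Finset.univ.filter fun i => x < |μ i|).card := by
  rw [Finset.card_filter, Finset.card_filter]
  exact Equiv.sum_comp (Tuple.sort fun i => -|μ i|) fun i => if x < |μ i| then 1 else 0

/-- If distinct nonzero entries are dominated by distinct terms of a decreasing sequence, then so is
the decreasing rearrangement. -/
theorem absRearr_le_of_rank {n : ℕ} {μ : Fin n → ℝ} {a : ℕ → ℝ} (ha : Antitone a)
    (ha0 : ∀ k, 0 ≤ a k) {f : Fin n → ℕ} (hf : ∀ i j, μ i ≠ 0 → μ j ≠ 0 → f i = f j → i = j)
    (hfa : ∀ i, μ i ≠ 0 → |μ i| ≤ a (f i)) (k : Fin n) : absRearr μ k ≤ a k := by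
  by_contra hcon
  push Not at hcon
  -- Otherwise k + 1 entries exceed a_k, whereas by monotonicity their distinct ranks all lie below
  -- k.
  have h1 : Finset.Iic k ⊆ Finset.univ.filter fun j => a k < absRearr μ j := by
    intro j hj
    simp only [Finset.mem_filter, Finset.mem_univ, true_and]
    exact hcon.trans_le (absRearr_antitone μ (Finset.mem_Iic.1 hj))
  have h2 := Finset.card_le_card h1
  rw [Fin.card_Iic, card_lt_absRearr] at h2
  have h3 : (Finset.univ.filter fun i => a k < |μ i|).card ≤ (Finset.range k).card := by
    have hne : ∀ i, a k < |μ i| → μ i ≠ 0 := fun i hi h0 => by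
      rw [h0, abs_zero] at hi; exact absurd hi (not_lt.2 (ha0 k))
    refine Finset.card_le_card_of_injOn f ?_ ?_
    · intro i hi
      simp only [Finset.coe_filter, Finset.mem_univ, true_and, Set.mem_ofPred_eq] at hi
      have h4 := hi.trans_le (hfa i (hne i hi))
      simp only [Finset.coe_range, Set.mem_Iio]
      by_contra hge
      exact absurd (ha (not_lt.1 hge)) (not_le.2 h4)
    · intro i hi j hj hij
      simp only [Finset.coe_filter, Finset.mem_univ, true_and, Set.mem_ofPred_eq] at hi hj
      exact hf i j (hne i hi) (hne j hj) hij
  rw [Finset.card_range] at h3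
  omega

namespace SparsityClass

/-- The exponent of the class, with `0` for nearly black vectors. -/
def expo : SparsityClass → ℝ
  | nearlyBlack => 0
  | strong p => p
  | weak p => p

theorem expo_nonneg {c : SparsityClass} (hc : c.Admissible) : 0 ≤ c.expo := by
  cases c with
  | nearlyBlack => exact le_rfl
  | strong p => exact hc.1.le
  | weak p => exact hc.1.le

theorem expo_lt_two {c : SparsityClass} (hc : c.Admissible) : c.expo < 2 := by
  cases c with
  | nearlyBlack => exact two_pos
  | strong p => exact hc.2
  | weak p => exact hc.2

theorem u_pos {c : SparsityClass} (hc : c.Admissible) : 0 < c.u := by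
  cases c with
  | nearlyBlack => exact one_pos
  | strong p => exact one_pos
  | weak p => have := hc.2; simp only [u]; linarith

theorem u_le_one {c : SparsityClass} (hc : c.Admissible) : c.u ≤ 1 := by
  cases c with
  | nearlyBlack => exact le_rfl
  | strong p => exact le_rfl
  | weak p => have := hc.1; simp only [u]; linarith

theorem weak_bound_eq {n : ℕ} {p η : ℝ} (hp : 0 < p) (hη : 0 ≤ η) {s : ℝ} (hs : 0 < s) :
    η * (n : ℝ) ^ (1 / p) * s ^ (-(1 / p)) = (n * η ^ p / s) ^ (1 / p) := by
  have hn : (0:ℝ) ≤ n := Nat.cast_nonneg n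
  rw [Real.div_rpow (by positivity) hs.le, Real.mul_rpow hn (by positivity), ← Real.rpow_mul hη,
    mul_one_div_cancel hp.ne', Real.rpow_one, Real.rpow_neg hs.le]
  rw [div_eq_mul_inv]; ring

theorem absRearr_le_of_mem_weak {n : ℕ} {p η : ℝ} (hp : 0 < p) (hη : 0 ≤ η) {μ : Fin n → ℝ}
    (hμ : μ ∈ (weak p).ball n η) (k : Fin n) :
    absRearr μ k ≤ (n * η ^ p / ((k : ℝ) + 1)) ^ (1 / p) := by
  rw [← weak_bound_eq hp hη (by positivity)]; exact hμ k

/-- Number of coordinates exceeding a level. -/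
theorem card_gt_mul_le {c : SparsityClass} (hc : c.Admissible) {n : ℕ} (hn : 0 < n) {η : ℝ}
    (hη : 0 ≤ η) {μ : Fin n → ℝ} (hμ : μ ∈ c.ball n η) {x : ℝ} (hx : 0 < x) :
    ((Finset.univ.filter fun i => x < |μ i|).card : ℝ) * x ^ c.expo ≤ n * c.sparsity η := by
  have hn' : (0:ℝ) < n := by exact_mod_cast hn
  cases c with
  | nearlyBlack =>
    simp only [expo, Real.rpow_zero, mul_one, sparsity]
    have h : (hammingNorm μ : ℝ) ≤ η * n := hμ
    rw [mul_comm]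
    refine le_trans ?_ h
    unfold hammingNorm
    gcongr with i _
    intro h h0; rw [h0, abs_zero] at h; exact absurd h (not_lt.2 hx.le)
  | strong p =>
    simp only [expo, sparsity]
    have h : 1 / (n : ℝ) * ∑ i, |μ i| ^ p ≤ η ^ p := hμ
    rw [one_div, inv_mul_le_iff₀ hn'] at h
    refine le_trans ?_ h
    rw [← nsmul_eq_mul]
    calc _ ≤ ∑ i ∈ Finset.univ.filter fun i => x < |μ i|, |μ i| ^ p := by
          refine Finset.card_nsmul_le_sum _ _ _ fun i hi => ?_
          exact Real.rpow_le_rpow hx.le (Finset.mem_filter.1 hi).2.le hc.1.le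
      _ ≤ _ := Finset.sum_le_sum_of_subset_of_nonneg (Finset.filter_subset _ _)
          fun i _ _ => by positivity
  | weak p =>
    obtain ⟨hp, hp2⟩ : 0 < p ∧ p < 2 := hc
    simp only [expo, sparsity]
    rw [← card_lt_absRearr]
    set S := Finset.univ.filter fun k => x < absRearr μ k with hS
    rcases S.eq_empty_or_nonempty with h0 | h0
    · rw [h0]; simp; positivity
    -- The largest index at which the rearrangement exceeds x; indices start at 0, so at most k + 1
    -- entries exceed x.
    set k := S.max' h0
    have hk : x < absRearr μ k := (Finset.mem_filter.1 (S.max'_mem h0)).2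
    have hcard : S.card ≤ k + 1 := by
      have : S ⊆ Finset.Iic k := fun j hj => Finset.mem_Iic.2 (S.le_max' j hj)
      simpa using Finset.card_le_card this
    have h1 := hk.le.trans (absRearr_le_of_mem_weak hp hη hμ k)
    have h2 : x ^ p ≤ n * η ^ p / ((k : ℝ) + 1) := by
      calc x ^ p ≤ ((n * η ^ p / ((k : ℝ) + 1)) ^ (1 / p)) ^ p := by gcongr
        _ = _ := by
          rw [← Real.rpow_mul (by positivity), one_div_mul_cancel hp.ne', Real.rpow_one]
    rw [le_div_iff₀ (by positivity)] at h2
    have hcard' : (S.card : ℝ) ≤ (k : ℝ) + 1 := by exact_mod_cast hcard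
    nlinarith [Real.rpow_pos_of_pos hx p]

theorem sum_rpow_tail_le {r : ℝ} (hr : 1 < r) {K n : ℕ} (hK : 1 ≤ K) :
    ∑ k ∈ Finset.Ico K n, ((k : ℝ) + 1) ^ (-r) ≤ (K : ℝ) ^ (1 - r) / (r - 1) := by
  have hK0 : (0:ℝ) < K := by exact_mod_cast hK
  rcases le_or_gt n K with h | h
  · rw [Finset.Ico_eq_empty (by omega), Finset.sum_empty]
    have : 0 < r - 1 := by linarith
    positivity
  have h1 := AntitoneOn.sum_le_integral_Ico (f := fun s : ℝ => s ^ (-r)) h.le (by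
    intro s hs t _ hst
    exact Real.rpow_le_rpow_of_nonpos (hK0.trans_le hs.1) hst (by linarith))
  have h2 : ∫ s in (K:ℝ)..n, s ^ (-r) = ((n:ℝ) ^ (-r + 1) - (K:ℝ) ^ (-r + 1)) / (-r + 1) := by
    refine integral_rpow (Or.inr ⟨by linarith, ?_⟩)
    rw [Set.uIcc_of_le (by exact_mod_cast h.le)]
    intro h0; exact absurd h0.1 (not_le.2 hK0)
  rw [h2] at h1
  push_cast at h1
  refine h1.trans ?_
  have h3 : ((n:ℝ) ^ (-r + 1) - (K:ℝ) ^ (-r + 1)) / (-r + 1)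
      = ((K:ℝ) ^ (1 - r) - (n:ℝ) ^ (1 - r)) / (r - 1) := by
    rw [show -r + 1 = -(r - 1) by ring, div_neg, ← neg_div, neg_sub,
      show -(r - 1) = 1 - r by ring]
  rw [h3]
  have : 0 < r - 1 := by linarith
  gcongr
  have : 0 ≤ (n:ℝ) ^ (1 - r) := by positivity
  linarith

/-- Truncated energy of the members of a class. -/
theorem u_mul_sum_min_le {c : SparsityClass} (hc : c.Admissible) {n : ℕ} (hn : 0 < n) {η : ℝ}
    (hη : 0 ≤ η) (hs : 0 < c.sparsity η) {μ : Fin n → ℝ} (hμ : μ ∈ c.ball n η) {x : ℝ}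
    (hx : 0 < x) :
    c.u * ∑ i, min (μ i ^ 2) (x ^ 2) ≤ n * c.sparsity η * x ^ (2 - c.expo) + x ^ 2 := by
  have hn' : (0:ℝ) < n := by exact_mod_cast hn
  cases c with
  | nearlyBlack =>
    have h : (hammingNorm μ : ℝ) ≤ η * n := hμ
    simp only [u, one_mul, expo, sub_zero, sparsity]
    have e : ∑ i, min (μ i ^ 2) (x ^ 2) ≤ hammingNorm μ * x ^ 2 := by
      rw [hammingNorm, Finset.card_filter]; push_cast
      rw [Finset.sum_mul]
      refine Finset.sum_le_sum fun i _ => ?_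
      by_cases hi : μ i = 0
      · simp [hi]
      · simp [hi]
    have e2 : x ^ (2:ℝ) = x ^ 2 := by exact_mod_cast Real.rpow_natCast x 2
    rw [e2]
    nlinarith [sq_nonneg x]
  | strong p =>
    obtain ⟨hp, hp2⟩ : 0 < p ∧ p < 2 := hc
    have h : 1 / (n : ℝ) * ∑ i, |μ i| ^ p ≤ η ^ p := hμ
    rw [one_div, inv_mul_le_iff₀ hn'] at h
    simp only [u, one_mul, expo, sparsity]
    -- Interpolation: min(a², x²) ≤ a^p x^{2-p} for 0 ≤ p ≤ 2.
    have e : ∑ i, min (μ i ^ 2) (x ^ 2) ≤ ∑ i, |μ i| ^ p * x ^ (2 - p) := by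
      refine Finset.sum_le_sum fun i _ => ?_
      rcases (abs_nonneg (μ i)).eq_or_lt with h0 | h0
      · rw [← h0, Real.zero_rpow hp.ne', zero_mul]
        exact (min_le_left _ _).trans (by rw [← sq_abs, ← h0]; simp)
      have key : ∀ a : ℝ, 0 < a → a ^ 2 = a ^ p * a ^ (2 - p) := fun a ha => by
        rw [← Real.rpow_add ha]; norm_num
      rcases le_total |μ i| x with h1 | h1
      · refine (min_le_left _ _).trans ?_
        rw [← sq_abs, key _ h0]
        have : 0 ≤ 2 - p := by linarith
        gcongr
      · refine (min_le_right _ _).trans ?_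
        rw [key _ hx]; gcongr
    rw [← Finset.sum_mul] at e
    have : 0 ≤ x ^ (2 - p) := by positivity
    nlinarith [sq_nonneg x]
  | weak p =>
    obtain ⟨hp, hp2⟩ : 0 < p ∧ p < 2 := hc
    simp only [u, expo, sparsity] at hs ⊢
    set N := n * η ^ p with hN
    have hN0 : 0 < N := mul_pos hn' hs
    set r := 2 / p with hr
    have hr1 : 1 < r := by rw [hr, lt_div_iff₀ hp]; linarith
    -- The rank at which the extremal sequence (N/k)^{1/p} crosses the level x; before it the
    -- truncated terms are x², after it they are summed as a power tail.
    set k0 := N * x ^ (-p) with hk0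
    have hk00 : 0 < k0 := by positivity
    set K := ⌈k0⌉₊ with hK
    have hK1 : 1 ≤ K := Nat.ceil_pos.2 hk00
    have hKk : k0 ≤ K := Nat.le_ceil _
    have hKk1 : (K:ℝ) ≤ k0 + 1 := (Nat.ceil_lt_add_one hk00.le).le
    have h1 : ∑ i, min (μ i ^ 2) (x ^ 2) = ∑ k, min (absRearr μ k ^ 2) (x ^ 2) := by
      rw [sum_absRearr μ fun a => min (a ^ 2) (x ^ 2)]; simp [sq_abs]
    have h2 : ∀ k : Fin n, min (absRearr μ k ^ 2) (x ^ 2)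
        ≤ min (N ^ r * ((k : ℝ) + 1) ^ (-r)) (x ^ 2) := by
      intro k
      refine min_le_min ?_ le_rfl
      have h := absRearr_le_of_mem_weak hp hη hμ k
      have h0 : 0 ≤ absRearr μ k := abs_nonneg _
      calc absRearr μ k ^ 2 ≤ ((N / ((k : ℝ) + 1)) ^ (1 / p)) ^ 2 := by gcongr
        _ = N ^ r * ((k : ℝ) + 1) ^ (-r) := by
          rw [← Real.rpow_natCast, ← Real.rpow_mul (by positivity), Real.div_rpow hN0.le
            (by positivity), Real.rpow_neg (by positivity), div_eq_mul_inv]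
          have : 1 / p * ((2:ℕ):ℝ) = r := by rw [hr]; push_cast; ring
          rw [this]
    have h3 : ∑ k : Fin n, min (N ^ r * ((k : ℝ) + 1) ^ (-r)) (x ^ 2)
        ≤ K * x ^ 2 + N ^ r * ((K : ℝ) ^ (1 - r) / (r - 1)) := by
      rw [Fin.sum_univ_eq_sum_range (fun k => min (N ^ r * ((k : ℝ) + 1) ^ (-r)) (x ^ 2)) n]
      have hsub : Finset.range n ⊆ Finset.range K ∪ Finset.Ico K n := by
        intro k hk; simp at hk ⊢; omega
      refine (Finset.sum_le_sum_of_subset_of_nonneg hsub fun k _ _ => by positivity).trans ?_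
      rw [Finset.sum_union (by
        rw [Finset.disjoint_left]; intro k hk hk'; simp at hk hk'; omega)]
      gcongr
      · have := Finset.sum_le_card_nsmul (Finset.range K)
          (fun k : ℕ => min (N ^ r * ((k : ℝ) + 1) ^ (-r)) (x ^ 2)) (x ^ 2)
          fun k _ => min_le_right _ _
        simpa using this
      · refine (Finset.sum_le_sum fun k _ => min_le_left _ _).trans ?_
        rw [← Finset.mul_sum]
        have := sum_rpow_tail_le hr1 (n := n) hK1
        gcongr
    have h4 : (K : ℝ) ^ (1 - r) ≤ k0 ^ (1 - r) :=
      Real.rpow_le_rpow_of_nonpos hk00 hKk (by linarith)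
    have h5 : N ^ r * k0 ^ (1 - r) = k0 * x ^ 2 := by
      have : N = k0 * x ^ p := by
        rw [hk0, mul_assoc, ← Real.rpow_add hx]; simp
      rw [this, Real.mul_rpow hk00.le (by positivity), ← Real.rpow_mul hx.le,
        mul_right_comm, ← Real.rpow_add hk00]
      have e1 : p * r = (2:ℕ) := by rw [hr]; push_cast; field_simp
      rw [e1, Real.rpow_natCast]; norm_num
    have h6 : N * x ^ (2 - p) = k0 * x ^ 2 := by
      have e : x ^ (2 - p) = x ^ (-p) * x ^ 2 := by
        rw [← Real.rpow_natCast x 2, ← Real.rpow_add hx]; congr 1; push_cast; ring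
      rw [e, hk0]; ring
    rw [h1, h6]
    have h7 : ∑ k, min (absRearr μ k ^ 2) (x ^ 2) ≤ (k0 + 1) * x ^ 2 + k0 * x ^ 2 / (r - 1) := by
      refine (Finset.sum_le_sum fun k _ => h2 k).trans (h3.trans ?_)
      rw [← h5, ← mul_div_assoc]
      have : 0 < r - 1 := by linarith
      gcongr
    -- Plateau plus tail amount to k₀x²(1 + 1/(r - 1)) = k₀x² r/(r - 1), and u is exactly the
    -- reciprocal of that factor.
    have hu : 1 - p / 2 = (r - 1) / r := by rw [hr]; field_simp
    have hu1 : 1 - p / 2 ≤ 1 := by linarith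
    have hu0 : 0 < 1 - p / 2 := by linarith
    have h8 : (1 - p / 2) * ((k0 + 1) * x ^ 2 + k0 * x ^ 2 / (r - 1))
        = k0 * x ^ 2 + (1 - p / 2) * x ^ 2 := by
      rw [hu]
      have : r - 1 ≠ 0 := by linarith
      have : r ≠ 0 := by linarith
      field_simp; ring
    calc _ ≤ (1 - p / 2) * ((k0 + 1) * x ^ 2 + k0 * x ^ 2 / (r - 1)) := by gcongr
      _ = _ := h8
      _ ≤ _ := by nlinarith [sq_nonneg x]

/-- Vectors with few spikes of bounded height belong to the class. -/
theorem mem_ball_of_card_mul_le {c : SparsityClass} (hc : c.Admissible) {n : ℕ} (hn : 0 < n)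
    {η : ℝ} (hη : 0 ≤ η) {μ : Fin n → ℝ} {A : Finset (Fin n)} {h : ℝ} (hh : 0 < h)
    (h0 : ∀ i, i ∉ A → μ i = 0) (hA : ∀ i ∈ A, |μ i| ≤ h)
    (hcard : (A.card : ℝ) * h ^ c.expo ≤ n * c.sparsity η) : μ ∈ c.ball n η := by
  have hn' : (0:ℝ) < n := by exact_mod_cast hn
  have hsub : (Finset.univ.filter fun i => μ i ≠ 0) ⊆ A := by
    intro i hi
    by_contra hiA
    exact (Finset.mem_filter.1 hi).2 (h0 i hiA)
  cases c with
  | nearlyBlack =>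
    simp only [expo, Real.rpow_zero, mul_one, sparsity] at hcard
    show (hammingNorm μ : ℝ) ≤ η * n
    rw [mul_comm]
    refine le_trans ?_ hcard
    exact_mod_cast Finset.card_le_card hsub
  | strong p =>
    obtain ⟨hp, hp2⟩ : 0 < p ∧ p < 2 := hc
    simp only [expo, sparsity] at hcard
    show 1 / (n : ℝ) * ∑ i, |μ i| ^ p ≤ η ^ p
    rw [one_div, inv_mul_le_iff₀ hn']
    refine le_trans ?_ hcard
    rw [← Finset.sum_subset (Finset.subset_univ A) fun i _ hi => by
      rw [h0 i hi, abs_zero, Real.zero_rpow hp.ne'], ← nsmul_eq_mul]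
    exact Finset.sum_le_card_nsmul _ _ _ fun i hi =>
      Real.rpow_le_rpow (abs_nonneg _) (hA i hi) hp.le
  | weak p =>
    obtain ⟨hp, hp2⟩ : 0 < p ∧ p < 2 := hc
    simp only [expo, sparsity] at hcard
    intro k
    have hk1 : (0:ℝ) < (k:ℝ) + 1 := by positivity
    rw [weak_bound_eq hp hη hk1]
    by_cases hkA : (k:ℕ) < A.card
    · have h1 : absRearr μ k ≤ h := by
        unfold absRearr
        by_cases hi : Tuple.sort (fun i => -|μ i|) k ∈ A
        · exact hA _ hi
        · rw [h0 _ hi, abs_zero]; exact hh.le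
      refine h1.trans ?_
      rw [one_div, Real.le_rpow_inv_iff_of_pos hh.le (by positivity) hp, le_div_iff₀ hk1]
      have : (k:ℝ) + 1 ≤ A.card := by exact_mod_cast hkA
      nlinarith [Real.rpow_pos_of_pos hh p]
    · have h1 : absRearr μ k ≤ 0 := by
        by_contra hcon
        push Not at hcon
        have h2 : Finset.Iic k ⊆ Finset.univ.filter fun j => 0 < absRearr μ j := by
          intro j hj
          simp only [Finset.mem_filter, Finset.mem_univ, true_and]
          exact hcon.trans_le (absRearr_antitone μ (Finset.mem_Iic.1 hj))
        have h3 := Finset.card_le_card h2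
        rw [Fin.card_Iic, card_lt_absRearr] at h3
        have h4 : (Finset.univ.filter fun i => 0 < |μ i|).card ≤ A.card := by
          refine Finset.card_le_card fun i hi => hsub ?_
          simpa using hi
        omega
      exact h1.trans (by positivity)

theorem mem_weak_of_rank {p : ℝ} (hp : 0 < p) {n : ℕ} {η : ℝ} (hη : 0 ≤ η) {μ : Fin n → ℝ}
    {f : Fin n → ℕ} (hf : ∀ i j, μ i ≠ 0 → μ j ≠ 0 → f i = f j → i = j)
    (hfa : ∀ i, μ i ≠ 0 → |μ i| ≤ (n * η ^ p / ((f i : ℝ) + 1)) ^ (1 / p)) :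
    μ ∈ (weak p).ball n η := by
  intro k
  rw [weak_bound_eq hp hη (by positivity)]
  refine absRearr_le_of_rank (a := fun j : ℕ => (n * η ^ p / ((j : ℝ) + 1)) ^ (1 / p)) ?_
    (fun j => by positivity) hf hfa k
  intro i j hij
  have : (i:ℝ) ≤ j := by exact_mod_cast hij
  simp only
  gcongr

end SparsityClass

/-! ### Upper bound for the minimax risk by soft thresholding -/

/-- Soft thresholding at `t`. -/
def soft (t y : ℝ) : ℝ := y - max (-t) (min y t)

theorem measurable_soft (t : ℝ) : Measurable (soft t) := by unfold soft; fun_prop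

theorem abs_soft_sub_le {t : ℝ} (ht : 0 ≤ t) (y : ℝ) : |soft t y - y| ≤ t := by
  unfold soft; rw [abs_le]
  constructor <;> simp only [sub_sub_cancel_left] <;>
    rcases max_cases (-t) (min y t) with h | h <;> rcases min_cases y t with h' | h' <;> linarith

theorem soft_sq_le {t : ℝ} (ht : 0 ≤ t) (z : ℝ) :
    soft t z ^ 2 ≤ (absGe t).indicator (fun z => z ^ 2) z := by
  by_cases hz : z ∈ absGe t
  · rw [Set.indicator_of_mem hz, sq_le_sq]
    have hz' : t ≤ |z| := hz
    unfold soft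
    rcases abs_cases z with ⟨h, h1⟩ | ⟨h, h1⟩ <;> rw [h] at hz' ⊢ <;> rw [abs_le] <;>
      rcases max_cases (-t) (min z t) with h2 | h2 <;> rcases min_cases z t with h3 | h3 <;>
      constructor <;> linarith
  · rw [Set.indicator_of_notMem hz]
    have hz' := abs_lt.1 (not_le.1 hz : |z| < t)
    have : soft t z = 0 := by
      unfold soft
      rw [min_eq_left hz'.2.le, max_eq_right hz'.1.le, sub_self]
    simp [this]

/-- The part removed by soft thresholding is a clipping of y, which is 1-Lipschitz; the error
therefore changes by at most |m| from its value at pure noise. -/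
theorem abs_soft_add_sub_le (t z m : ℝ) : |soft t (z + m) - m| ≤ |soft t z| + |m| := by
  have h : |soft t (z + m) - soft t z - m| ≤ |m| := by
    unfold soft
    have e : z + m - max (-t) (min (z + m) t) - (z - max (-t) (min z t)) - m
      = max (-t) (min z t) - max (-t) (min (z + m) t) := by ring
    rw [e]
    have h1 := abs_max_sub_max_le_max (-t) (min z t) (-t) (min (z + m) t)
    have h2 := abs_min_sub_min_le_max z t (z + m) t
    simp only [sub_self, abs_zero, sub_add_cancel_left, abs_neg] at h1 h2
    have h3 : max 0 |min z t - min (z + m) t| ≤ |m| :=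
      max_le (abs_nonneg m) (h2.trans (max_le le_rfl (abs_nonneg m)))
    exact h1.trans h3
  calc |soft t (z + m) - m| = |soft t z + (soft t (z + m) - soft t z - m)| := by ring_nf
    _ ≤ |soft t z| + |soft t (z + m) - soft t z - m| := abs_add_le _ _
    _ ≤ _ := by gcongr

theorem sq_add_le_eps {ε : ℝ} (hε : 0 < ε) (a b : ℝ) :
    (a + b) ^ 2 ≤ (1 + 1 / ε) * a ^ 2 + (1 + ε) * b ^ 2 := by
  have h : 0 ≤ (a - ε * b) ^ 2 / ε := by positivity
  have e : (a - ε * b) ^ 2 / ε = a ^ 2 / ε - 2 * a * b + ε * b ^ 2 := by field_simp; ring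
  rw [e] at h
  have e2 : (1 + 1 / ε) * a ^ 2 = a ^ 2 + a ^ 2 / ε := by ring
  rw [e2]; nlinarith

theorem integrable_soft_sub_sq {t : ℝ} (ht : 0 ≤ t) (m : ℝ) :
    Integrable (fun y => (soft t y - m) ^ 2) (gaussianReal m 1) := by
  have := integrable_polynomial_gaussianReal m
    (2 * Polynomial.C t ^ 2 + 2 * (Polynomial.X - Polynomial.C m) ^ 2)
  refine this.mono' ((measurable_soft t).sub_const m |>.pow_const 2).aestronglyMeasurable
    (ae_of_all _ fun y => ?_)
  rw [Real.norm_of_nonneg (sq_nonneg _)]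
  simp
  have h1 := abs_le.1 (abs_soft_sub_le ht y)
  nlinarith [sq_nonneg (soft t y - y - (y - m)), sq_nonneg (soft t y - y + (y - m))]

/-- Two bounds, one for each side of the minimum: the error is at most |soft z| + |m|, useful for
small means, and it is z plus a bias of size at most t, useful for large ones. The weighted square
inequality makes the main terms carry 1 + ε, and (1 + ε)/ε = 1 + 1/ε explains the correction to t².
-/
theorem integral_soft_sub_sq_le {t ε : ℝ} (ht : 0 ≤ t) (hε : 0 < ε) (m : ℝ) :
    ∫ y, (soft t y - m) ^ 2 ∂gaussianReal m 1
      ≤ (1 + 1 / ε) * tailEnergy t + (1 + ε) * min (m ^ 2) (t ^ 2 + 1 / ε) := by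
  have hI : Integrable (fun z => (soft t (z + m) - m) ^ 2) (gaussianReal 0 1) := by
    have := integrable_polynomial_gaussianReal 0
      (2 * Polynomial.C t ^ 2 + 2 * Polynomial.X ^ 2)
    refine this.mono' ((((measurable_soft t).comp (measurable_add_const m)).sub_const m
      |>.pow_const 2).aestronglyMeasurable) (ae_of_all _ fun z => ?_)
    rw [Real.norm_of_nonneg (sq_nonneg _)]
    simp
    have h1 := abs_le.1 (abs_soft_sub_le ht (z + m))
    nlinarith [sq_nonneg (soft t (z + m) - (z + m) - z), sq_nonneg (soft t (z + m) - (z + m) + z)]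
  have hT : 0 ≤ tailEnergy t := tailEnergy_nonneg t
  rw [integral_gaussianReal_shift]
  have hA : ∫ z, (soft t (z + m) - m) ^ 2 ∂gaussianReal 0 1
      ≤ (1 + 1 / ε) * tailEnergy t + (1 + ε) * m ^ 2 := by
    have : ∫ z, (soft t (z + m) - m) ^ 2 ∂gaussianReal 0 1
        ≤ ∫ z, ((1 + 1 / ε) * (absGe t).indicator (fun z => z ^ 2) z + (1 + ε) * m ^ 2)
          ∂gaussianReal 0 1 := by
      refine integral_mono hI (((integrable_indicator_sq t).const_mul _).add (integrable_const _))
        fun z => ?_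
      simp only
      have h1 := abs_soft_add_sub_le t z m
      calc (soft t (z + m) - m) ^ 2 = |soft t (z + m) - m| ^ 2 := (sq_abs _).symm
        _ ≤ (|soft t z| + |m|) ^ 2 := by gcongr
        _ ≤ (1 + 1 / ε) * |soft t z| ^ 2 + (1 + ε) * |m| ^ 2 := sq_add_le_eps hε _ _
        _ ≤ _ := by
          rw [sq_abs, sq_abs]
          have := soft_sq_le ht z
          gcongr
    rw [integral_add ((integrable_indicator_sq t).const_mul _) (integrable_const _),
      integral_const_mul] at this
    simpa [tailEnergy] using this
  have hB : ∫ z, (soft t (z + m) - m) ^ 2 ∂gaussianReal 0 1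
      ≤ (1 + ε) * (t ^ 2 + 1 / ε) := by
    have : ∫ z, (soft t (z + m) - m) ^ 2 ∂gaussianReal 0 1
        ≤ ∫ z, ((1 + 1 / ε) * z ^ 2 + (1 + ε) * t ^ 2) ∂gaussianReal 0 1 := by
      refine integral_mono hI (((integrable_pow_gaussianReal 0 2).const_mul _).add
        (integrable_const _)) fun z => ?_
      simp only
      have h1 := abs_soft_sub_le ht (z + m)
      have e : soft t (z + m) - m = z + (soft t (z + m) - (z + m)) := by ring
      rw [e]
      refine (sq_add_le_eps hε _ _).trans ?_
      rw [← sq_abs (soft t (z + m) - (z + m))]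
      gcongr
    rw [integral_add ((integrable_pow_gaussianReal 0 2).const_mul _) (integrable_const _),
      integral_const_mul, integral_sq_std] at this
    simp only [integral_const, probReal_univ, one_smul] at this
    refine this.trans (le_of_eq ?_)
    field_simp; ring
  have h0 : 0 ≤ (1 + 1 / ε) * tailEnergy t := by positivity
  rcases min_cases (m ^ 2) (t ^ 2 + 1 / ε) with ⟨h, _⟩ | ⟨h, _⟩ <;> rw [h] <;> linarith

theorem sqRisk_eq_ofReal {n : ℕ} {m : (Fin n → ℝ) → Fin n → ℝ} {μ : Fin n → ℝ}
    (hi : ∀ i, Integrable (fun y => (m y i - μ i) ^ 2) (gaussShift μ)) :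
    sqRisk m μ = ENNReal.ofReal (∑ i, ∫ y, (m y i - μ i) ^ 2 ∂gaussShift μ) := by
  unfold sqRisk
  rw [← integral_finsetSum _ fun i _ => hi i, ofReal_integral_eq_lintegral_ofReal
    (integrable_finsetSum _ fun i _ => hi i)
    (ae_of_all _ fun y => Finset.sum_nonneg fun i _ => sq_nonneg _)]

theorem minimaxSqRisk_le {n : ℕ} {Θ : Set (Fin n → ℝ)} {t ε S : ℝ} (ht : 0 ≤ t) (hε : 0 < ε)
    (hS0 : 0 ≤ S) (hS : ∀ μ ∈ Θ, ∑ i, min (μ i ^ 2) (t ^ 2 + 1 / ε) ≤ S) :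
    minimaxSqRisk Θ ≤ n * ((1 + 1 / ε) * tailEnergy t) + (1 + ε) * S := by
  have hT : 0 ≤ tailEnergy t := tailEnergy_nonneg t
  refine ENNReal.toReal_le_of_le_ofReal (by positivity) ?_
  refine (iInf₂_le (fun y i => soft t (y i)) ?_).trans (iSup₂_le fun μ hμ => ?_)
  · exact measurable_pi_lambda _ fun i => (measurable_soft t).comp (measurable_pi_apply i)
  rw [sqRisk_eq_ofReal fun i => integrable_gaussShift_eval (integrable_soft_sub_sq ht (μ i))]
  refine ENNReal.ofReal_le_ofReal ?_
  calc ∑ i, ∫ y, (soft t (y i) - μ i) ^ 2 ∂gaussShift μ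
      ≤ ∑ i, ((1 + 1 / ε) * tailEnergy t + (1 + ε) * min (μ i ^ 2) (t ^ 2 + 1 / ε)) := by
        refine Finset.sum_le_sum fun i _ => ?_
        rw [integral_gaussShift_eval (f := fun x => (soft t x - μ i) ^ 2)
          (integrable_soft_sub_sq ht (μ i)).aestronglyMeasurable]
        exact integral_soft_sub_sq_le ht hε (μ i)
    _ = n * ((1 + 1 / ε) * tailEnergy t) + (1 + ε) * ∑ i, min (μ i ^ 2) (t ^ 2 + 1 / ε) := by
        rw [Finset.sum_add_distrib, Finset.mul_sum]; simp
    _ ≤ _ := by gcongr; exact hS μ hμ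

theorem minimaxSqRisk_ne_top {n : ℕ} (Θ : Set (Fin n → ℝ)) :
    (⨅ (m : (Fin n → ℝ) → Fin n → ℝ) (_ : Measurable m), ⨆ μ ∈ Θ, sqRisk m μ) ≠ ⊤ := by
  refine ne_top_of_le_ne_top (ENNReal.ofReal_ne_top (r := n)) ?_
  refine (iInf₂_le (fun y => y) measurable_id).trans (iSup₂_le fun μ _ => ?_)
  rw [sqRisk_eq_ofReal fun i => integrable_eval_sub_pow μ i 2]
  simp [integral_eval_sub_sq]

/-! ### Lower bound for the minimax risk by blockwise random spikes -/

/-- Only the i-th marginal changes, by the exponential tilt of a centred Gaussian; both sides are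
compared on rectangles, where the density factorises. It rewrites all spike positions as
reweightings of one reference law. -/
theorem gaussShift_update {n : ℕ} (μ : Fin n → ℝ) {i : Fin n} (hi : μ i = 0) (a : ℝ) :
    gaussShift (Function.update μ i a) = (gaussShift μ).withDensity
      fun y => ENNReal.ofReal (Real.exp (a * y i - a ^ 2 / 2)) := by
  classical
  unfold gaussShift
  refine Measure.pi_eq fun s hs => ?_
  set g : ℝ → ℝ≥0∞ := fun x => ENNReal.ofReal (Real.exp (a * x - a ^ 2 / 2)) with hg
  have hgm : Measurable g := by fun_prop
  set F : Fin n → ℝ → ℝ≥0∞ := fun j => (s j).indicator (if j = i then g else 1) with hF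
  have hFm : ∀ j, Measurable (F j) := by
    intro j
    refine Measurable.indicator ?_ (hs j)
    split_ifs
    · exact hgm
    · exact measurable_const
  have hS : MeasurableSet (Set.univ.pi s) := MeasurableSet.univ_pi hs
  rw [withDensity_apply _ hS, ← lintegral_indicator hS]
  have e : ∀ y : Fin n → ℝ, (Set.univ.pi s).indicator (fun y => g (y i)) y = ∏ j, F j (y j) := by
    intro y
    by_cases hy : y ∈ Set.univ.pi s
    · rw [Set.indicator_of_mem hy, Finset.prod_eq_single i]
      · simp [hF, Set.indicator_of_mem (hy i trivial)]
      · intro j _ hj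
        simp [hF, Set.indicator_of_mem (hy j trivial), hj]
      · simp
    · rw [Set.indicator_of_notMem hy]
      simp only [Set.mem_univ_pi, not_forall] at hy
      obtain ⟨j, hj⟩ := hy
      exact (Finset.prod_eq_zero (Finset.mem_univ j) (by simp [hF, hj])).symm
  calc ∫⁻ y, (Set.univ.pi s).indicator (fun y => g (y i)) y
        ∂(Measure.pi fun i => gaussianReal (μ i) 1)
      = ∫⁻ y, ∏ j, F j (y j) ∂(Measure.pi fun i => gaussianReal (μ i) 1) := by simp only [e]
    _ = ∏ j, ∫⁻ y, F j (y j) ∂(Measure.pi fun i => gaussianReal (μ i) 1) :=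
        lintegral_prod_eq_prod_lintegral_of_indepFun Finset.univ
          (fun j (y : Fin n → ℝ) => F j (y j)) (iIndepFun_pi fun j => (hFm j).aemeasurable)
          fun j => (hFm j).comp (measurable_pi_apply j)
    _ = ∏ j, gaussianReal (Function.update μ i a j) 1 (s j) := by
        refine Finset.prod_congr rfl fun j _ => ?_
        rw [(measurePreserving_eval (fun i => gaussianReal (μ i) 1) j).lintegral_comp (hFm j)]
        simp only [hF, lintegral_indicator (hs j)]
        rcases eq_or_ne j i with rfl | hj
        · simp only [Function.update_self, hi, if_true]
          rw [gaussianReal_eq_withDensity_tilt a, withDensity_apply _ (hs j)]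
        · simp [hj]

/-- The right side is a posterior loss with unnormalised weights w; the exact minimum over a is h²(W
- Σw²/W), with W the total weight. A fixed K replaces W in the denominator so that expectations can
be taken termwise: for K ≤ W, lower W a² to K a² and complete the square; for W ≤ K the left side is
nonpositive. -/
theorem weighted_spike_loss_ge {ι : Type*} [Fintype ι] [DecidableEq ι] {w a : ι → ℝ} {h K : ℝ}
    (hw : ∀ j, 0 ≤ w j) (hK : 0 < K) :
    h ^ 2 * (∑ j, w j - K - (∑ j, w j ^ 2) / K)
      ≤ ∑ j, w j * ∑ k, (a k - if k = j then h else 0) ^ 2 := by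
  set W := ∑ j, w j with hW
  have hW0 : 0 ≤ W := Finset.sum_nonneg fun j _ => hw j
  have e1 : ∀ j, ∑ k, (a k - if k = j then h else 0) ^ 2
      = ∑ k, a k ^ 2 - 2 * h * a j + h ^ 2 := by
    intro j
    have : ∀ k, (a k - if k = j then h else 0) ^ 2
        = a k ^ 2 + if k = j then (h ^ 2 - 2 * h * a k) else 0 := by
      intro k; split_ifs <;> ring
    simp only [this, Finset.sum_add_distrib, Finset.sum_ite_eq', Finset.mem_univ, if_true]
    ring
  have e2 : ∑ j, w j * ∑ k, (a k - if k = j then h else 0) ^ 2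
      = ∑ k, (W * a k ^ 2 - 2 * h * w k * a k) + h ^ 2 * W := by
    simp only [e1]
    rw [Finset.sum_sub_distrib, ← Finset.mul_sum, hW, Finset.mul_sum (a := h ^ 2), Finset.sum_mul,
      ← Finset.sum_sub_distrib, ← Finset.sum_add_distrib]
    exact Finset.sum_congr rfl fun j _ => by ring
  rw [e2]
  have hS0 : 0 ≤ (∑ j, w j ^ 2) / K := div_nonneg (Finset.sum_nonneg fun _ _ => sq_nonneg _) hK.le
  rcases le_total K W with hKW | hKW
  · have : ∑ k, -(h ^ 2 * (w k ^ 2 / K)) ≤ ∑ k, (W * a k ^ 2 - 2 * h * w k * a k) := by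
      refine Finset.sum_le_sum fun k _ => ?_
      have h1 : K * a k ^ 2 ≤ W * a k ^ 2 := by gcongr
      have h2 : 0 ≤ (K * a k - h * w k) ^ 2 / K := by positivity
      have h3 : (K * a k - h * w k) ^ 2 / K = K * a k ^ 2 - 2 * h * w k * a k
        + h ^ 2 * (w k ^ 2 / K) := by field_simp; ring
      linarith
    rw [Finset.sum_neg_distrib, ← Finset.mul_sum, ← Finset.sum_div] at this
    nlinarith [mul_nonneg (sq_nonneg h) hK.le]
  · have : ∑ k, -(h ^ 2 * w k) ≤ ∑ k, (W * a k ^ 2 - 2 * h * w k * a k) := by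
      refine Finset.sum_le_sum fun k _ => ?_
      have h1 : w k ≤ W := Finset.single_le_sum (fun j _ => hw j) (Finset.mem_univ k)
      have h2 : w k * a k ^ 2 ≤ W * a k ^ 2 := by gcongr
      nlinarith [mul_nonneg (hw k) (sq_nonneg (a k - h))]
    rw [Finset.sum_neg_distrib, ← Finset.mul_sum] at this
    have h3 : 0 ≤ h ^ 2 * (K - W) := mul_nonneg (sq_nonneg h) (sub_nonneg.2 hKW)
    have h4 := mul_nonneg (sq_nonneg h) hS0
    nlinarith

/-- Truncated likelihood ratio of the shift by `h`. -/
def truncLR (h r : ℝ) : ℝ → ℝ := (Set.Iic (h + r)).indicator fun x => Real.exp (h * x - h ^ 2 / 2)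

theorem truncLR_nonneg (h r x : ℝ) : 0 ≤ truncLR h r x :=
  Set.indicator_nonneg (fun _ _ => Real.exp_nonneg _) _

theorem truncLR_le (h r x : ℝ) : truncLR h r x ≤ Real.exp (h * x - h ^ 2 / 2) :=
  Set.indicator_le_self' (fun _ _ => Real.exp_nonneg _) _

theorem integrable_lr (h : ℝ) :
    Integrable (fun x => Real.exp (h * x - h ^ 2 / 2)) (gaussianReal 0 1) := by
  simpa using integrable_tilt (m := h) (integrable_const (1:ℝ))

theorem measurable_truncLR (h r : ℝ) : Measurable (truncLR h r) :=
  Measurable.indicator (by fun_prop) measurableSet_Iic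

theorem integrable_truncLR (h r : ℝ) : Integrable (truncLR h r) (gaussianReal 0 1) :=
  (integrable_lr h).indicator measurableSet_Iic

theorem integral_truncLR (h r : ℝ) : ∫ x, truncLR h r x ∂gaussianReal 0 1 = 1 - gaussTail r := by
  have h1 := integral_gaussianReal_tilt h ((Set.Iic (h + r)).indicator fun _ => 1)
  have h2 : ∫ x, truncLR h r x ∂gaussianReal 0 1 = ∫ z, Real.exp (h * z - h ^ 2 / 2)
      * (Set.Iic (h + r)).indicator (fun _ => 1) z ∂gaussianReal 0 1 := by
    refine integral_congr_ae (ae_of_all _ fun x => ?_)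
    by_cases hx : x ∈ Set.Iic (h + r) <;> simp only [truncLR, Set.indicator, hx] <;> simp
  rw [h2, ← h1, integral_gaussianReal_shift]
  have h3 : ∀ z : ℝ, (Set.Iic (h + r)).indicator (fun _ => (1:ℝ)) (z + h)
      = (Set.Iic r).indicator (fun _ => 1) z := by
    intro z
    by_cases hz : z ≤ r
    · rw [Set.indicator_of_mem (show z ∈ Set.Iic r from hz),
        Set.indicator_of_mem (show z + h ∈ Set.Iic (h + r) by simp only [Set.mem_Iic]; linarith)]
    · rw [Set.indicator_of_notMem (show z ∉ Set.Iic r from hz),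
        Set.indicator_of_notMem (show z + h ∉ Set.Iic (h + r) by
          simp only [Set.mem_Iic]; intro h'; exact hz (by linarith))]
  simp only [h3]
  rw [integral_indicator measurableSet_Iic]
  simp only [integral_const, smul_eq_mul, mul_one, measureReal_restrict_apply_univ]
  rw [gaussTail, ← Set.compl_Iic, probReal_compl_eq_one_sub measurableSet_Iic]; ring

/-- On the truncation set the likelihood ratio is at most exp(h²/2 + hr), so its square is at most
that times itself. Without truncation the second moment would be exp(h²), too large for heights near
τ; truncation loses only the mass P(Z > r). -/
theorem truncLR_sq_le {h : ℝ} (hh : 0 ≤ h) (r x : ℝ) :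
    truncLR h r x ^ 2 ≤ Real.exp (h ^ 2 / 2 + h * r) * Real.exp (h * x - h ^ 2 / 2) := by
  by_cases hx : x ∈ Set.Iic (h + r)
  · rw [truncLR, Set.indicator_of_mem hx, ← Real.exp_add, ← Real.exp_nat_mul]
    apply Real.exp_le_exp.2
    have : x ≤ h + r := hx
    push_cast
    nlinarith
  · rw [truncLR, Set.indicator_of_notMem hx]; simp; positivity

theorem integrable_truncLR_sq {h : ℝ} (hh : 0 ≤ h) (r : ℝ) :
    Integrable (fun x => truncLR h r x ^ 2) (gaussianReal 0 1) :=
  ((integrable_lr h).const_mul _).mono' ((measurable_truncLR h r).pow_const 2).aestronglyMeasurable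
    (ae_of_all _ fun x => by
      rw [Real.norm_of_nonneg (sq_nonneg _)]; exact truncLR_sq_le hh r x)

theorem integral_truncLR_sq_le {h : ℝ} (hh : 0 ≤ h) (r : ℝ) :
    ∫ x, truncLR h r x ^ 2 ∂gaussianReal 0 1 ≤ Real.exp (h ^ 2 / 2 + h * r) := by
  have h1 := integral_mono (integrable_truncLR_sq hh r) ((integrable_lr h).const_mul _)
    (truncLR_sq_le hh r)
  rw [integral_const_mul] at h1
  have h2 := integral_gaussianReal_tilt h fun _ => 1
  simp only [mul_one, integral_const, probReal_univ, one_smul] at h2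
  rw [← h2, mul_one] at h1
  exact h1

/-- Lower bound for the average risk over the position of a single spike. -/
theorem sum_single_spike_risk_ge {n B : ℕ} (μ : Fin n → ℝ) {e : Fin B → Fin n}
    (he : Function.Injective e) (hμ : ∀ j, μ (e j) = 0) {h r κ : ℝ} (hh : 0 ≤ h) (hκ : 0 < κ)
    (hB : 0 < B) {m : (Fin n → ℝ) → Fin n → ℝ} (hm : Measurable m) :
    ENNReal.ofReal (B * (h ^ 2 * (1 - gaussTail r - κ - Real.exp (h ^ 2 / 2 + h * r) / (κ * B))))
      ≤ ∑ j, ∫⁻ y, ENNReal.ofReal (∑ k, (m y (e k) - Function.update μ (e j) h (e k)) ^ 2)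
          ∂gaussShift (Function.update μ (e j) h) := by
  have hB' : (0:ℝ) < B := by exact_mod_cast hB
  set w : Fin B → (Fin n → ℝ) → ℝ := fun j y => truncLR h r (y (e j)) with hw
  set L : Fin B → (Fin n → ℝ) → ℝ := fun j y =>
    ∑ k, (m y (e k) - if k = j then h else 0) ^ 2 with hL
  have hL0 : ∀ j y, 0 ≤ L j y := fun j y => Finset.sum_nonneg fun _ _ => sq_nonneg _
  have hLm : ∀ j, Measurable (L j) := fun j => Finset.measurable_fun_sum _ fun k _ =>
    (((measurable_pi_apply (e k)).comp hm).sub_const _).pow_const 2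
  have hwm : ∀ j, Measurable (w j) := fun j =>
    (measurable_truncLR h r).comp (measurable_pi_apply (e j))
  have hupd : ∀ j k, Function.update μ (e j) h (e k) = if k = j then h else 0 := by
    intro j k
    rcases eq_or_ne k j with rfl | hkj
    · simp
    · rw [Function.update_of_ne (fun h' => hkj (he h')), hμ, if_neg hkj]
  -- The total weight has mean close to B, so K is a small fraction of it.
  set K := κ * B with hK
  have hK0 : 0 < K := by positivity
  set f : (Fin n → ℝ) → ℝ := fun y =>
    h ^ 2 * (∑ j, w j y - K - (∑ j, w j y ^ 2) / K) with hf
  have iw : ∀ j, Integrable (w j) (gaussShift μ) := fun j => by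
    refine integrable_gaussShift_eval (μ := μ) (i := e j) ?_
    rw [hμ]; exact integrable_truncLR h r
  have iw2 : ∀ j, Integrable (fun y => w j y ^ 2) (gaussShift μ) := fun j => by
    refine integrable_gaussShift_eval (μ := μ) (i := e j) (f := fun x => truncLR h r x ^ 2) ?_
    rw [hμ]; exact integrable_truncLR_sq hh r
  have i1 : Integrable (fun y => ∑ j, w j y) (gaussShift μ) :=
    integrable_finsetSum _ fun j _ => iw j
  have i2 : Integrable (fun y => ∑ j, w j y - K) (gaussShift μ) := i1.sub (integrable_const _)
  have i3 : Integrable (fun y => (∑ j, w j y ^ 2) / K) (gaussShift μ) :=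
    (integrable_finsetSum _ fun j _ => iw2 j).div_const K
  have hfi : Integrable f (gaussShift μ) := (i2.sub i3).const_mul _
  have hfint : B * (h ^ 2 * (1 - gaussTail r - κ - Real.exp (h ^ 2 / 2 + h * r) / (κ * B)))
      ≤ ∫ y, f y ∂gaussShift μ := by
    simp only [hf]
    rw [integral_const_mul, integral_sub i2 i3, integral_sub i1 (integrable_const _), integral_div,
      integral_finsetSum _ fun j _ => iw j, integral_finsetSum _ fun j _ => iw2 j]
    have e1 : ∀ j, ∫ y, w j y ∂gaussShift μ = 1 - gaussTail r := fun j => by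
      rw [← integral_truncLR h r, ← hμ j]
      exact integral_gaussShift_eval (measurable_truncLR _ _).aestronglyMeasurable
    have e2 : ∀ j, ∫ y, w j y ^ 2 ∂gaussShift μ ≤ Real.exp (h ^ 2 / 2 + h * r) := fun j => by
      refine le_trans (le_of_eq ?_) (integral_truncLR_sq_le hh r)
      rw [← hμ j]
      exact integral_gaussShift_eval (f := fun x => truncLR h r x ^ 2)
        ((measurable_truncLR _ _).pow_const 2).aestronglyMeasurable
    have e3 : (∑ j, ∫ y, w j y ^ 2 ∂gaussShift μ) / K
        ≤ (B * Real.exp (h ^ 2 / 2 + h * r)) / K := by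
      gcongr
      have := Finset.sum_le_card_nsmul Finset.univ
        (fun j => ∫ y, w j y ^ 2 ∂gaussShift μ) _ fun j _ => e2 j
      simpa using this
    have e4 : (B * Real.exp (h ^ 2 / 2 + h * r)) / K
        = B * (Real.exp (h ^ 2 / 2 + h * r) / (κ * B)) := by rw [hK]; ring
    simp only [e1, Finset.sum_const, Finset.card_univ, Fintype.card_fin, nsmul_eq_mul,
      integral_const, probReal_univ, one_smul]
    rw [e4] at e3
    nlinarith [mul_le_mul_of_nonneg_left e3 (sq_nonneg h)]
  calc ENNReal.ofReal _ ≤ ENNReal.ofReal (∫ y, max (f y) 0 ∂gaussShift μ) := by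
        refine ENNReal.ofReal_le_ofReal (hfint.trans ?_)
        exact integral_mono hfi hfi.pos_part fun y => le_max_left _ _
    _ = ∫⁻ y, ENNReal.ofReal (max (f y) 0) ∂gaussShift μ :=
        ofReal_integral_eq_lintegral_ofReal hfi.pos_part (ae_of_all _ fun y => le_max_right _ _)
    _ ≤ ∫⁻ y, ∑ j, ENNReal.ofReal (Real.exp (h * y (e j) - h ^ 2 / 2))
          * ENNReal.ofReal (L j y) ∂gaussShift μ := by
        refine lintegral_mono fun y => ?_
        have h1 : f y ≤ ∑ j, w j y * L j y :=
          weighted_spike_loss_ge (w := fun j => w j y) (a := fun k => m y (e k))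
            (fun j => truncLR_nonneg _ _ _) hK0
        -- The loss is nonnegative, so the truncation can be undone here; the full likelihood ratio
        -- is what turns the reference integral into the risk at the shifted mean.
        have h2 : max (f y) 0 ≤ ∑ j, Real.exp (h * y (e j) - h ^ 2 / 2) * L j y := by
          refine max_le (h1.trans ?_) (Finset.sum_nonneg fun j _ =>
            mul_nonneg (Real.exp_nonneg _) (hL0 j y))
          exact Finset.sum_le_sum fun j _ =>
            mul_le_mul_of_nonneg_right (truncLR_le _ _ _) (hL0 j y)
        refine (ENNReal.ofReal_le_ofReal h2).trans (le_of_eq ?_)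
        rw [ENNReal.ofReal_sum_of_nonneg fun j _ => mul_nonneg (Real.exp_nonneg _) (hL0 j y)]
        exact Finset.sum_congr rfl fun j _ => ENNReal.ofReal_mul (Real.exp_nonneg _)
    _ = ∑ j, ∫⁻ y, ENNReal.ofReal (Real.exp (h * y (e j) - h ^ 2 / 2))
          * ENNReal.ofReal (L j y) ∂gaussShift μ := by
        refine lintegral_finsetSum _ fun j _ => ?_
        exact Measurable.mul (by fun_prop) (hLm j).ennreal_ofReal
    _ = _ := by
        refine Finset.sum_congr rfl fun j _ => ?_
        rw [gaussShift_update μ (hμ j) h,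
          lintegral_withDensity_eq_lintegral_mul _ (by fun_prop)
            (by simp only [hupd]; exact (hLm j).ennreal_ofReal)]
        simp only [Pi.mul_apply, hupd, hL]

/-- The vector with one spike of height `h b` in each block `b`, at position `J b`. -/
def spikeVec {n M B : ℕ} (e : Fin M × Fin B → Fin n) (h : Fin M → ℝ) (J : Fin M → Fin B)
    (i : Fin n) : ℝ := ∑ b, if i = e (b, J b) then h b else 0

theorem spikeVec_apply {n M B : ℕ} {e : Fin M × Fin B → Fin n} (he : Function.Injective e)
    (h : Fin M → ℝ) (J : Fin M → Fin B) (b : Fin M) (k : Fin B) :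
    spikeVec e h J (e (b, k)) = if k = J b then h b else 0 := by
  unfold spikeVec
  rw [Finset.sum_eq_single b]
  · simp [he.eq_iff]
  · intro b' _ hb'
    rw [if_neg]
    intro h'
    exact hb' (Prod.ext_iff.1 (he h')).1.symm
  · simp

theorem spikeVec_eq_zero {n M B : ℕ} {e : Fin M × Fin B → Fin n} {h : Fin M → ℝ}
    {J : Fin M → Fin B} {i : Fin n} (hi : ∀ b, i ≠ e (b, J b)) : spikeVec e h J i = 0 :=
  Finset.sum_eq_zero fun b _ => if_neg (hi b)

theorem spikeVec_update {n M B : ℕ} {e : Fin M × Fin B → Fin n} (he : Function.Injective e)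
    (h : Fin M → ℝ) (J : Fin M → Fin B) (b : Fin M) (j : Fin B) :
    spikeVec e h (Function.update J b j)
      = Function.update (spikeVec e (Function.update h b 0) J) (e (b, j)) (h b) := by
  ext i
  by_cases hi : i = e (b, j)
  · subst hi
    rw [spikeVec_apply he]; simp
  · rw [Function.update_of_ne hi]
    unfold spikeVec
    refine Finset.sum_congr rfl fun b' _ => ?_
    rcases eq_or_ne b' b with rfl | hb'
    · simp [hi]
    · simp [hb']

/-- Exchanging the b-th coordinate with the extra index is an involution, so resampling one
coordinate leaves the uniform law on configurations invariant. -/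
theorem sum_update_eq {M B : ℕ} (F : (Fin M → Fin B) → ℝ≥0∞) (b : Fin M) :
    ∑ J, ∑ j, F (Function.update J b j) = B * ∑ J, F J := by
  classical
  rw [← Finset.sum_product', Finset.univ_product_univ]
  let φ : (Fin M → Fin B) × Fin B ≃ (Fin M → Fin B) × Fin B :=
    { toFun := fun p => (Function.update p.1 b p.2, p.1 b)
      invFun := fun p => (Function.update p.1 b p.2, p.1 b)
      left_inv := fun p => by simp
      right_inv := fun p => by simp }
  have h1 : ∑ p : (Fin M → Fin B) × Fin B, F (Function.update p.1 b p.2)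
      = ∑ p : (Fin M → Fin B) × Fin B, F (φ p).1 := rfl
  rw [h1, Equiv.sum_comp φ fun p => F p.1, Fintype.sum_prod_type]
  simp [Finset.mul_sum]

/-- The worst case dominates the average over independent uniform spike positions. For each block,
freezing the positions in the others leaves a single-spike problem, whose Bayes risk is nearly h²
whatever the estimator does with the remaining data. -/
theorem minimaxSqRisk_ge {n M B : ℕ} {Θ : Set (Fin n → ℝ)} {e : Fin M × Fin B → Fin n}
    (he : Function.Injective e) (hB : 0 < B) {h : Fin M → ℝ} (hh : ∀ b, 0 ≤ h b)
    (hΘ : ∀ J, spikeVec e h J ∈ Θ) {r κ δ : ℝ} (hκ : 0 < κ)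
    (hδ : ∀ b, gaussTail r + κ + Real.exp (h b ^ 2 / 2 + h b * r) / (κ * B) ≤ δ) :
    (1 - δ) * ∑ b, h b ^ 2 ≤ minimaxSqRisk Θ := by
  classical
  have hB' : (0:ℝ) < B := by exact_mod_cast hB
  rcases le_or_gt 1 δ with h1 | h1
  · have h2 : (1 - δ) * ∑ b, h b ^ 2 ≤ 0 :=
      mul_nonpos_of_nonpos_of_nonneg (by linarith) (Finset.sum_nonneg fun _ _ => sq_nonneg _)
    exact h2.trans ENNReal.toReal_nonneg
  rw [minimaxSqRisk, ← ENNReal.ofReal_le_iff_le_toReal (minimaxSqRisk_ne_top Θ)]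
  refine le_iInf₂ fun m hm => ?_
  set R := ⨆ μ ∈ Θ, sqRisk m μ with hR
  set F : Fin M → (Fin M → Fin B) → ℝ≥0∞ := fun b J =>
    ∫⁻ y, ENNReal.ofReal (∑ k, (m y (e (b, k)) - spikeVec e h J (e (b, k))) ^ 2)
      ∂gaussShift (spikeVec e h J) with hF
  have hsum : ∀ J, ∑ b, F b J ≤ R := by
    intro J
    refine le_trans ?_ (le_iSup₂ (f := fun μ (_ : μ ∈ Θ) => sqRisk m μ) _ (hΘ J))
    have hmeas : ∀ b, Measurable fun y => ENNReal.ofReal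
        (∑ k, (m y (e (b, k)) - spikeVec e h J (e (b, k))) ^ 2) := fun b =>
      (Finset.measurable_fun_sum _ fun k _ =>
        (((measurable_pi_apply (e (b, k))).comp hm).sub_const _).pow_const 2).ennreal_ofReal
    rw [hF, ← lintegral_finsetSum _ fun b _ => hmeas b]
    refine lintegral_mono fun y => ?_
    rw [← ENNReal.ofReal_sum_of_nonneg fun b _ => Finset.sum_nonneg fun _ _ => sq_nonneg _]
    refine ENNReal.ofReal_le_ofReal ?_
    rw [← Fintype.sum_prod_type' (f := fun b k => (m y (e (b, k)) - spikeVec e h J (e (b, k))) ^ 2)]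
    rw [← Finset.sum_image (f := fun i => (m y i - spikeVec e h J i) ^ 2)
      (g := e) (s := Finset.univ) (fun a _ b _ hab => he hab)]
    exact Finset.sum_le_sum_of_subset_of_nonneg (Finset.subset_univ _) fun _ _ _ => sq_nonneg _
  have hblock : ∀ b, ENNReal.ofReal ((1 - δ) * h b ^ 2) * (B : ℝ≥0∞) ^ M ≤ ∑ J, F b J := by
    intro b
    have h2 : ∀ J : Fin M → Fin B, ENNReal.ofReal ((1 - δ) * h b ^ 2) * B
        ≤ ∑ j, F b (Function.update J b j) := by
      intro J
      -- The reference vector has the spike of block b erased and all other spikes in place.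
      have h3 := sum_single_spike_risk_ge (spikeVec e (Function.update h b 0) J)
        (e := fun k => e (b, k)) (fun k k' hk => (Prod.ext_iff.1 (he hk)).2)
        (fun j => by rw [spikeVec_apply he]; simp) (h := h b) (r := r) (κ := κ) (hh b) hκ hB hm
      simp only [← spikeVec_update he] at h3
      refine le_trans ?_ h3
      rw [← ENNReal.ofReal_natCast, ← ENNReal.ofReal_mul (mul_nonneg (by linarith) (sq_nonneg _))]
      refine ENNReal.ofReal_le_ofReal ?_
      have h4 := hδ b
      have h5 : (1 - δ) * h b ^ 2 ≤ h b ^ 2 * (1 - gaussTail r - κ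
          - Real.exp (h b ^ 2 / 2 + h b * r) / (κ * B)) := by nlinarith [sq_nonneg (h b)]
      nlinarith
    -- Multiplying by B allows the average over J to be replaced by an average over J with its b-th
    -- position resampled.
    have h6 : ENNReal.ofReal ((1 - δ) * h b ^ 2) * (B : ℝ≥0∞) ^ M * B ≤ (∑ J, F b J) * B := by
      rw [mul_comm (∑ J, F b J), ← sum_update_eq (F b) b]
      have h7 := Finset.sum_le_sum fun J (_ : J ∈ Finset.univ) => h2 J
      simp only [Finset.sum_const, Finset.card_univ, Fintype.card_fun, Fintype.card_fin,
        nsmul_eq_mul, Nat.cast_pow] at h7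
      refine le_trans (le_of_eq ?_) h7
      ring
    exact (ENNReal.mul_le_mul_iff_left (by exact_mod_cast hB.ne') (ENNReal.natCast_ne_top B)).1 h6
  have htot : ENNReal.ofReal ((1 - δ) * ∑ b, h b ^ 2) * (B : ℝ≥0∞) ^ M ≤ R * (B : ℝ≥0∞) ^ M := by
    rw [Finset.mul_sum, ENNReal.ofReal_sum_of_nonneg fun b _ =>
      mul_nonneg (by linarith) (sq_nonneg _), Finset.sum_mul]
    refine (Finset.sum_le_sum fun b _ => hblock b).trans ?_
    rw [Finset.sum_comm]
    refine (Finset.sum_le_sum fun J _ => hsum J).trans (le_of_eq ?_)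
    simp [mul_comm]
  exact (ENNReal.mul_le_mul_iff_left (pow_ne_zero _ (by exact_mod_cast hB.ne'))
    (ENNReal.pow_ne_top (ENNReal.natCast_ne_top B))).1 htot

/-! ### The asymptotic regime -/

theorem eventually_pow_mul_exp_le (k : ℕ) (b : ℝ) {a ε : ℝ} (ha : 0 < a) (hε : 0 < ε) :
    ∀ᶠ t : ℝ in atTop, t ^ k * Real.exp (b * t - a * t ^ 2) ≤ ε := by
  have hlim : Tendsto (fun t : ℝ => (k.factorial : ℝ) * Real.exp (t * ((b + 1) - a * t))) atTop
      (nhds ((k.factorial : ℝ) * 0)) := by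
    refine Tendsto.const_mul _ (Real.tendsto_exp_atBot.comp ?_)
    refine tendsto_id.atTop_mul_atBot₀ ?_
    have h1 : Tendsto (fun t : ℝ => a * t) atTop atTop := tendsto_id.const_mul_atTop ha
    exact tendsto_const_nhds.add_atBot (tendsto_neg_atTop_atBot.comp h1)
  rw [mul_zero] at hlim
  filter_upwards [hlim.eventually (ge_mem_nhds hε), eventually_ge_atTop 0] with t h1 h0
  refine le_trans ?_ h1
  have h2 := Real.pow_div_factorial_le_exp t h0 k
  rw [div_le_iff₀ (by positivity)] at h2
  calc t ^ k * Real.exp (b * t - a * t ^ 2)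
      ≤ (Real.exp t * k.factorial) * Real.exp (b * t - a * t ^ 2) := by gcongr
    _ = k.factorial * (Real.exp t * Real.exp (b * t - a * t ^ 2)) := by ring
    _ = _ := by rw [← Real.exp_add]; congr 2; ring

/-- The asymptotic regime: `τ` is the effective threshold and `κ` the effective number of
nonzero coordinates. -/
structure SparseRegime (qs τ κ : ℕ → ℝ) (q p : ℝ) : Prop where
  p_nonneg : 0 ≤ p
  p_lt : p < 2
  q_nonneg : 0 ≤ q
  q_lt : q < 1
  tendsto_q : Tendsto qs atTop (nhds q)
  tendsto_τ : Tendsto τ atTop atTop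
  κ_eq : ∀ᶠ n : ℕ in atTop, κ n = n * Real.exp (-τ n ^ 2 / 2) * τ n ^ (-p)
  κ_ge : ∀ᶠ n : ℕ in atTop, τ n ^ 8 / 32 ≤ κ n
  log_le : ∃ C : ℝ, 0 < C ∧ ∀ᶠ n : ℕ in atTop, Real.log n ≤ C * τ n ^ 2
  q_ge : ∃ C : ℝ, 0 < C ∧ ∀ᶠ n : ℕ in atTop, 1 ≤ C * τ n ^ 2 * qs n

/-- The properties of the members of the sparsity classes used in the upper bounds. -/
structure EffSparse {n : ℕ} (p τ κ C : ℝ) (μ : Fin n → ℝ) : Prop where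
  card_mul_le : ∀ x : ℝ, 0 < x →
    ((Finset.univ.filter fun i => x < |μ i|).card : ℝ) * x ^ p ≤ κ * τ ^ p
  sum_min_le : ∑ i, min (μ i ^ 2) (τ ^ 2) ≤ C * (κ * τ ^ 2)

namespace SparseRegime

variable {qs τ κ : ℕ → ℝ} {q p : ℝ}

theorem eventually_basic (h : SparseRegime qs τ κ q p) : ∀ᶠ n : ℕ in atTop,
    0 < n ∧ 0 < qs n ∧ qs n < 1 ∧ 1 ≤ τ n ∧ 1 ≤ κ n := by
  obtain ⟨C, hC, hq⟩ := h.q_ge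
  filter_upwards [eventually_gt_atTop 0, hq, h.tendsto_q.eventually (gt_mem_nhds h.q_lt),
    h.tendsto_τ.eventually_ge_atTop 2, h.κ_ge] with n hn hq hq1 hτ hκ
  refine ⟨hn, ?_, hq1, by linarith, ?_⟩
  · by_contra hcon
    have : C * τ n ^ 2 * qs n ≤ 0 := mul_nonpos_of_nonneg_of_nonpos (by positivity) (not_lt.1 hcon)
    linarith
  · have : (2:ℝ) ^ 8 ≤ τ n ^ 8 := by gcongr
    norm_num at this; linarith

theorem eventually_τ (h : SparseRegime qs τ κ q p) {P : ℝ → Prop} (hP : ∀ᶠ t in atTop, P t) :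
    ∀ᶠ n : ℕ in atTop, P (τ n) := h.tendsto_τ.eventually hP

/-- Powers of `τ` up to the seventh are negligible relative to `κ`. -/
theorem eventually_pow_le_κ (h : SparseRegime qs τ κ q p) {C : ℝ} (hC : 0 < C) {k : ℕ}
    (hk : k ≤ 7) : ∀ᶠ n : ℕ in atTop, C * τ n ^ k ≤ κ n := by
  filter_upwards [h.κ_ge, h.tendsto_τ.eventually_ge_atTop 1,
    h.tendsto_τ.eventually_ge_atTop (32 * C)] with n h1 h2 h3
  refine le_trans ?_ h1
  have h4 : τ n ^ k ≤ τ n ^ 7 := pow_le_pow_right₀ h2 hk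
  have h5 : (0:ℝ) < τ n ^ 7 := by positivity
  have h6 : 32 * C * τ n ^ 7 ≤ τ n * τ n ^ 7 := by gcongr
  have h7 : τ n * τ n ^ 7 = τ n ^ 8 := by ring
  have h8 : C * τ n ^ k ≤ C * τ n ^ 7 := by gcongr
  linarith

theorem eventually_κ_bounds (h : SparseRegime qs τ κ q p) : ∀ᶠ n : ℕ in atTop,
    κ n ≤ n * Real.exp (-τ n ^ 2 / 2) ∧ n * Real.exp (-τ n ^ 2 / 2) ≤ κ n * τ n ^ 2 := by
  filter_upwards [h.κ_eq, h.eventually_basic] with n h1 ⟨hn, _, _, hτ, _⟩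
  have e1 : τ n ^ (-p) ≤ 1 := Real.rpow_le_one_of_one_le_of_nonpos hτ (by linarith [h.p_nonneg])
  have e2 : 1 ≤ τ n ^ (-p) * τ n ^ 2 := by
    rw [← Real.rpow_natCast (τ n) 2, ← Real.rpow_add (by linarith)]
    exact Real.one_le_rpow hτ (by push_cast; linarith [h.p_lt])
  have e3 : 0 ≤ (n:ℝ) * Real.exp (-τ n ^ 2 / 2) := by positivity
  rw [h1]
  constructor
  · nlinarith
  · nlinarith

/-- Even `κ τ⁴` is negligible relative to `n`. -/
theorem eventually_κ_le (h : SparseRegime qs τ κ q p) {ε : ℝ} (hε : 0 < ε) :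
    ∀ᶠ n : ℕ in atTop, κ n * τ n ^ 4 ≤ ε * n := by
  filter_upwards [h.eventually_κ_bounds, h.eventually_τ (eventually_pow_mul_exp_le 4 0
    (a := 1 / 2) (by norm_num) hε), h.eventually_basic] with n ⟨h1, _⟩ h2 ⟨_, _, _, hτ, _⟩
  have e : Real.exp (0 * τ n - 1 / 2 * τ n ^ 2) = Real.exp (-τ n ^ 2 / 2) := by congr 1; ring
  rw [e] at h2
  calc κ n * τ n ^ 4 ≤ n * Real.exp (-τ n ^ 2 / 2) * τ n ^ 4 := by gcongr
    _ = n * (τ n ^ 4 * Real.exp (-τ n ^ 2 / 2)) := by ring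
    _ ≤ n * ε := by gcongr
    _ = _ := by ring

/-- Up to rank κτ⁴ the quantile level is at most τ⁴e^{-τ²/2}, and the polynomial factor is beaten by
the ratio of Gaussian tails at (1 - ε)τ and τ. -/
theorem eventually_le_thr (h : SparseRegime qs τ κ q p) {ε : ℝ} (hε : 0 < ε) (hε1 : ε < 1) :
    ∀ᶠ n : ℕ in atTop, ∀ x : ℝ, 0 < x → x ≤ κ n * τ n ^ 4 → (1 - ε) * τ n ≤ thr n (qs n) x := by
  have ha : 0 < (1 - (1 - ε) ^ 2) / 2 := by nlinarith
  filter_upwards [h.eventually_κ_bounds, h.eventually_basic, h.eventually_τ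
    (eventually_pow_mul_exp_le 4 (1 - ε) ha (ε := Real.exp (-(1/2)) / 3) (by positivity))]
    with n ⟨h1, _⟩ ⟨hn, hq0, hq1, hτ, hκ⟩ h2 x hx hxκ
  have hn' : (0:ℝ) < n := by exact_mod_cast hn
  have hs0 : 0 ≤ (1 - ε) * τ n := mul_nonneg (by linarith) (by linarith)
  have key : qs n / 2 * (x / n) ≤ gaussTail ((1 - ε) * τ n) := by
    refine le_trans ?_ (le_gaussTail hs0)
    have e1 : x / n ≤ Real.exp (-τ n ^ 2 / 2) * τ n ^ 4 := by
      rw [div_le_iff₀ hn']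
      calc x ≤ κ n * τ n ^ 4 := hxκ
        _ ≤ n * Real.exp (-τ n ^ 2 / 2) * τ n ^ 4 := by gcongr
        _ = _ := by ring
    have e0 : 0 ≤ x / n := by positivity
    have e2 : qs n / 2 * (x / n) ≤ Real.exp (-τ n ^ 2 / 2) * τ n ^ 4 := by nlinarith
    refine e2.trans ?_
    have e3 : Real.exp (-((1 - ε) * τ n + 1) ^ 2 / 2) / 3 = (Real.exp (-(1/2)) / 3)
        * Real.exp (-((1 - ε) * τ n + (1 - ε) ^ 2 / 2 * τ n ^ 2)) := by
      rw [div_mul_eq_mul_div, ← Real.exp_add]; congr 2; ring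
    have e4 : Real.exp (-τ n ^ 2 / 2) * τ n ^ 4
        = (τ n ^ 4 * Real.exp ((1 - ε) * τ n - (1 - (1 - ε) ^ 2) / 2 * τ n ^ 2))
          * Real.exp (-((1 - ε) * τ n + (1 - ε) ^ 2 / 2 * τ n ^ 2)) := by
      rw [mul_assoc, ← Real.exp_add, mul_comm]; congr 2; ring
    rw [e3, e4]
    gcongr
  have hα1 : qs n / 2 * (x / n) < 1 := by
    have := gaussTail_strictAnti.antitone hs0
    rw [gaussTail_zero] at this; linarith
  exact (le_upperQuantile_iff (thr_arg_pos hn hq0 hx) hα1).2 key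

/-- From rank κ/τ on, the quantile level is at least e^{-τ²/2} divided by a multiple of τ⁵. The
lower bound on q_n enters only through a factor τ², negligible against the tail ratio. -/
theorem eventually_thr_le (h : SparseRegime qs τ κ q p) {ε : ℝ} (hε : 0 < ε) :
    ∀ᶠ n : ℕ in atTop, ∀ x : ℝ, κ n / τ n ≤ x → qs n * x ≤ n →
      thr n (qs n) x ≤ (1 + ε) * τ n := by
  obtain ⟨C, hC, hq⟩ := h.q_ge
  have ha : 0 < ((1 + ε) ^ 2 - 1) / 2 := by nlinarith
  filter_upwards [h.eventually_κ_bounds, h.eventually_basic, hq, h.eventually_τ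
    (eventually_pow_mul_exp_le 5 0 ha (ε := 1 / (2 * C)) (by positivity))]
    with n ⟨_, h1⟩ ⟨hn, hq0, hq1, hτ, hκ⟩ hq h2 x hx hxn
  have hn' : (0:ℝ) < n := by exact_mod_cast hn
  have hτ0 : 0 < τ n := by linarith
  have hx0 : 0 < x := lt_of_lt_of_le (by positivity) hx
  have hα1 : qs n / 2 * (x / n) < 1 := by linarith [thr_arg_le hn hxn]
  refine (upperQuantile_le_iff (thr_arg_pos hn hq0 hx0) hα1).2 ?_
  refine (gaussTail_le_exp (by positivity)).trans ?_
  have e1 : Real.exp (-τ n ^ 2 / 2) ≤ (x / n) * τ n ^ 3 := by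
    rw [div_mul_eq_mul_div, le_div_iff₀ hn']
    rw [div_le_iff₀ hτ0] at hx
    have : κ n * τ n ^ 2 ≤ x * τ n * τ n ^ 2 := by gcongr
    linarith
  have e2 : Real.exp (-τ n ^ 2 / 2) ≤ 2 * C * τ n ^ 5 * (qs n / 2 * (x / n)) := by
    have h3 : (x / n) * τ n ^ 3 * 1 ≤ (x / n) * τ n ^ 3 * (C * τ n ^ 2 * qs n) := by gcongr
    nlinarith
  have e3 : Real.exp (-((1 + ε) * τ n) ^ 2 / 2)
      = Real.exp (0 * τ n - ((1 + ε) ^ 2 - 1) / 2 * τ n ^ 2) * Real.exp (-τ n ^ 2 / 2) := by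
    rw [← Real.exp_add]; congr 1; ring
  have hα0 : 0 < qs n / 2 * (x / n) := thr_arg_pos hn hq0 hx0
  rw [e3]
  calc _ ≤ Real.exp (0 * τ n - ((1 + ε) ^ 2 - 1) / 2 * τ n ^ 2)
        * (2 * C * τ n ^ 5 * (qs n / 2 * (x / n))) := by gcongr
    _ = 2 * C * (τ n ^ 5 * Real.exp (0 * τ n - ((1 + ε) ^ 2 - 1) / 2 * τ n ^ 2))
        * (qs n / 2 * (x / n)) := by ring
    _ ≤ 2 * C * (1 / (2 * C)) * (qs n / 2 * (x / n)) := by gcongr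
    _ = _ := by field_simp

theorem exists_large_level (h : SparseRegime qs τ κ q p) : ∃ D : ℝ, 1 ≤ D ∧
    ∀ᶠ n : ℕ in atTop, n * (τ n ^ 2 * Real.exp (D * τ n - (D * τ n) ^ 2 / 2)) ≤ 1 := by
  obtain ⟨C, hC, hl⟩ := h.log_le
  -- Since n ≤ e^{Cτ²}, it suffices that half the square of the constant be at least C + 1.
  refine ⟨2 * C + 2, by linarith, ?_⟩
  filter_upwards [hl, h.eventually_basic, h.eventually_τ
    (eventually_pow_mul_exp_le 2 (2 * C + 2) one_pos one_pos)]
    with n hl ⟨hn, _⟩ h2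
  have hn' : (0:ℝ) < n := by exact_mod_cast hn
  have e1 : (n:ℝ) ≤ Real.exp (C * τ n ^ 2) := by
    rw [← Real.log_le_iff_le_exp hn']; exact hl
  calc n * (τ n ^ 2 * Real.exp ((2 * C + 2) * τ n - ((2 * C + 2) * τ n) ^ 2 / 2))
      ≤ Real.exp (C * τ n ^ 2)
        * (τ n ^ 2 * Real.exp ((2 * C + 2) * τ n - ((2 * C + 2) * τ n) ^ 2 / 2)) := by gcongr
    _ = τ n ^ 2 * Real.exp (C * τ n ^ 2 + ((2 * C + 2) * τ n - ((2 * C + 2) * τ n) ^ 2 / 2)) := by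
        rw [Real.exp_add]; ring
    _ ≤ τ n ^ 2 * Real.exp ((2 * C + 2) * τ n - 1 * τ n ^ 2) := by
        gcongr
        nlinarith [mul_nonneg (mul_nonneg hC.le hC.le) (sq_nonneg (τ n)),
          mul_nonneg hC.le (sq_nonneg (τ n)), sq_nonneg (τ n)]
    _ ≤ 1 := h2

theorem exists_thr_one_le (h : SparseRegime qs τ κ q p) : ∃ D : ℝ, 1 ≤ D ∧
    ∀ᶠ n : ℕ in atTop, thr n (qs n) 1 ≤ D * τ n ∧ noiseEnergy n (qs n) 1 ≤ D * τ n ^ 2 := by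
  obtain ⟨D, hD, hl⟩ := h.exists_large_level
  obtain ⟨C, hC, hq⟩ := h.q_ge
  -- The noise energy above t_1 splits at Dτ: below it at most q values are expected, each of energy
  -- at most D²τ²; beyond it the tail contributes at most 8.
  refine ⟨D ^ 2 + 8, by nlinarith, ?_⟩
  filter_upwards [hl, hq, h.eventually_basic,
    h.tendsto_τ.eventually_ge_atTop (2 * C)] with n hl hq ⟨hn, hq0, hq1, hτ, _⟩ hτC
  have hn' : (0:ℝ) < n := by exact_mod_cast hn
  have hn1 : (1:ℝ) ≤ n := by exact_mod_cast hn
  have hqn : qs n * 1 ≤ n := by linarith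
  have hτ0 : 0 < τ n := by linarith
  have hα1 : qs n / 2 * (1 / n) < 1 := by linarith [thr_arg_le hn hqn]
  have hT0 : 0 ≤ D * τ n := by positivity
  have e1 : Real.exp (D * τ n) ≥ 2 * C := by
    have := Real.add_one_le_exp (D * τ n)
    nlinarith
  have key : Real.exp (-(D * τ n) ^ 2 / 2) ≤ qs n / 2 * (1 / n) := by
    have e2 : Real.exp (D * τ n - (D * τ n) ^ 2 / 2)
        = Real.exp (D * τ n) * Real.exp (-(D * τ n) ^ 2 / 2) := by
      rw [← Real.exp_add]; congr 1; ring
    rw [e2] at hl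
    set E := Real.exp (-(D * τ n) ^ 2 / 2) with hE
    have hE0 : 0 < E := Real.exp_pos _
    have e3 : n * (τ n ^ 2 * (2 * C * E)) ≤ 1 :=
      le_trans (by gcongr) hl
    rw [div_mul_div_comm, mul_one, le_div_iff₀ (by positivity)]
    have e4 : n * (τ n ^ 2 * (2 * C * E)) * qs n ≤ 1 * qs n := by gcongr
    have e5 : E * (2 * n) * 1 ≤ E * (2 * n) * (C * τ n ^ 2 * qs n) := by gcongr
    nlinarith
  have ht1 : thr n (qs n) 1 ≤ D * τ n :=
    (upperQuantile_le_iff (thr_arg_pos hn hq0 one_pos) hα1).2 ((gaussTail_le_exp hT0).trans key)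
  refine ⟨ht1.trans (by nlinarith), ?_⟩
  have h1 := (tailEnergy_sub_bounds (thr_nonneg hn hq0 one_pos hqn) ht1).2
  have h2 := two_tail_thr hn hq0 one_pos hqn
  have h3 : tailEnergy (D * τ n) ≤ 2 * (2 * Real.exp (1 / 2 + D * τ n - (D * τ n) ^ 2 / 2)) := by
    have := integral_pow_tail_le 2 hT0
    simpa [tailEnergy, sq_abs] using this
  have h4 : Real.exp (1 / 2 + D * τ n - (D * τ n) ^ 2 / 2)
      ≤ 2 * Real.exp (D * τ n - (D * τ n) ^ 2 / 2) := by
    rw [add_sub_assoc, Real.exp_add]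
    have : Real.exp (1 / 2) ≤ 2 := by
      have h5 : Real.exp (1 / 2) ^ 2 = Real.exp 1 := by rw [← Real.exp_nat_mul]; norm_num
      have := Real.exp_one_lt_d9
      nlinarith [Real.exp_pos (1 / 2)]
    gcongr
  set E := Real.exp (D * τ n - (D * τ n) ^ 2 / 2) with hE
  have hE0 : 0 < E := Real.exp_pos _
  have hτ2 : 1 ≤ τ n ^ 2 := one_le_pow₀ hτ
  have h5 : n * E ≤ 1 := by
    have : n * E * 1 ≤ n * E * τ n ^ 2 := by gcongr
    nlinarith
  have h6 : tailEnergy (thr n (qs n) 1)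
      ≤ (D * τ n) ^ 2 * (gaussianReal 0 1).real (absGe (thr n (qs n) 1)) + 8 * E := by
    have : 0 ≤ (D * τ n) ^ 2 * (gaussianReal 0 1).real (absGe (D * τ n)) := by positivity
    linarith
  calc noiseEnergy n (qs n) 1 = n * tailEnergy (thr n (qs n) 1) := rfl
    _ ≤ n * ((D * τ n) ^ 2 * (gaussianReal 0 1).real (absGe (thr n (qs n) 1)) + 8 * E) := by gcongr
    _ = (D * τ n) ^ 2 * (n * (gaussianReal 0 1).real (absGe (thr n (qs n) 1))) + 8 * (n * E) := by
        ring
    _ ≤ (D * τ n) ^ 2 * 1 + 8 * τ n ^ 2 := by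
        rw [h2]; gcongr
        · linarith
        · linarith
    _ = _ := by ring

/-- The boundary is bounded away from zero. -/
theorem exists_le_thr_sq (h : SparseRegime qs τ κ q p) : ∃ c : ℝ, 0 < c ∧
    ∀ᶠ n : ℕ in atTop, ∀ k : ℕ, k ≤ n → c * k ≤ penSum n (qs n) k := by
  have hq1 := h.q_lt
  have hq0 := h.q_nonneg
  -- Eventually q_n < (1 + q)/2 < 1, so even the last boundary value z(q_n/2) stays above z((1 +
  -- q)/4) > 0. This lets the support size be bounded by a multiple of the penalty.
  have hpos := upperQuantile_pos (α := (1 + q) / 4) (by linarith) (by linarith)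
  refine ⟨upperQuantile ((1 + q) / 4) ^ 2, by positivity, ?_⟩
  filter_upwards [h.eventually_basic, h.tendsto_q.eventually
    (gt_mem_nhds (show q < (1 + q) / 2 by linarith))] with n ⟨hn, hq0, hq1, _⟩ hq2 k hk
  have hn' : (0:ℝ) < n := by exact_mod_cast hn
  have h1 := le_penSum hn hq0 k (x := n) (by nlinarith) (by exact_mod_cast hk)
  refine le_trans ?_ h1
  rw [mul_comm]
  have h2 : upperQuantile ((1 + q) / 4) ≤ thr n (qs n) n := by
    rw [thr, div_self hn'.ne', mul_one]
    exact (upperQuantile_lt (by linarith) (by linarith) (by linarith)).le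
  gcongr

theorem exists_card_levels_le (h : SparseRegime qs τ κ q p) {δ : ℝ} (hδ : 0 < δ) : ∃ D : ℝ,
    0 < D ∧ ∀ᶠ n : ℕ in atTop, ((levels n δ).card : ℝ) ≤ D * τ n ^ 2 := by
  obtain ⟨C, hC, hl⟩ := h.log_le
  have hl0 : 0 < Real.log (1 + δ) := Real.log_pos (by linarith)
  refine ⟨C / Real.log (1 + δ) + 1, by positivity, ?_⟩
  filter_upwards [hl, h.eventually_basic] with n hl ⟨hn, _, _, hτ, _⟩
  refine (card_levels_le hn hδ).trans ?_
  have : 1 ≤ τ n ^ 2 := one_le_pow₀ hτ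
  rw [add_mul, div_mul_eq_mul_div]
  gcongr
  linarith

theorem penSum_add_le_mul {n : ℕ} {q : ℝ} (hn : 0 < n) (hq : 0 < q) {a : ℕ} (ha : 1 ≤ a) (b : ℕ)
    (hab : q * ((a + b : ℕ) : ℝ) ≤ n) :
    penSum n q (a + b) ≤ penSum n q a + b * thr n q a ^ 2 := by
  induction b with
  | zero => simp
  | succ b ih =>
    have ha' : (1:ℝ) ≤ a := by exact_mod_cast ha
    have h1 := ih (le_trans (by push_cast; nlinarith) hab)
    rw [← add_assoc, penSum_succ, fdrBoundary_eq_thr]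
    have h2 := thr_le hn hq (x := a) (x' := ((a + b + 1 : ℕ) : ℝ)) (by linarith)
      (by push_cast; linarith [Nat.cast_nonneg (α := ℝ) b]) hab
    have h3 := thr_nonneg hn hq (x := ((a + b + 1 : ℕ) : ℝ)) (by positivity) hab
    have h4 : thr n q ((a + b + 1 : ℕ) : ℝ) ^ 2 ≤ thr n q a ^ 2 := by gcongr
    push_cast at h4 ⊢
    linarith

/-- The first κ/τ ranks have boundary values up to Dτ but contribute only O(κτ); at all later ranks
the boundary is at most (1 + ε')τ. -/
theorem eventually_penSum_le (h : SparseRegime qs τ κ q p) {ε ρ : ℝ} (hε : 0 < ε) (hρ : 0 < ρ) :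
    ∀ᶠ n : ℕ in atTop, ∀ m : ℕ, ρ * κ n ≤ m → m ≤ n →
      penSum n (qs n) m ≤ (1 + ε) * (m * τ n ^ 2) := by
  obtain ⟨D, hD, ht⟩ := h.exists_thr_one_le
  set ε' := min 1 (ε / 6) with hε'
  have hε'0 : 0 < ε' := by positivity
  have hε'1 : ε' ≤ 1 := min_le_left _ _
  have hε'2 : ε' ≤ ε / 6 := min_le_right _ _
  filter_upwards [ht, h.eventually_thr_le hε'0, h.eventually_basic,
    h.tendsto_τ.eventually_ge_atTop (2 / ρ),
    h.tendsto_τ.eventually_ge_atTop (4 * D ^ 2 / (ε * ρ)), h.eventually_pow_le_κ one_pos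
      (k := 1) (by norm_num)]
    with n ⟨ht, _⟩ ht2 ⟨hn, hq0, hq1, hτ, hκ⟩ hτ1 hτ2 hκτ m hm hmn
  have hτ0 : 0 < τ n := by linarith
  have hn' : (0:ℝ) < n := by exact_mod_cast hn
  have hmn' : (m:ℝ) ≤ n := by exact_mod_cast hmn
  set a := ⌈κ n / τ n⌉₊ with ha
  have ha0 : 0 < κ n / τ n := by positivity
  have ha1 : 1 ≤ a := Nat.ceil_pos.2 ha0
  have hage : κ n / τ n ≤ a := Nat.le_ceil _
  have hκτ1 : 1 ≤ κ n / τ n := by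
    rw [le_div_iff₀ hτ0]; simpa using hκτ
  have hale : (a:ℝ) ≤ 2 * (κ n / τ n) := by
    have := (Nat.ceil_lt_add_one ha0.le).le
    linarith
  have ham : a ≤ m := by
    have : (a:ℝ) ≤ m := by
      refine hale.trans (le_trans ?_ hm)
      rw [div_le_iff₀ hρ] at hτ1
      rw [← mul_div_assoc, div_le_iff₀ hτ0]
      nlinarith
    exact_mod_cast this
  obtain ⟨b, rfl⟩ := Nat.exists_eq_add_of_le ham
  have hqm : qs n * ((a + b : ℕ) : ℝ) ≤ n := by nlinarith [Nat.cast_nonneg (α := ℝ) (a + b)]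
  have hqa : qs n * (a:ℝ) ≤ n := le_trans (by push_cast; nlinarith [Nat.cast_nonneg (α := ℝ) b]) hqm
  have h1 := penSum_add_le_mul hn hq0 ha1 b hqm
  have h2 := penSum_le_mul hn hq0 a hqa
  have h3 := ht2 a hage hqa
  have h4 := thr_nonneg hn hq0 (x := (a:ℝ)) (by exact_mod_cast ha1) hqa
  have hn1 : (1:ℝ) ≤ n := by exact_mod_cast hn
  have h5 := thr_nonneg hn hq0 one_pos (by linarith)
  have h6 : (a:ℝ) * thr n (qs n) 1 ^ 2 ≤ ε / 2 * (((a + b : ℕ) : ℝ) * τ n ^ 2) := by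
    calc (a:ℝ) * thr n (qs n) 1 ^ 2 ≤ 2 * (κ n / τ n) * (D * τ n) ^ 2 := by gcongr
      _ = 2 * D ^ 2 * κ n * τ n := by field_simp
      _ ≤ ε / 2 * (ρ * κ n * τ n ^ 2) := by
          rw [div_le_iff₀ (by positivity)] at hτ2
          have := mul_le_mul_of_nonneg_left hτ2 (by positivity : 0 ≤ κ n * τ n / 2)
          nlinarith
      _ ≤ _ := by gcongr
  have h7 : (b:ℝ) * thr n (qs n) a ^ 2 ≤ (1 + ε / 2) * (((a + b : ℕ) : ℝ) * τ n ^ 2) := by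
    have e1 : (1 + ε') ^ 2 ≤ 1 + ε / 2 := by nlinarith
    calc (b:ℝ) * thr n (qs n) a ^ 2 ≤ ((a + b : ℕ) : ℝ) * ((1 + ε') * τ n) ^ 2 := by
          gcongr; linarith [Nat.cast_nonneg (α := ℝ) a]
      _ = (1 + ε') ^ 2 * (((a + b : ℕ) : ℝ) * τ n ^ 2) := by ring
      _ ≤ _ := by gcongr
  linarith

/-! ### Excess counts and energies over the small coordinates -/

theorem sum_sq_le_of_effSparse {n : ℕ} {p τ κ C : ℝ} {μ : Fin n → ℝ} (hμ : EffSparse p τ κ C μ)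
    {G : Finset (Fin n)} (hG : ∀ i ∈ G, |μ i| ≤ τ) : ∑ i ∈ G, μ i ^ 2 ≤ C * (κ * τ ^ 2) := by
  refine le_trans ?_ hμ.sum_min_le
  calc ∑ i ∈ G, μ i ^ 2 = ∑ i ∈ G, min (μ i ^ 2) (τ ^ 2) := by
        refine Finset.sum_congr rfl fun i hi => (min_eq_left ?_).symm
        rw [← sq_abs (μ i)]
        have := hG i hi
        gcongr
    _ ≤ _ := Finset.sum_le_sum_of_subset_of_nonneg (Finset.subset_univ _)
        fun i _ _ => by positivity

/-- The null part is exact, so only the second-order excess Σ r μ_i² matters, with Σ μ_i² ≤ Cκτ². At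
moderate ranks the gap between (1 - ε)τ and the boundary makes r exponentially small; at large ranks
the allowance δx itself dominates. -/
theorem eventually_excess_le (h : SparseRegime qs τ κ q p) {ε δ C : ℝ} (hε : 0 < ε) (hε1 : ε < 1)
    (hδ : 0 < δ) (hC : 0 < C) :
    ∀ᶠ n : ℕ in atTop, ∀ μ : Fin n → ℝ, EffSparse p (τ n) (κ n) C μ →
      ∀ G : Finset (Fin n), (∀ i ∈ G, |μ i| ≤ (1 - ε) * τ n) → ∀ x : ℝ, 0 < x → qs n * x ≤ n →
        ∑ i ∈ G, (gaussianReal (μ i) 1).real (absGe (thr n (qs n) x))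
            ≤ qs n * x + δ * (κ n + x) ∧
          ∑ i ∈ G, ∫ y, energyFun (qs n) μ x i y ∂gaussianReal (μ i) 1
            ≤ noiseEnergy n (qs n) x + δ * (κ n + x) := by
  have ha : 0 < ε ^ 2 / 8 := by positivity
  filter_upwards [h.eventually_basic, h.eventually_le_thr (half_pos hε) (by linarith),
    h.tendsto_τ.eventually_ge_atTop (2400 * C / δ),
    h.eventually_τ (eventually_pow_mul_exp_le 6 (ε / 2) ha (ε := δ / (4800 * C)) (by positivity))]
    with n ⟨hn, hq0, hq1, hτ, hκ⟩ hthr hτδ hexp μ hμ G hG x hx hxn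
  have hn' : (0:ℝ) < n := by exact_mod_cast hn
  have hτ0 : 0 < τ n := by linarith
  set t := thr n (qs n) x with ht
  have ht0 : 0 ≤ t := thr_nonneg hn hq0 hx hxn
  have hGτ : ∀ i ∈ G, |μ i| ≤ τ n := fun i hi => (hG i hi).trans (by nlinarith)
  have hsum := sum_sq_le_of_effSparse hμ hGτ
  have hcard : (G.card : ℝ) ≤ n := by
    exact_mod_cast (by simpa using Finset.card_le_univ G : G.card ≤ n)
  have hnull1 : ∑ i ∈ G, (gaussianReal 0 1).real (absGe t) ≤ qs n * x := by
    rw [← two_tail_thr hn hq0 hx hxn, Finset.sum_const, nsmul_eq_mul]; gcongr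
  have hnull2 : ∑ i ∈ G, tailEnergy t ≤ noiseEnergy n (qs n) x := by
    rw [Finset.sum_const, nsmul_eq_mul]
    have := tailEnergy_nonneg t
    unfold noiseEnergy; gcongr
  obtain ⟨r, hr, hr1, hr2⟩ : ∃ r : ℝ, r * (C * (κ n * τ n ^ 2)) ≤ δ * (κ n + x) ∧
      (∀ i ∈ G, (gaussianReal (μ i) 1).real (absGe t)
        ≤ (gaussianReal 0 1).real (absGe t) + r * μ i ^ 2) ∧
      (0 ≤ r ∧ ∀ i ∈ G, ∫ y, (absGe t).indicator (meanSq (μ i)) y ∂gaussianReal (μ i) 1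
        ≤ tailEnergy t + r * μ i ^ 2) := by
    rcases le_or_gt x (κ n * τ n ^ 4) with hxκ | hxκ
    · have h1 := hthr x hx hxκ
      -- The gap between means of size at most (1 - ε)τ and a boundary of size at least (1 - ε/2)τ.
      set s := ε / 2 * τ n with hs
      set E := Real.exp (1 / 2 + s - s ^ 2 / 2) with hE
      have hQ : ∀ i ∈ G, tailQuartic (μ i) t ≤ 1200 * τ n ^ 4 * E := by
        intro i hi
        have h2 := tailQuartic_le (s := s) (a := (1 - ε) * τ n) (t := t) (by positivity) (hG i hi)
          (le_trans (le_of_eq (by rw [hs]; ring)) h1)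
        refine h2.trans ?_
        have h3 : ((1 - ε) * τ n) ^ 4 ≤ τ n ^ 4 := by
          have : (1 - ε) * τ n ≤ τ n := by nlinarith
          have : 0 ≤ (1 - ε) * τ n := mul_nonneg (by linarith) hτ0.le
          gcongr
        have h4 : 1 ≤ τ n ^ 4 := one_le_pow₀ hτ
        have : 400 * (2 + ((1 - ε) * τ n) ^ 4) ≤ 1200 * τ n ^ 4 := by linarith
        gcongr
      refine ⟨600 * τ n ^ 4 * E, ?_, ?_, by positivity, ?_⟩
      · have e1 : E ≤ 2 * Real.exp (ε / 2 * τ n - ε ^ 2 / 8 * τ n ^ 2) := by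
          have e2 : E = Real.exp (1 / 2) * Real.exp (ε / 2 * τ n - ε ^ 2 / 8 * τ n ^ 2) := by
            rw [hE, ← Real.exp_add]; congr 1; rw [hs]; ring
          rw [e2]
          gcongr
          have h5 : Real.exp (1 / 2) ^ 2 = Real.exp 1 := by rw [← Real.exp_nat_mul]; norm_num
          have := Real.exp_one_lt_d9
          nlinarith [Real.exp_pos (1 / 2)]
        set E' := Real.exp (ε / 2 * τ n - ε ^ 2 / 8 * τ n ^ 2) with hE'
        rw [le_div_iff₀ (by positivity)] at hexp
        calc 600 * τ n ^ 4 * E * (C * (κ n * τ n ^ 2))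
            ≤ 600 * τ n ^ 4 * (2 * E') * (C * (κ n * τ n ^ 2)) := by gcongr
          _ = (τ n ^ 6 * E' * (4800 * C)) * (κ n / 4) := by ring
          _ ≤ δ * (κ n / 4) := by gcongr
          _ ≤ _ := by gcongr; linarith
      · intro i hi
        have h2 := tailCount_le (μ i) t
        have h3 := mul_le_mul_of_nonneg_left (hQ i hi) (by positivity : 0 ≤ μ i ^ 2 / 2)
        linarith
      · intro i hi
        have h2 := tailMeanSq_le (μ i) t
        have h3 := mul_le_mul_of_nonneg_left (hQ i hi) (by positivity : 0 ≤ μ i ^ 2 / 2)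
        linarith
    -- Here x > κτ⁴, which exceeds Cκτ² by the factor τ²/C, so the crude constant suffices.
    · refine ⟨2400, ?_, fun i _ => (tail_excess_le_sq ht0).1, by norm_num,
        fun i _ => (tail_excess_le_sq ht0).2⟩
      rw [div_le_iff₀ hδ] at hτδ
      have h1 : τ n ^ 3 ≤ τ n ^ 4 := pow_le_pow_right₀ hτ (by norm_num)
      calc 2400 * (C * (κ n * τ n ^ 2)) = 2400 * C * (κ n * τ n ^ 2) := by ring
        _ ≤ τ n * δ * (κ n * τ n ^ 2) := by gcongr
        _ = δ * (κ n * τ n ^ 3) := by ring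
        _ ≤ δ * (κ n * τ n ^ 4) := by gcongr
        _ ≤ _ := by gcongr; linarith
  obtain ⟨hr0, hr3⟩ := hr2
  have hrs : ∑ i ∈ G, r * μ i ^ 2 ≤ δ * (κ n + x) := by
    rw [← Finset.mul_sum]; exact (mul_le_mul_of_nonneg_left hsum hr0).trans hr
  constructor
  · have := Finset.sum_le_sum hr1
    rw [Finset.sum_add_distrib] at this
    linarith
  · have := Finset.sum_le_sum hr3
    rw [Finset.sum_add_distrib] at this
    unfold energyFun
    linarith

/-- The energy weight squared is O(τ⁴) unless the noise exceeds Dτ, which has negligible total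
effect over n coordinates; so the variance is O(τ⁴) times the count. -/
theorem exists_variance_le (h : SparseRegime qs τ κ q p) : ∃ D : ℝ, 0 < D ∧
    ∀ᶠ n : ℕ in atTop, ∀ μ : Fin n → ℝ, ∀ G : Finset (Fin n), (∀ i ∈ G, |μ i| ≤ τ n) →
      ∀ x : ℝ, 0 < x →
        ∑ i ∈ G, (gaussianReal (μ i) 1).real (absGe (thr n (qs n) x)) ≤ qs n * x + (κ n + x) →
        ∑ i ∈ G, ∫ y, energyFun (qs n) μ x i y ^ 2 ∂gaussianReal (μ i) 1
          ≤ D * τ n ^ 4 * (κ n * τ n ^ 2 + x) := by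
  obtain ⟨D, hD, hl⟩ := h.exists_large_level
  refine ⟨18 * D ^ 4 + 864, by positivity, ?_⟩
  filter_upwards [h.eventually_basic, hl] with n ⟨hn, hq0, hq1, hτ, hκ⟩ hl μ G hG x hx hcount
  have hτ0 : 0 < τ n := by linarith
  have hcard : (G.card : ℝ) ≤ n := by
    exact_mod_cast (by simpa using Finset.card_le_univ G : G.card ≤ n)
  set T := D * τ n with hT
  have h1 : ∀ i ∈ G, ∫ y, energyFun (qs n) μ x i y ^ 2 ∂gaussianReal (μ i) 1
      ≤ 9 * T ^ 4 * (gaussianReal (μ i) 1).real (absGe (thr n (qs n) x))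
        + 432 * Real.exp (1 / 2 + T - T ^ 2 / 2) := fun i hi =>
    integral_indicator_meanSq_sq_le (by positivity) ((hG i hi).trans (by nlinarith))
  have h2 := Finset.sum_le_sum h1
  rw [Finset.sum_add_distrib, ← Finset.mul_sum, Finset.sum_const, nsmul_eq_mul] at h2
  have h4 : Real.exp (1 / 2 + T - T ^ 2 / 2) ≤ 2 * Real.exp (T - T ^ 2 / 2) := by
    rw [add_sub_assoc, Real.exp_add]
    have : Real.exp (1 / 2) ≤ 2 := by
      have h5 : Real.exp (1 / 2) ^ 2 = Real.exp 1 := by rw [← Real.exp_nat_mul]; norm_num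
      have := Real.exp_one_lt_d9
      nlinarith [Real.exp_pos (1 / 2)]
    gcongr
  set E := Real.exp (T - T ^ 2 / 2) with hE
  have hE0 : 0 < E := Real.exp_pos _
  have hτ2 : 1 ≤ τ n ^ 2 := one_le_pow₀ hτ
  have hτ4 : 1 ≤ τ n ^ 4 := one_le_pow₀ hτ
  have h5 : n * E ≤ 1 := by
    have : n * E * 1 ≤ n * E * τ n ^ 2 := by gcongr
    nlinarith
  have h6 : (G.card : ℝ) * (432 * Real.exp (1 / 2 + T - T ^ 2 / 2)) ≤ 864 := by
    calc _ ≤ (n:ℝ) * (432 * (2 * E)) := by gcongr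
      _ = 864 * (n * E) := by ring
      _ ≤ 864 * 1 := by gcongr
      _ = 864 := by ring
  have h7 : qs n * x + (κ n + x) ≤ 2 * (κ n * τ n ^ 2 + x) := by nlinarith
  have h8 : 9 * T ^ 4 * ∑ i ∈ G, (gaussianReal (μ i) 1).real (absGe (thr n (qs n) x))
      ≤ 9 * T ^ 4 * (2 * (κ n * τ n ^ 2 + x)) := by
    gcongr; exact hcount.trans h7
  have h10 : 1 ≤ κ n * τ n ^ 2 := one_le_mul_of_one_le_of_one_le hκ hτ2
  have h9 : 1 ≤ τ n ^ 4 * (κ n * τ n ^ 2 + x) :=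
    one_le_mul_of_one_le_of_one_le hτ4 (by linarith)
  calc _ ≤ 9 * T ^ 4 * (2 * (κ n * τ n ^ 2 + x)) + 864 * 1 := by linarith
    _ ≤ 9 * T ^ 4 * (2 * (κ n * τ n ^ 2 + x)) + 864 * (τ n ^ 4 * (κ n * τ n ^ 2 + x)) := by gcongr
    _ = _ := by rw [hT]; ring

end SparseRegime

/-! ### Upper bounds for the penalty and the error functional -/

theorem EffSparse.card_large_mul_le {n : ℕ} {p τ κ C : ℝ} {μ : Fin n → ℝ}
    (hμ : EffSparse p τ κ C μ) (hp : p ≤ 2) (hτ : 0 < τ) {δ : ℝ} (hδ : 0 ≤ δ)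
    (hδ1 : δ < 1) :
    ((Finset.univ.filter fun i => |μ i| ≤ (1 - δ) * τ)ᶜ.card : ℝ) * (1 - δ) ^ 2 ≤ κ := by
  have h1 := hμ.card_mul_le ((1 - δ) * τ) (mul_pos (by linarith) hτ)
  have h2 : (Finset.univ.filter fun i => |μ i| ≤ (1 - δ) * τ)ᶜ
      = Finset.univ.filter fun i => (1 - δ) * τ < |μ i| := by
    ext i; simp
  rw [h2]
  rw [Real.mul_rpow (by linarith) hτ.le, ← mul_assoc] at h1
  have h3 := le_of_mul_le_mul_right h1 (Real.rpow_pos_of_pos hτ p)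
  refine le_trans ?_ h3
  rw [← Real.rpow_natCast]
  have := Real.rpow_le_rpow_of_exponent_ge (x := 1 - δ) (by linarith) (by linarith) hp
  push_cast
  gcongr

/-- Subadditivity separates the typical support size, priced at the typical boundary, from the
fluctuation r, priced at t_1². The latter is affordable because E r is only a power of τ. -/
theorem fdrPen_le_of_card_le {n : ℕ} {q a r : ℝ} {x : Fin n → ℝ} (hn : 0 < n) (hq : 0 < q)
    (hq1 : q < 1) {M : ℕ} (hM : a ≤ M) (hk : (hammingNorm x : ℝ) ≤ a + r) (hr : 0 ≤ r) :
    fdrPen q x ≤ penSum n q M + r * thr n q 1 ^ 2 := by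
  rw [fdrPen_eq_penSum]
  have hnn : 0 ≤ r * thr n q 1 ^ 2 := by positivity
  rcases le_total (hammingNorm x) M with hle | hle
  · linarith [penSum_mono n q hle]
  · obtain ⟨b, hb⟩ := Nat.exists_eq_add_of_le hle
    have hkn : ((M + b : ℕ) : ℝ) ≤ n := by
      rw [← hb]; exact_mod_cast IsPenalizedFDR.hammingNorm_le_card x
    have e1 := penSum_add_le hn hq M b (by nlinarith [Nat.cast_nonneg (α := ℝ) (M + b)])
    push_cast at hkn
    have e2 := penSum_le_mul hn hq b (by
      nlinarith [Nat.cast_nonneg (α := ℝ) b, Nat.cast_nonneg (α := ℝ) M])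
    have e3 : (b : ℝ) ≤ r := by
      rw [hb] at hk; push_cast at hk
      linarith
    have e4 : (b : ℝ) * thr n q 1 ^ 2 ≤ r * thr n q 1 ^ 2 := by gcongr
    rw [hb]
    linarith

namespace SparseRegime

variable {qs τ κ : ℕ → ℝ} {q p : ℝ}

/-- With G the coordinates below (1 - δ)τ, its complement has at most κ/(1 - δ)² elements. The
self-bounding inequality for k then gives k ≤ aκ plus a fluctuation, with a close to 1/(1 - q), and
each rank costs about τ². -/
theorem eventually_integral_fdrPen_le_of_level (h : SparseRegime qs τ κ q p) {δ C : ℝ} (hδ : 0 < δ)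
    (hδ1 : δ < 1) (hC : 0 < C) (hd : 0 < 1 - (q + 3 * δ) * (1 + δ)) :
    ∀ᶠ n : ℕ in atTop, ∀ m : (Fin n → ℝ) → Fin n → ℝ, IsPenalizedFDR (qs n) m →
      ∀ μ : Fin n → ℝ, EffSparse p (τ n) (κ n) C μ →
        ∫ y, fdrPen (qs n) (m y) ∂gaussShift μ
          ≤ ((1 + δ) * ((1 / (1 - δ) ^ 2 + 2 * δ) / (1 - (q + 3 * δ) * (1 + δ)) + δ) + δ)
            * (κ n * τ n ^ 2) := by
  set d := 1 - (q + 3 * δ) * (1 + δ) with hd'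
  set a := (1 / (1 - δ) ^ 2 + 2 * δ) / d with ha'
  have hδ2 : 0 < 1 - δ := by linarith
  have ha : 0 < a := by positivity
  obtain ⟨D, hD, ht⟩ := h.exists_thr_one_le
  obtain ⟨D', hD', hlev⟩ := h.exists_card_levels_le hδ
  have hq0 := h.q_nonneg
  filter_upwards [h.eventually_basic, h.eventually_excess_le hδ hδ1 hδ hC, ht, hlev,
    h.tendsto_q.eventually (gt_mem_nhds (show q < q + δ by linarith)),
    h.eventually_penSum_le hδ ha, h.eventually_κ_le (show 0 < 1 / (a + 1) by positivity),
    h.eventually_pow_le_κ (show 0 < 1 / δ by positivity) (k := 0) (by norm_num),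
    h.eventually_pow_le_κ (show 0 < D ^ 2 / d * (D' / (2 * δ)) / δ by positivity) (k := 2)
      (by norm_num)]
    with n ⟨hn, hqn, hqn1, hτ, hκ⟩ hex ⟨ht, _⟩ hlev hqn2 hpen hκn hκ0 hκ2 m hm μ hμ
  have hn' : (0:ℝ) < n := by exact_mod_cast hn
  have hqδ : qs n * (1 + δ) ≤ 1 := by nlinarith
  set G := Finset.univ.filter fun i => |μ i| ≤ (1 - δ) * τ n with hG
  have hGc : (Gᶜ.card : ℝ) ≤ 1 / (1 - δ) ^ 2 * κ n := by
    have := hμ.card_large_mul_le h.p_lt.le (by linarith) hδ.le hδ1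
    rw [one_div, inv_mul_eq_div, le_div_iff₀ (by positivity)]
    exact this
  have hex' := hex μ hμ G (by simp [hG])
  set F := levelDev μ G (countFun n (qs n)) (fun x => δ * (κ n + x)) δ 1 with hF
  have hF0 : ∀ y, 0 ≤ F y := fun y => levelDev_nonneg y
  have hk : ∀ y, (hammingNorm (m y) : ℝ) ≤ a * κ n + F y / d := fun y => by
    have := card_support_le hm hn hqn hδ hqδ (by linarith) μ G (fun x hx hx' => (hex' x hx hx').1) y
    have h2 : (qs n + 2 * δ) * (1 + δ) * hammingNorm (m y)
        ≤ (q + 3 * δ) * (1 + δ) * hammingNorm (m y) := by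
      have : qs n + 2 * δ ≤ q + 3 * δ := by linarith
      exact mul_le_mul_of_nonneg_right (mul_le_mul_of_nonneg_right this (by linarith))
        (Nat.cast_nonneg _)
    -- All multiples of k are moved to the left; d tends to 1 - q as δ tends to 0.
    have h3 : d * hammingNorm (m y) ≤ (1 / (1 - δ) ^ 2 + 2 * δ) * κ n + F y := by
      rw [hd']; linarith
    rw [ha', div_mul_eq_mul_div, ← add_div, le_div_iff₀ hd, mul_comm]
    exact h3
  set M := ⌈a * κ n⌉₊ with hM
  have hM1 : a * κ n ≤ M := Nat.le_ceil _
  have hM2 : (M : ℝ) ≤ a * κ n + 1 := (Nat.ceil_lt_add_one (by positivity)).le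
  have hτ4 : 1 ≤ τ n ^ 4 := one_le_pow₀ hτ
  have hMn : M ≤ n := by
    have : κ n * (a + 1) ≤ n := by
      rw [one_div, inv_mul_eq_div, le_div_iff₀ (by positivity)] at hκn
      refine le_trans ?_ hκn
      have : κ n * 1 ≤ κ n * τ n ^ 4 := by gcongr
      nlinarith
    exact_mod_cast (show (M:ℝ) ≤ n by nlinarith)
  have hpen' : ∀ y, fdrPen (qs n) (m y)
      ≤ penSum n (qs n) M + (D * τ n) ^ 2 / d * F y := fun y => by
    refine (fdrPen_le_of_card_le hn hqn hqn1 hM1 (hk y) (div_nonneg (hF0 y) hd.le)).trans ?_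
    have t0 : 0 ≤ thr n (qs n) 1 := thr_nonneg hn hqn one_pos (by
      have : (1:ℝ) ≤ n := by exact_mod_cast hn
      linarith)
    have t1 : thr n (qs n) 1 ^ 2 ≤ (D * τ n) ^ 2 := pow_le_pow_left₀ t0 ht 2
    have t2 := mul_le_mul_of_nonneg_left t1 (div_nonneg (hF0 y) hd.le)
    have t3 : (D * τ n) ^ 2 / d * F y = F y / d * (D * τ n) ^ 2 := by ring
    rw [t3]
    linarith
  have iF : Integrable F (gaussShift μ) := integrable_levelDev fun x i _ => memLp_countFun x i _
  have iP : Integrable (fun y => fdrPen (qs n) (m y)) (gaussShift μ) :=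
    hm.integrable_comp_hammingNorm (penSum n (qs n)) μ
  have h1 := integral_mono iP ((integrable_const _).add (iF.const_mul _)) hpen'
  simp only [Pi.add_apply] at h1
  rw [integral_add (integrable_const _) (iF.const_mul _), integral_const_mul] at h1
  simp only [integral_const, probReal_univ, one_smul] at h1
  have h2 : ∫ y, F y ∂gaussShift μ ≤ D' * τ n ^ 2 * (1 / (2 * δ)) :=
    (integral_countDev_le hqn1 hδ hδ1 (by linarith) μ G (fun j hj => level_mul_le hn hδ hqδ hj)
      (fun x hx hx' => (hex' x hx hx').1)).trans (by gcongr)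
  have h3 : (D * τ n) ^ 2 / d * ∫ y, F y ∂gaussShift μ ≤ δ * (κ n * τ n ^ 2) := by
    calc _ ≤ (D * τ n) ^ 2 / d * (D' * τ n ^ 2 * (1 / (2 * δ))) := by gcongr
      _ = δ * (D ^ 2 / d * (D' / (2 * δ)) / δ * τ n ^ 2 * τ n ^ 2) := by field_simp
      _ ≤ _ := by gcongr
  have h4 : penSum n (qs n) M ≤ (1 + δ) * ((a + δ) * κ n * τ n ^ 2) := by
    refine (hpen M hM1 hMn).trans ?_
    have : (M : ℝ) ≤ (a + δ) * κ n := by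
      rw [pow_zero, mul_one, div_le_iff₀ hδ] at hκ0
      linarith
    gcongr
  linarith

/-- The expected penalty is at most `(1 / (1 - q) + o(1)) κ τ²`. -/
theorem eventually_integral_fdrPen_le (h : SparseRegime qs τ κ q p) {ε C : ℝ} (hε : 0 < ε)
    (hC : 0 < C) :
    ∀ᶠ n : ℕ in atTop, ∀ m : (Fin n → ℝ) → Fin n → ℝ, IsPenalizedFDR (qs n) m →
      ∀ μ : Fin n → ℝ, EffSparse p (τ n) (κ n) C μ →
        ∫ y, fdrPen (qs n) (m y) ∂gaussShift μ ≤ (1 / (1 - q) + ε) * (κ n * τ n ^ 2) := by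
  have hq := h.q_lt
  have hd0 : Tendsto (fun δ : ℝ => 1 - (q + 3 * δ) * (1 + δ)) (nhdsWithin 0 (Set.Ioi 0))
      (nhds (1 - q)) := by
    have : ContinuousAt (fun δ : ℝ => 1 - (q + 3 * δ) * (1 + δ)) 0 := by fun_prop
    simpa using this.tendsto.mono_left nhdsWithin_le_nhds
  have hf0 : Tendsto (fun δ : ℝ => (1 + δ) * ((1 / (1 - δ) ^ 2 + 2 * δ)
      / (1 - (q + 3 * δ) * (1 + δ)) + δ) + δ) (nhdsWithin 0 (Set.Ioi 0)) (nhds (1 / (1 - q))) := by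
    have : ContinuousAt (fun δ : ℝ => (1 + δ) * ((1 / (1 - δ) ^ 2 + 2 * δ)
      / (1 - (q + 3 * δ) * (1 + δ)) + δ) + δ) 0 := by
      have hne : 1 - q ≠ 0 := by linarith
      fun_prop (disch := first | norm_num; done | simpa using hne)
    simpa using this.tendsto.mono_left nhdsWithin_le_nhds
  have hδ1 : ∀ᶠ δ : ℝ in nhdsWithin 0 (Set.Ioi 0), δ < 1 :=
    nhdsWithin_le_nhds (gt_mem_nhds one_pos)
  have hδ0 : ∀ᶠ δ : ℝ in nhdsWithin 0 (Set.Ioi 0), 0 < δ := self_mem_nhdsWithin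
  obtain ⟨δ, hδ, hδ1, hd, hf⟩ := (hδ0.and (hδ1.and
    ((hd0.eventually (lt_mem_nhds (show 0 < 1 - q by linarith))).and
    (hf0.eventually (gt_mem_nhds (show 1 / (1 - q) < 1 / (1 - q) + ε by linarith)))))).exists
  filter_upwards [h.eventually_basic, h.eventually_integral_fdrPen_le_of_level hδ hδ1 hC hd]
    with n ⟨_, _, _, _, hκ⟩ h1 m hm μ hμ
  refine (h1 m hm μ hμ).trans ?_
  gcongr

/-- The error functional is at most `(2 q_n - 1) E Pen + o(κ τ²)`. -/
theorem eventually_err₂_le (h : SparseRegime qs τ κ q p) {ε C : ℝ} (hε : 0 < ε) (hC : 0 < C) :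
    ∀ᶠ n : ℕ in atTop, ∀ m : (Fin n → ℝ) → Fin n → ℝ, IsPenalizedFDR (qs n) m →
      ∀ μ : Fin n → ℝ, EffSparse p (τ n) (κ n) C μ →
        err₂ (qs n) m μ ≤ (2 * qs n - 1) * ∫ y, fdrPen (qs n) (m y) ∂gaussShift μ
          + ε * (κ n * τ n ^ 2) := by
  have hq := h.q_lt
  have hq0 := h.q_nonneg
  have hq' : 0 < 1 - q := by linarith
  obtain ⟨D₁, hD₁, ht⟩ := h.exists_thr_one_le
  obtain ⟨c, hc, hthr⟩ := h.exists_le_thr_sq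
  obtain ⟨D, hD, hvar⟩ := h.exists_variance_le
  set B := 1 / (1 - q) + 1 with hB
  have hB0 : 0 < B := by positivity
  -- The total coefficient of δκτ² in the error: B bounds E Pen and B/c bounds the expected support
  -- size, relative to κτ².
  set A := 2 * B + 4 + 8 * B / c with hA
  have hA0 : 0 < A := by positivity
  set δ := min (min (1 / 2) ((1 - q) / 4)) (ε / (4 * A)) with hδ'
  have hδ : 0 < δ := by positivity
  have hδ1 : δ ≤ 1 / 2 := (min_le_left _ _).trans (min_le_left _ _)
  have hδ2 : δ ≤ (1 - q) / 4 := (min_le_left _ _).trans (min_le_right _ _)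
  have hδ3 : δ * A ≤ ε / 4 := by
    have : δ ≤ ε / (4 * A) := min_le_right _ _
    rw [le_div_iff₀ (by positivity)] at this
    linarith
  obtain ⟨D₂, hD₂, hlev⟩ := h.exists_card_levels_le hδ
  filter_upwards [h.eventually_basic, h.eventually_excess_le (ε := 1 / 2) (by norm_num)
    (by norm_num) hδ hC, ht, hlev, hthr, hvar, h.eventually_integral_fdrPen_le one_pos hC,
    h.tendsto_q.eventually (gt_mem_nhds (show q < q + δ by linarith)),
    h.tendsto_τ.eventually_ge_atTop (8 * (1 + D₁) / (ε / 4)),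
    h.eventually_pow_le_κ (show 0 < 4 * D₁ / (ε / 4) by positivity) (k := 0) (by norm_num),
    h.eventually_pow_le_κ (show 0 < D₂ * D / (2 * δ) / (ε / 4) by positivity) (k := 4)
      (by norm_num)]
    with n ⟨hn, hqn, hqn1, hτ, hκ⟩ hex ⟨ht, hne⟩ hlev hthr hvar hpen hqn2 hτ1 hκ0 hκ4 m hm μ hμ
  have hqδ : qs n * (1 + δ) ≤ 1 := by nlinarith
  have hτ2 : 1 ≤ τ n ^ 2 := one_le_pow₀ hτ
  have hκτ : κ n ≤ κ n * τ n ^ 2 := le_mul_of_one_le_right (by linarith) hτ2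
  -- The cut at τ/2 need not be sharp here: outside G only O(κ) coordinates remain, each costing
  -- O(τ), which is o(κτ²).
  set G := Finset.univ.filter fun i => |μ i| ≤ (1 - 1 / 2) * τ n with hG
  have hGc : (Gᶜ.card : ℝ) ≤ 4 * κ n := by
    have := hμ.card_large_mul_le h.p_lt.le (by linarith) (δ := 1 / 2) (by norm_num) (by norm_num)
    rw [← hG] at this
    linarith
  have hGm : ∀ i ∈ G, |μ i| ≤ (1 - 1 / 2) * τ n := by simp [hG]
  have hex' := hex μ hμ G hGm
  -- The allowance is measured against κτ² rather than κ; it absorbs the variance bound and leaves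
  -- O(τ⁴) per level.
  have h1 := err₂_le hm hn hqn hqn1 (l := κ n * τ n ^ 2) (V := D * τ n ^ 4) hδ (by linarith) hqδ
    (by positivity) μ G
    (fun x hx hx' => (hex' x hx hx').2.trans (by gcongr))
    (fun x hx hx' => hvar μ G (fun i hi => (hGm i hi).trans (by linarith)) x hx
      ((hex' x hx hx').1.trans (by nlinarith)))
  have hP0 : 0 ≤ ∫ y, fdrPen (qs n) (m y) ∂gaussShift μ :=
    integral_nonneg fun y => penSum_nonneg _ _ _
  have hP := hpen m hm μ hμ
  have hK : c * ∫ y, (hammingNorm (m y) : ℝ) ∂gaussShift μ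
      ≤ ∫ y, fdrPen (qs n) (m y) ∂gaussShift μ := by
    rw [← integral_const_mul]
    exact integral_mono ((hm.integrable_comp_hammingNorm (fun k => (k:ℝ)) μ).const_mul c)
      (hm.integrable_comp_hammingNorm (penSum n (qs n)) μ)
      fun y => hthr _ (IsPenalizedFDR.hammingNorm_le_card (m y))
  set P := ∫ y, fdrPen (qs n) (m y) ∂gaussShift μ with hPdef
  set K := ∫ y, (hammingNorm (m y) : ℝ) ∂gaussShift μ with hKdef
  set L := κ n * τ n ^ 2 with hL
  have hL0 : 0 < L := by positivity
  have e1 : (Gᶜ.card : ℝ) * (1 + thr n (qs n) 1) ≤ 4 * κ n * ((1 + D₁) * τ n) := by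
    have : 1 + thr n (qs n) 1 ≤ (1 + D₁) * τ n := by linarith
    have h0 : 0 ≤ (1 + D₁) * τ n := by positivity
    calc _ ≤ (Gᶜ.card : ℝ) * ((1 + D₁) * τ n) := by gcongr
      _ ≤ _ := by gcongr
  have e2 : 2 * (4 * κ n * ((1 + D₁) * τ n)) ≤ ε / 4 * L := by
    rw [div_le_iff₀ (by positivity)] at hτ1
    have := mul_le_mul_of_nonneg_left hτ1 (show 0 ≤ κ n * τ n by positivity)
    rw [hL]; linarith
  have e3 : 2 * ((1 + δ) * noiseEnergy n (qs n) 1) ≤ ε / 4 * L := by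
    rw [pow_zero, mul_one, div_le_iff₀ (by positivity)] at hκ0
    calc _ ≤ 2 * ((1 + 1) * (D₁ * τ n ^ 2)) := by
          have := noiseEnergy_nonneg n (qs n) 1
          gcongr; linarith
      _ = 4 * D₁ * τ n ^ 2 := by ring
      _ ≤ κ n * (ε / 4) * τ n ^ 2 := by gcongr
      _ = _ := by ring
  have e4 : 2 * ((levels n δ).card * (D * τ n ^ 4 / (4 * δ))) ≤ ε / 4 * L := by
    rw [div_mul_eq_mul_div, div_le_iff₀ (by positivity)] at hκ4
    calc _ ≤ 2 * (D₂ * τ n ^ 2 * (D * τ n ^ 4 / (4 * δ))) := by gcongr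
      _ = D₂ * D / (2 * δ) * τ n ^ 4 * τ n ^ 2 := by field_simp; ring
      _ ≤ κ n * (ε / 4) * τ n ^ 2 := by gcongr
      _ = _ := by ring
  have e5 : K ≤ P / c := by rw [le_div_iff₀ hc]; linarith
  have e6 : P / c ≤ B * L / c := by gcongr
  have e7 : 2 * (δ * (qs n * P)) + 4 * δ * L + 8 * δ * K ≤ ε / 4 * L := by
    calc _ ≤ 2 * (δ * (1 * (B * L))) + 4 * δ * L + 8 * δ * (B * L / c) := by
          gcongr; exact e5.trans e6
      _ = δ * A * L := by rw [hA]; field_simp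
      _ ≤ _ := by gcongr
  linarith

end SparseRegime

/-! ### Lower bounds at sparse spike vectors -/

theorem sum_tail_le_of_eq_zero {n : ℕ} {q x : ℝ} (hn : 0 < n) (hq : 0 < q) (hx : 0 < x)
    (hxn : q * x ≤ n) {μ : Fin n → ℝ} {G : Finset (Fin n)} (hμ : ∀ i ∈ G, μ i = 0) :
    ∑ i ∈ G, (gaussianReal (μ i) 1).real (absGe (thr n q x)) ≤ q * x := by
  rw [← two_tail_thr hn hq hx hxn, Finset.sum_congr rfl fun i hi => by rw [hμ i hi],
    Finset.sum_const, nsmul_eq_mul]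
  gcongr
  simpa using Finset.card_le_univ G

/-- Spikes above the level `H` that are set to zero are few; the others have a large deviation. -/
theorem card_missing_le {n : ℕ} {m : (Fin n → ℝ) → Fin n → ℝ} {A : Finset (Fin n)} {H s : ℝ}
    (hs : 0 < s) {μ : Fin n → ℝ} (hμ : ∀ i ∈ A, H + s ≤ |μ i|) (y : Fin n → ℝ) :
    ((A.filter fun i => m y i = 0).card : ℝ)
      ≤ (A.filter fun i => m y i = 0 ∧ H ≤ |y i|).card + (∑ i ∈ A, (y i - μ i) ^ 2) / s ^ 2 := by
  classical
  rw [Finset.card_filter, Finset.card_filter, Finset.sum_div]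
  push_cast
  rw [← Finset.sum_add_distrib]
  refine Finset.sum_le_sum fun i hi => ?_
  by_cases h0 : m y i = 0
  · by_cases hH : H ≤ |y i|
    · simp only [h0, hH, and_self, if_true]
      have : 0 ≤ (y i - μ i) ^ 2 / s ^ 2 := by positivity
      linarith
    · simp only [h0, hH, and_false, if_true, if_false, zero_add]
      rw [one_le_div (by positivity), ← sq_abs (y i - μ i)]
      have h1 := abs_sub_abs_le_abs_sub (μ i) (y i)
      rw [abs_sub_comm] at h1
      have := hμ i hi
      have : s ≤ |y i - μ i| := by linarith [not_le.1 hH]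
      gcongr
  · simp only [h0, false_and, if_false, zero_add]; positivity

namespace SparseRegime

variable {qs τ κ : ℕ → ℝ} {q p : ℝ}

/-- At spike vectors the error functional is at least `(2 q_n - 1) E Pen - o(κ τ²)`. -/
theorem eventually_le_err₂ (h : SparseRegime qs τ κ q p) {ε C : ℝ} (hε : 0 < ε) (hC : 0 < C) :
    ∀ᶠ n : ℕ in atTop, ∀ m : (Fin n → ℝ) → Fin n → ℝ, IsPenalizedFDR (qs n) m →
      ∀ μ : Fin n → ℝ, EffSparse p (τ n) (κ n) C μ → ∀ A : Finset (Fin n), (A.card : ℝ) ≤ κ n →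
        (∀ i ∈ Aᶜ, μ i = 0) → (∀ i ∈ A, |μ i| ≤ 2 * τ n) →
        (2 * qs n - 1) * ∫ y, fdrPen (qs n) (m y) ∂gaussShift μ - ε * (κ n * τ n ^ 2)
          ≤ err₂ (qs n) m μ := by
  have hq := h.q_lt
  have hq' : 0 < 1 - q := by linarith
  obtain ⟨c, hc, hthr⟩ := h.exists_le_thr_sq
  obtain ⟨D, hD, hvar⟩ := h.exists_variance_le
  set B := 1 / (1 - q) + 1 with hB
  have hB0 : 0 < B := by positivity
  set a := 4 * B + 2 + 2 * B / c with ha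
  have ha0 : 0 < a := by positivity
  set δ := min (1 / 2) (ε / (3 * a)) with hδ'
  have hδ : 0 < δ := by positivity
  have hδ1 : δ ≤ 1 / 2 := min_le_left _ _
  have hδ3 : δ * a ≤ ε / 3 := by
    have : δ ≤ ε / (3 * a) := min_le_right _ _
    rw [le_div_iff₀ (by positivity)] at this
    linarith
  obtain ⟨D₂, hD₂, hlev⟩ := h.exists_card_levels_le hδ
  filter_upwards [h.eventually_basic, hlev, hthr, hvar, h.eventually_integral_fdrPen_le one_pos hC,
    h.eventually_κ_le hδ, h.tendsto_τ.eventually_ge_atTop (4 / (ε / 3)),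
    h.eventually_pow_le_κ (show 0 < D₂ * D / (2 * δ) / (ε / 3) by positivity) (k := 4)
      (by norm_num)]
    with n ⟨hn, hqn, hqn1, hτ, hκ⟩ hlev hthr hvar hpen hκn hτ1 hκ4 m hm μ hμ A hA hμ0 hμA
  have hn' : (0:ℝ) < n := by exact_mod_cast hn
  have hτ2 : 1 ≤ τ n ^ 2 := one_le_pow₀ hτ
  have hτ4 : 1 ≤ τ n ^ 4 := one_le_pow₀ hτ
  have hAn : (A.card : ℝ) / n ≤ δ := by
    rw [div_le_iff₀ hn']
    have : κ n * 1 ≤ κ n * τ n ^ 4 := by gcongr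
    linarith
  have h1 := le_err₂ hm hn hqn hqn1 (l := κ n * τ n ^ 2) (H := 2 * τ n) (V := D * τ n ^ 4) hδ
    (by positivity) (by positivity) μ A hμ0 hμA
    (fun x hx hx' => hvar μ Aᶜ (fun i hi => by rw [hμ0 i hi, abs_zero]; linarith) x hx
      ((sum_tail_le_of_eq_zero hn hqn hx hx' hμ0).trans (by linarith)))
  have hP0 : 0 ≤ ∫ y, fdrPen (qs n) (m y) ∂gaussShift μ :=
    integral_nonneg fun y => penSum_nonneg _ _ _
  have hP := hpen m hm μ hμ
  have hK : c * ∫ y, (hammingNorm (m y) : ℝ) ∂gaussShift μ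
      ≤ ∫ y, fdrPen (qs n) (m y) ∂gaussShift μ := by
    rw [← integral_const_mul]
    exact integral_mono ((hm.integrable_comp_hammingNorm (fun k => (k:ℝ)) μ).const_mul c)
      (hm.integrable_comp_hammingNorm (penSum n (qs n)) μ)
      fun y => hthr _ (IsPenalizedFDR.hammingNorm_le_card (m y))
  set P := ∫ y, fdrPen (qs n) (m y) ∂gaussShift μ with hPdef
  set K := ∫ y, (hammingNorm (m y) : ℝ) ∂gaussShift μ with hKdef
  set L := κ n * τ n ^ 2 with hL
  have hL0 : 0 < L := by positivity
  have e2 : 2 * ((A.card : ℝ) * (2 * τ n)) ≤ ε / 3 * L := by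
    rw [div_le_iff₀ (by positivity)] at hτ1
    calc _ ≤ 2 * (κ n * (2 * τ n)) := by gcongr
      _ = κ n * τ n * 4 := by ring
      _ ≤ κ n * τ n * (τ n * (ε / 3)) := by gcongr
      _ = _ := by ring
  have e4 : 2 * ((levels n δ).card * (D * τ n ^ 4 / (4 * δ))) ≤ ε / 3 * L := by
    rw [div_mul_eq_mul_div, div_le_iff₀ (by positivity)] at hκ4
    calc _ ≤ 2 * (D₂ * τ n ^ 2 * (D * τ n ^ 4 / (4 * δ))) := by gcongr
      _ = D₂ * D / (2 * δ) * τ n ^ 4 * τ n ^ 2 := by field_simp; ring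
      _ ≤ κ n * (ε / 3) * τ n ^ 2 := by gcongr
      _ = _ := by ring
  have e5 : K ≤ P / c := by rw [le_div_iff₀ hc]; linarith
  have e6 : P / c ≤ B * L / c := by gcongr
  have e7 : 4 * (δ * (qs n * P)) + 2 * δ * L + 2 * δ * K ≤ ε / 3 * L := by
    calc _ ≤ 4 * (δ * (1 * (B * L))) + 2 * δ * L + 2 * δ * (B * L / c) := by
          gcongr; exact e5.trans e6
      _ = δ * a * L := by rw [ha]; field_simp
      _ ≤ _ := by gcongr
  have e8 : (1 - 2 * δ) * (qs n * P) ≤ (1 - A.card / n) * qs n / (1 + δ) * P := by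
    have : 1 - 2 * δ ≤ (1 - A.card / n) / (1 + δ) := by
      rw [le_div_iff₀ (by positivity)]; nlinarith
    calc _ ≤ (1 - A.card / n) / (1 + δ) * (qs n * P) := by gcongr
      _ = _ := by ring
  linarith

/-- Few spikes are missed, so k ≥ |A| + qk up to small terms, and each of the first κτ ranks costs
at least (1 - ε)²τ². In 1 - 5ε the losses are 3ε from |A|, ε from missed large values and ε from the
allowance; the denominator is what remains after the terms in k are moved to one side. -/
theorem eventually_le_fdrPen_of_level (h : SparseRegime qs τ κ q p) {ε : ℝ} (hε : 0 < ε)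
    (hε1 : ε < 1 / 7) (hg0 : 0 < 1 + ε - (1 - ε) * (q - ε) / (1 + ε)) :
    ∀ᶠ n : ℕ in atTop, ∀ m : (Fin n → ℝ) → Fin n → ℝ, IsPenalizedFDR (qs n) m →
      ∀ μ : Fin n → ℝ, ∀ A : Finset (Fin n), (1 - 3 * ε) * κ n ≤ A.card → (A.card : ℝ) ≤ κ n →
        (∀ i ∈ Aᶜ, μ i = 0) → (∀ i ∈ A, μ i = (1 + ε) * τ n) → ∀ y : Fin n → ℝ,
        (1 - ε) ^ 2 * τ n ^ 2
              * ((1 - 5 * ε) / (1 + ε - (1 - ε) * (q - ε) / (1 + ε)) * κ n)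
            + -((1 - ε) ^ 2 * τ n ^ 2 / (1 + ε - (1 - ε) * (q - ε) / (1 + ε)))
              * ((∑ i ∈ A, (y i - μ i) ^ 2) / (ε / 2 * τ n) ^ 2
                + levelDev μ Aᶜ (countFun n (qs n)) (fun x => ε * (κ n + x)) ε 0 y)
          ≤ fdrPen (qs n) (m y) := by
  have hq := h.q_lt
  have hq0 := h.q_nonneg
  set g := 1 + ε - (1 - ε) * (q - ε) / (1 + ε) with hg
  filter_upwards [h.eventually_basic, h.eventually_κ_le hε,
    h.eventually_le_thr hε (by linarith), h.eventually_penSum_le (half_pos hε) hε,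
    h.tendsto_q.eventually (lt_mem_nhds (show q - ε < q by linarith)),
    h.tendsto_τ.eventually_ge_atTop (1 / g + 2)]
    with n ⟨hn, hqn, hqn1, hτ, hκ⟩ hκn hthr hpen hqn2 hτg m hm μ A hA1 hA2 hμ0 hμA y
  have hn' : (0:ℝ) < n := by exact_mod_cast hn
  have hτ0 : 0 < τ n := by linarith
  have hκ0 : 0 < κ n := by linarith
  have hτ4 : τ n ≤ τ n ^ 4 := le_self_pow₀ hτ (by norm_num)
  have hκτ : κ n * τ n ≤ κ n * τ n ^ 4 := by gcongr
  have hAn : (A.card : ℝ) / n ≤ ε := by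
    rw [div_le_iff₀ hn']
    nlinarith
  -- If more than εκ large values were missed, their penalty would be at most (1 + ε/2)τ² each while
  -- their energy is at least (1 + ε/2)²τ² each.
  have hmiss : ∀ y, ((A.filter fun i => m y i = 0 ∧ (1 + ε / 2) * τ n ≤ |y i|).card : ℝ)
      ≤ ε * κ n := fun y => by
    by_contra hcon
    rw [not_le] at hcon
    have h1 := penSum_missing hm hn hqn hqn1 A (H := (1 + ε / 2) * τ n) (by positivity) y
    set M := (A.filter fun i => m y i = 0 ∧ (1 + ε / 2) * τ n ≤ |y i|).card with hM
    have h2 := hpen M hcon.le (by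
      simpa using Finset.card_le_univ (A.filter fun i => m y i = 0 ∧ (1 + ε / 2) * τ n ≤ |y i|))
    have h3 : 0 < (M : ℝ) * τ n ^ 2 := by
      have : 0 < ε * κ n := by positivity
      have : (0:ℝ) < M := by linarith
      positivity
    have h4 : (M:ℝ) * ((1 + ε / 2) * τ n) ^ 2
        = (1 + ε / 2) * (M * τ n ^ 2) + ε / 2 * (1 + ε / 2) * (M * τ n ^ 2) := by ring
    have h5 : 0 < ε / 2 * (1 + ε / 2) * (M * τ n ^ 2) := by positivity
    linarith
  set F := levelDev μ Aᶜ (countFun n (qs n)) (fun x => ε * (κ n + x)) ε 0 with hF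
  have hF0 : ∀ y, 0 ≤ F y := fun y => levelDev_nonneg y
  set b : (Fin n → ℝ) → ℝ := fun y => (∑ i ∈ A, (y i - μ i) ^ 2) / (ε / 2 * τ n) ^ 2 with hb
  have hb0 : ∀ y, 0 ≤ b y := fun y => by positivity
  have hw : (1 - ε) * (q - ε) / (1 + ε) ≤ (1 - A.card / n) * qs n / (1 + ε) := by
    gcongr ?_ / _
    -- The limit q may be 0, so q - ε may be negative.
    rcases le_total 0 (q - ε) with h0 | h0
    · gcongr; linarith
    · have h1 : (1 - ε) * (q - ε) ≤ 0 := mul_nonpos_of_nonneg_of_nonpos (by linarith) h0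
      have h2 : 0 ≤ (1 - A.card / n) * qs n := mul_nonneg (by linarith) hqn.le
      linarith
  have hk : ∀ y, (1 - 5 * ε) / g * κ n - (b y + F y) / g ≤ hammingNorm (m y) := fun y => by
    have h1 := le_card_support hm hn hqn hqn1 hε hκ0.le μ A hμ0 y
    have h2 := card_missing_le (m := m) (A := A) (H := (1 + ε / 2) * τ n) (s := ε / 2 * τ n)
      (μ := μ) (by positivity)
      (fun i hi => by rw [hμA i hi, abs_of_nonneg (by positivity)]; linarith) y
    have h3 := hmiss y
    have h4 := mul_le_mul_of_nonneg_right hw (Nat.cast_nonneg (α := ℝ) (hammingNorm (m y)))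
    rw [div_mul_eq_mul_div, ← sub_div, div_le_iff₀ hg0, hg]
    simp only [hb, hF]
    linarith
  -- The lower bound on the boundary is only known up to rank κτ⁴. Capping the support at K loses
  -- nothing, since the count aimed at is below κτ.
  set K := ⌈κ n * τ n⌉₊ with hK
  have hK1 : κ n * τ n ≤ K := Nat.le_ceil _
  have hK2 : (K : ℝ) ≤ κ n * τ n + 1 := (Nat.ceil_lt_add_one (by positivity)).le
  have hτ2 : 2 ≤ τ n := by
    have : 0 < 1 / g := by positivity
    linarith
  have hK3 : (K : ℝ) ≤ κ n * τ n ^ 4 := by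
    have e1 : 2 * τ n ≤ τ n ^ 2 := by nlinarith
    have e2 : τ n ^ 2 ≤ τ n ^ 4 := pow_le_pow_right₀ hτ (by norm_num)
    have e3 : κ n * (2 * τ n) ≤ κ n * τ n ^ 4 := by gcongr; linarith
    have e4 : 1 * 1 ≤ κ n * τ n := by gcongr
    linarith
  have hKn : (K : ℝ) ≤ n := hK3.trans (hκn.trans (by
    have : ε * n ≤ 1 * n := by gcongr; linarith
    linarith))
  have hK0 : (0 : ℝ) < K := lt_of_lt_of_le (by positivity) hK1
  have hKq : qs n * K ≤ n := by
    have : qs n * K ≤ 1 * K := by gcongr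
    linarith
  have ht := hthr K hK0 hK3
  change (1 - ε) ^ 2 * τ n ^ 2 * ((1 - 5 * ε) / g * κ n) +
      -((1 - ε) ^ 2 * τ n ^ 2 / g) * (b y + F y) ≤ fdrPen (qs n) (m y)
  rw [fdrPen_eq_penSum]
  set k := min (hammingNorm (m y)) K with hkdef
  have h1 : (1 - 5 * ε) / g * κ n - (b y + F y) / g ≤ k := by
    rw [hkdef]; push_cast
    refine le_min (hk y) ?_
    have h2 : 0 ≤ (b y + F y) / g := div_nonneg (add_nonneg (hb0 y) (hF0 y)) hg0.le
    have h3 : (1 - 5 * ε) / g ≤ τ n := by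
      have : (1 - 5 * ε) / g ≤ 1 / g := by gcongr; linarith
      linarith
    have h4 : (1 - 5 * ε) / g * κ n ≤ τ n * κ n := by gcongr
    linarith
  have h2 := le_penSum hn hqn k hKq (by exact_mod_cast min_le_right _ _)
  have h3 := penSum_mono n (qs n) (min_le_left (hammingNorm (m y)) K)
  have h5 : ((1 - ε) * τ n) ^ 2 ≤ thr n (qs n) K ^ 2 :=
    pow_le_pow_left₀ (mul_nonneg (by linarith) hτ0.le) ht 2
  have h6 : (k:ℝ) * ((1 - ε) * τ n) ^ 2 ≤ k * thr n (qs n) K ^ 2 := by gcongr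
  have h7 := mul_le_mul_of_nonneg_right h1 (sq_nonneg ((1 - ε) * τ n))
  refine le_trans (le_of_eq ?_) (h7.trans (h6.trans (h2.trans h3)))
  ring

theorem eventually_le_integral_fdrPen_of_level (h : SparseRegime qs τ κ q p) {ε : ℝ} (hε : 0 < ε)
    (hε1 : ε < 1 / 7) :
    ∀ᶠ n : ℕ in atTop, ∀ m : (Fin n → ℝ) → Fin n → ℝ, IsPenalizedFDR (qs n) m →
      ∀ μ : Fin n → ℝ, ∀ A : Finset (Fin n), (1 - 3 * ε) * κ n ≤ A.card → (A.card : ℝ) ≤ κ n →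
        (∀ i ∈ Aᶜ, μ i = 0) → (∀ i ∈ A, μ i = (1 + ε) * τ n) →
        (1 - ε) ^ 2 * (1 - 7 * ε) / (1 + ε - (1 - ε) * (q - ε) / (1 + ε)) * (κ n * τ n ^ 2)
          ≤ ∫ y, fdrPen (qs n) (m y) ∂gaussShift μ := by
  have hq := h.q_lt
  have hq0 := h.q_nonneg
  set g := 1 + ε - (1 - ε) * (q - ε) / (1 + ε) with hg
  have hg0 : 0 < g := by
    have : (1 - ε) * (q - ε) / (1 + ε) < 1 := by
      rw [div_lt_one (by positivity)]; nlinarith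
    linarith
  obtain ⟨D₂, hD₂, hlev⟩ := h.exists_card_levels_le hε
  filter_upwards [h.eventually_basic, hlev, h.eventually_le_fdrPen_of_level hε hε1 hg0,
    h.tendsto_τ.eventually_ge_atTop (4 / ε ^ 3),
    h.eventually_pow_le_κ (show 0 < D₂ / (2 * ε) / ε by positivity) (k := 2) (by norm_num)]
    with n ⟨hn, hqn, hqn1, hτ, hκ⟩ hlev hpen hτε hκ2 m hm μ A hA1 hA2 hμ0 hμA
  have hτ0 : 0 < τ n := by linarith
  have hκ0 : 0 < κ n := by linarith
  have hpen' := hpen m hm μ A hA1 hA2 hμ0 hμA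
  set F := levelDev μ Aᶜ (countFun n (qs n)) (fun x => ε * (κ n + x)) ε 0 with hF
  set b : (Fin n → ℝ) → ℝ := fun y => (∑ i ∈ A, (y i - μ i) ^ 2) / (ε / 2 * τ n) ^ 2 with hb
  have iF : Integrable F (gaussShift μ) := integrable_levelDev fun x i _ => memLp_countFun x i _
  have ib' : Integrable (fun y : Fin n → ℝ => ∑ i ∈ A, (y i - μ i) ^ 2) (gaussShift μ) :=
    integrable_finsetSum _ fun i _ => integrable_eval_sub_pow μ i 2
  have ib : Integrable b (gaussShift μ) := ib'.div_const _
  have iP : Integrable (fun y => fdrPen (qs n) (m y)) (gaussShift μ) :=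
    hm.integrable_comp_hammingNorm (penSum n (qs n)) μ
  have h1 := integral_mono ((integrable_const _).add ((ib.add iF).const_mul _)) iP hpen'
  simp only [Pi.add_apply] at h1
  have e0 := integral_add (integrable_const (μ := gaussShift μ)
    ((1 - ε) ^ 2 * τ n ^ 2 * ((1 - 5 * ε) / g * κ n)))
    ((ib.add iF).const_mul (-((1 - ε) ^ 2 * τ n ^ 2 / g)))
  simp only [Pi.add_apply] at e0
  rw [e0, integral_const_mul _ fun y => b y + F y, integral_add ib iF] at h1
  simp only [integral_const, probReal_univ, one_smul] at h1
  -- Each squared noise has mean 1, so the bound amounts to τ² ≥ 4/ε³.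
  have hEb : ∫ y, b y ∂gaussShift μ ≤ ε * κ n := by
    simp only [hb]
    rw [integral_div, integral_finsetSum _ fun i _ => integrable_eval_sub_pow μ i 2]
    simp only [integral_eval_sub_sq, Finset.sum_const, nsmul_eq_mul, mul_one]
    rw [div_le_iff₀ (by positivity)]
    rw [div_le_iff₀ (by positivity)] at hτε
    have : τ n * ε ^ 3 ≤ τ n ^ 2 * ε ^ 3 := by gcongr; nlinarith
    have : 1 ≤ ε * (ε / 2 * τ n) ^ 2 := by nlinarith
    nlinarith
  have hEF : ∫ y, F y ∂gaussShift μ ≤ ε * κ n := by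
    refine (integral_countDev_le hqn1 hε (by linarith) hκ0.le μ Aᶜ (fun j hj => ?_)
      (fun x hx hx' => (sum_tail_le_of_eq_zero hn hqn hx hx' hμ0).trans
        (le_add_of_nonneg_right (by positivity)))).trans ?_
    · have h1 := (mem_levels hn hε).1 hj
      have : (0:ℝ) < (1 + ε) ^ j := by positivity
      rw [add_zero]; nlinarith
    · rw [div_mul_eq_mul_div, div_le_iff₀ hε] at hκ2
      calc _ ≤ D₂ * τ n ^ 2 * (1 / (2 * ε)) := by gcongr
        _ = D₂ / (2 * ε) * τ n ^ 2 := by ring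
        _ ≤ _ := by linarith
  refine le_trans ?_ h1
  have h2 := mul_le_mul_of_nonneg_left (add_le_add hEb hEF)
    (show 0 ≤ (1 - ε) ^ 2 * τ n ^ 2 / g by positivity)
  have e1 : (1 - ε) ^ 2 * τ n ^ 2 * ((1 - 5 * ε) / g * κ n)
      - (1 - ε) ^ 2 * τ n ^ 2 / g * (ε * κ n + ε * κ n)
      = (1 - ε) ^ 2 * (1 - 7 * ε) / g * (κ n * τ n ^ 2) := by ring
  linarith

end SparseRegime

/-! ### Asymptotic bounds for the minimax risk -/

/-- The radii `η` put the class in the sparse regime with effective sparsity `κ` at level `τ`. -/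
structure ClassRegime (c : SparsityClass) (qs τ κ : ℕ → ℝ) (q : ℝ) (η : ℕ → ℝ) : Prop where
  sparse : SparseRegime qs τ κ q c.expo
  admissible : c.Admissible
  η_nonneg : ∀ n, 0 ≤ η n
  sparsity_eq : ∀ᶠ n : ℕ in atTop, n * c.sparsity (η n) = κ n * τ n ^ c.expo

theorem rpow_two_mul {a p : ℝ} (ha : 0 < a) : a ^ p * a ^ (2 - p) = a ^ 2 := by
  rw [← Real.rpow_add ha, add_sub_cancel, Real.rpow_two]

namespace ClassRegime

variable {c : SparsityClass} {qs τ κ η : ℕ → ℝ} {q : ℝ}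

theorem eventually_u_mul_sum_min_le (h : ClassRegime c qs τ κ q η) :
    ∀ᶠ n : ℕ in atTop, ∀ μ ∈ c.ball n (η n), ∀ a : ℝ, 1 ≤ a →
      c.u * ∑ i, min (μ i ^ 2) ((a * τ n) ^ 2) ≤ a ^ 2 * ((κ n + 1) * τ n ^ 2) := by
  filter_upwards [h.sparse.eventually_basic, h.sparsity_eq] with n ⟨hn, _, _, hτ, hκ⟩ hν μ hμ a ha
  have hτ0 : 0 < τ n := by linarith
  have hn' : (0:ℝ) < n := by exact_mod_cast hn
  have hs : 0 < c.sparsity (η n) := by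
    have : 0 < n * c.sparsity (η n) := by rw [hν]; positivity
    exact pos_of_mul_pos_right this hn'.le
  have h1 := SparsityClass.u_mul_sum_min_le h.admissible hn (h.η_nonneg n) hs hμ (x := a * τ n)
    (by positivity)
  refine h1.trans ?_
  have h2 : n * c.sparsity (η n) * (a * τ n) ^ (2 - c.expo)
      = κ n * τ n ^ 2 * a ^ (2 - c.expo) := by
    rw [hν, Real.mul_rpow (by linarith) hτ0.le, ← rpow_two_mul (p := c.expo) hτ0]; ring
  have h3 : a ^ (2 - c.expo) ≤ a ^ 2 := by
    rw [← Real.rpow_two]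
    exact Real.rpow_le_rpow_of_exponent_le ha
      (by linarith [SparsityClass.expo_nonneg h.admissible])
  rw [h2]
  calc _ ≤ κ n * τ n ^ 2 * a ^ 2 + (a * τ n) ^ 2 := by gcongr
    _ = _ := by ring

theorem eventually_effSparse (h : ClassRegime c qs τ κ q η) :
    ∀ᶠ n : ℕ in atTop, ∀ μ ∈ c.ball n (η n), EffSparse c.expo (τ n) (κ n) (2 / c.u) μ := by
  filter_upwards [h.sparse.eventually_basic, h.sparsity_eq, h.eventually_u_mul_sum_min_le]
    with n ⟨hn, _, _, hτ, hκ⟩ hν hsum μ hμ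
  refine ⟨fun x hx => ?_, ?_⟩
  · rw [← hν]
    exact SparsityClass.card_gt_mul_le h.admissible hn (h.η_nonneg n) hμ hx
  · have hu := SparsityClass.u_pos h.admissible
    have h1 := hsum μ hμ 1 le_rfl
    rw [one_mul, one_pow, one_mul] at h1
    rw [div_mul_eq_mul_div, le_div_iff₀ hu, mul_comm]
    refine h1.trans ?_
    have : (κ n + 1) * τ n ^ 2 ≤ (2 * κ n) * τ n ^ 2 := by gcongr; linarith
    linarith

/-- The minimax risk is at most `(1 + o(1)) κ τ² / u`. -/
theorem eventually_minimaxSqRisk_le (h : ClassRegime c qs τ κ q η) {ε : ℝ} (hε : 0 < ε) :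
    ∀ᶠ n : ℕ in atTop,
      minimaxSqRisk (c.ball n (η n)) * c.u ≤ (1 + ε) * (κ n * τ n ^ 2) := by
  have hu := SparsityClass.u_pos h.admissible
  have hu1 := SparsityClass.u_le_one h.admissible
  obtain ⟨s, hs0, hs⟩ : ∃ s : ℝ, 0 < s ∧ s + (1 + s) * ((1 + 2 * s) ^ 2 * (1 + s)) ≤ 1 + ε := by
    have hc : ContinuousAt (fun s : ℝ => s + (1 + s) * ((1 + 2 * s) ^ 2 * (1 + s))) 0 := by
      fun_prop
    have h1 := hc.tendsto.mono_left (nhdsWithin_le_nhds (s := Set.Ioi 0))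
    have h2 : ∀ᶠ s : ℝ in nhdsWithin 0 (Set.Ioi 0),
        s + (1 + s) * ((1 + 2 * s) ^ 2 * (1 + s)) < 1 + ε :=
      h1.eventually (gt_mem_nhds (by norm_num; exact hε))
    have h3 : ∀ᶠ s : ℝ in nhdsWithin 0 (Set.Ioi 0), 0 < s := self_mem_nhdsWithin
    obtain ⟨s, h4, h5⟩ := (h3.and h2).exists
    exact ⟨s, h4, h5.le⟩
  have ha : 0 < ((1 + s) ^ 2 - 1) / 2 := by nlinarith
  filter_upwards [h.sparse.eventually_basic, h.eventually_u_mul_sum_min_le,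
    h.sparse.eventually_κ_bounds, h.sparse.eventually_pow_le_κ (show 0 < 1 / s by positivity)
      (k := 0) (by norm_num), h.sparse.tendsto_τ.eventually_ge_atTop (1 / s),
    h.sparse.eventually_τ (eventually_pow_mul_exp_le 0 (1 + s) ha
      (ε := s / ((1 + 1 / s) * 8)) (by positivity))]
    with n ⟨hn, _, _, hτ, hκ⟩ hsum ⟨_, hκ1⟩ hκ0 hτs hexp
  have hn' : (0:ℝ) < n := by exact_mod_cast hn
  set S := (1 + 2 * s) ^ 2 * ((1 + s) * (κ n * τ n ^ 2)) / c.u with hS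
  -- A threshold slightly above τ makes the noise term negligible against κτ², and the truncation
  -- level t² + 1/s fits below ((1 + 2s)τ)².
  have h1 := minimaxSqRisk_le (Θ := c.ball n (η n)) (t := (1 + s) * τ n) (ε := s) (S := S)
    (by positivity) hs0 (by positivity) fun μ hμ => by
      rw [hS, le_div_iff₀ hu, mul_comm]
      refine le_trans ?_ ((hsum μ hμ (1 + 2 * s) (by linarith)).trans ?_)
      · gcongr
        have e1 : 1 ≤ τ n * s := by rwa [div_le_iff₀ hs0] at hτs
        have e2 : τ n * 1 ≤ τ n * (τ n * s) := by gcongr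
        have e3 : 0 ≤ (s + 3 * s ^ 2) * τ n ^ 2 := by positivity
        linarith
      · rw [pow_zero, mul_one, div_le_iff₀ hs0] at hκ0
        have : κ n + 1 ≤ (1 + s) * κ n := by linarith
        have := mul_le_mul_of_nonneg_right this (sq_nonneg (τ n))
        rw [mul_assoc] at this
        gcongr
  have h2 : tailEnergy ((1 + s) * τ n)
      ≤ 2 * (2 * Real.exp (1 / 2 + (1 + s) * τ n - ((1 + s) * τ n) ^ 2 / 2)) := by
    have := integral_pow_tail_le 2 (T := (1 + s) * τ n) (by positivity)
    simpa [tailEnergy] using this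
  have h3 : Real.exp (1 / 2 + (1 + s) * τ n - ((1 + s) * τ n) ^ 2 / 2)
      = Real.exp (1 / 2) * (Real.exp (-τ n ^ 2 / 2)
        * Real.exp ((1 + s) * τ n - ((1 + s) ^ 2 - 1) / 2 * τ n ^ 2)) := by
    rw [← Real.exp_add, ← Real.exp_add]; congr 1; ring
  have h4 : Real.exp (1 / 2) ≤ 2 := by
    have h5 : Real.exp (1 / 2) ^ 2 = Real.exp 1 := by rw [← Real.exp_nat_mul]; norm_num
    have := Real.exp_one_lt_d9
    nlinarith [Real.exp_pos (1 / 2)]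
  rw [pow_zero, one_mul, le_div_iff₀ (by positivity)] at hexp
  set E := Real.exp ((1 + s) * τ n - ((1 + s) ^ 2 - 1) / 2 * τ n ^ 2) with hE
  have hE0 : 0 < E := Real.exp_pos _
  have h6 : n * ((1 + 1 / s) * tailEnergy ((1 + s) * τ n)) ≤ s * (κ n * τ n ^ 2) := by
    calc _ ≤ n * ((1 + 1 / s) * (2 * (2 * (2 * (Real.exp (-τ n ^ 2 / 2) * E))))) := by
          rw [h3] at h2
          gcongr
          refine h2.trans ?_
          gcongr
      _ = E * ((1 + 1 / s) * 8) * (n * Real.exp (-τ n ^ 2 / 2)) := by ring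
      _ ≤ s * (κ n * τ n ^ 2) := by gcongr
  have h7 : s * (κ n * τ n ^ 2) * c.u ≤ s * (κ n * τ n ^ 2) :=
    mul_le_of_le_one_right (by positivity) hu1
  have hSu : S * c.u = (1 + 2 * s) ^ 2 * ((1 + s) * (κ n * τ n ^ 2)) := by
    rw [hS]; field_simp
  calc _ ≤ (s * (κ n * τ n ^ 2) + (1 + s) * S) * c.u := by gcongr; linarith
    _ = s * (κ n * τ n ^ 2) * c.u + (1 + s) * (S * c.u) := by ring
    _ ≤ s * (κ n * τ n ^ 2)
        + (1 + s) * ((1 + 2 * s) ^ 2 * ((1 + s) * (κ n * τ n ^ 2))) := by rw [hSu]; gcongr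
    _ = (s + (1 + s) * ((1 + 2 * s) ^ 2 * (1 + s))) * (κ n * τ n ^ 2) := by ring
    _ ≤ _ := by gcongr

end ClassRegime

/-! ### Bayes risk of spikes below the detection level -/

namespace SparseRegime

variable {qs τ κ : ℕ → ℝ} {q p : ℝ}

/-- Blocks with one spike below the detection level carry a Bayes risk close to their energy. -/
theorem eventually_sum_sq_le_minimaxSqRisk (h : SparseRegime qs τ κ q p) {s L δ : ℝ} (hs : 0 < s)
    (hs1 : s < 1) (hL : 0 < L) (hδ : 0 < δ) (hδ1 : δ < 1) :
    ∀ᶠ n : ℕ in atTop, ∀ Θ : Set (Fin n → ℝ), ∀ M : ℕ, 0 < M → (M : ℝ) ≤ L * κ n →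
      ∀ f : Fin M → ℝ, (∀ b, 0 ≤ f b) → (∀ b, f b ≤ (1 - s) * τ n) →
        (∀ B : ℕ, ∀ e : Fin M × Fin B → Fin n, Function.Injective e → ∀ J, spikeVec e f J ∈ Θ) →
        (1 - δ) * ∑ b, f b ^ 2 ≤ minimaxSqRisk Θ := by
  obtain ⟨r, hr⟩ := exists_gaussTail_eq (α := δ / 3) (by positivity) (by linarith)
  have hr0 : 0 ≤ r := by
    by_contra hcon
    have := gaussTail_strictAnti (not_le.1 hcon)
    rw [gaussTail_zero, hr] at this
    linarith
  have ha : 0 < (1 - (1 - s) ^ 2) / 2 := by nlinarith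
  filter_upwards [h.eventually_basic, h.eventually_κ_bounds, h.eventually_κ_le
    (show 0 < 1 / L by positivity), h.eventually_τ (eventually_pow_mul_exp_le 0 r ha
      (ε := δ / 3 * (δ / 3) / (2 * L)) (by positivity))]
    with n ⟨hn, _, _, hτ, hκ⟩ ⟨hκ1, _⟩ hκn hexp Θ M hM hML f hf0 hf hΘ
  have hn' : (0:ℝ) < n := by exact_mod_cast hn
  have hM' : (0:ℝ) < M := by exact_mod_cast hM
  have hMn : M ≤ n := by
    have : κ n * 1 ≤ κ n * τ n ^ 4 := by gcongr; exact one_le_pow₀ hτ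
    have h2 : κ n ≤ 1 / L * n := by linarith
    rw [one_div, inv_mul_eq_div, le_div_iff₀ hL] at h2
    exact_mod_cast (show (M:ℝ) ≤ n by linarith)
  set B := n / M with hB
  have hB0 : 0 < B := Nat.div_pos hMn hM
  have hB' : (0:ℝ) < B := by exact_mod_cast hB0
  have hMB : M * B ≤ n := Nat.mul_div_le n M
  have hB2 : (n:ℝ) ≤ 2 * M * B := by
    have h1 : n < M * (B + 1) := Nat.lt_mul_div_succ n hM
    have h2 : M * (B + 1) ≤ 2 * M * B := by nlinarith
    exact_mod_cast (h1.le.trans h2)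
  have he : Function.Injective fun x : Fin M × Fin B => Fin.castLE hMB (finProdFinEquiv x) :=
    (Fin.castLE_injective hMB).comp finProdFinEquiv.injective
  refine minimaxSqRisk_ge he hB0 hf0 (hΘ B _ he) (r := r) (κ := δ / 3) (by positivity) fun b => ?_
  have h1 : f b ^ 2 / 2 + f b * r
      ≤ τ n ^ 2 / 2 + (r * τ n - (1 - (1 - s) ^ 2) / 2 * τ n ^ 2) := by
    have e1 : f b ^ 2 ≤ ((1 - s) * τ n) ^ 2 := pow_le_pow_left₀ (hf0 b) (hf b) 2
    have e2 : f b * r ≤ τ n * r := by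
      have : f b ≤ τ n := (hf b).trans (by nlinarith)
      gcongr
    nlinarith
  have h2 := Real.exp_le_exp.2 h1
  rw [Real.exp_add (τ n ^ 2 / 2)] at h2
  rw [pow_zero, one_mul] at hexp
  set E := Real.exp (r * τ n - (1 - (1 - s) ^ 2) / 2 * τ n ^ 2) with hE
  have hE0 : 0 < E := Real.exp_pos _
  -- At most Lκ ≤ L n e^{-τ²/2} blocks leave block length of order e^{τ²/2}. This beats exp(f²/2 +
  -- fr) for f ≤ (1 - s)τ, so one spike hides in its block.
  have h3 : Real.exp (τ n ^ 2 / 2) ≤ 2 * L * B := by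
    have e1 : (M:ℝ) ≤ L * (n * Real.exp (-τ n ^ 2 / 2)) := hML.trans (by gcongr)
    have e2 : (n:ℝ) ≤ 2 * (L * (n * Real.exp (-τ n ^ 2 / 2))) * B := hB2.trans (by gcongr)
    have e3 : Real.exp (-τ n ^ 2 / 2) = (Real.exp (τ n ^ 2 / 2))⁻¹ := by
      rw [← Real.exp_neg]; congr 1; ring
    rw [e3] at e2
    have e4 : 0 < Real.exp (τ n ^ 2 / 2) := Real.exp_pos _
    have e5 : 2 * (L * (n * (Real.exp (τ n ^ 2 / 2))⁻¹)) * B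
        = n * (2 * L * B / Real.exp (τ n ^ 2 / 2)) := by field_simp
    rw [e5] at e2
    have e6 : 1 ≤ 2 * L * B / Real.exp (τ n ^ 2 / 2) :=
      le_of_mul_le_mul_left (by linarith) hn'
    rwa [one_le_div e4] at e6
  have h4 : Real.exp (f b ^ 2 / 2 + f b * r) / (δ / 3 * B) ≤ δ / 3 := by
    rw [div_le_iff₀ (by positivity)]
    rw [le_div_iff₀ (by positivity)] at hexp
    calc _ ≤ Real.exp (τ n ^ 2 / 2) * E := h2
      _ ≤ 2 * L * B * E := by gcongr
      _ = E * (2 * L) * B := by ring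
      _ ≤ δ / 3 * (δ / 3) * B := by gcongr
      _ = _ := by ring
  rw [hr]
  linarith

end SparseRegime

/-! ### Spike configurations and the extremal profile of weak balls -/

theorem le_sum_rpow_Ico {r : ℝ} (hr : 1 < r) {K M : ℕ} (hKM : K ≤ M) :
    (((K:ℝ) + 1) ^ (1 - r) - ((M:ℝ) + 1) ^ (1 - r)) / (r - 1)
      ≤ ∑ k ∈ Finset.Ico K M, ((k : ℝ) + 1) ^ (-r) := by
  have hK0 : (0:ℝ) ≤ K := Nat.cast_nonneg K
  have hKM' : (K:ℝ) ≤ M := by exact_mod_cast hKM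
  have h1 := AntitoneOn.integral_le_sum_Ico (f := fun s : ℝ => (s + 1) ^ (-r)) hKM (by
    intro x hx y _ hxy
    exact Real.rpow_le_rpow_of_nonpos (by linarith [hx.1]) (by linarith) (by linarith))
  rw [intervalIntegral.integral_comp_add_right (fun s : ℝ => s ^ (-r)) 1,
    integral_rpow (Or.inr ⟨by linarith, by
      rw [Set.uIcc_of_le (by linarith)]
      intro h0; linarith [h0.1]⟩)] at h1
  refine le_trans (le_of_eq ?_) h1
  rw [show -r + 1 = -(r - 1) by ring, div_neg, ← neg_div, neg_sub,
    show -(r - 1) = 1 - r by ring]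

/-- Energy of the extremal configuration of a weak ball, truncated at its detection level. -/
theorem le_sum_min_one_rpow {r κ s : ℝ} (hr : 1 < r) (hs : 0 < s) (hs1 : s < 1)
    (hκ : 1 / s ≤ κ) :
    κ * ((1 - s) + ((1 + s) ^ (1 - r) - s ^ (r - 1)) / (r - 1))
      ≤ ∑ b ∈ Finset.range ⌊κ / s⌋₊, min 1 ((κ / ((b:ℝ) + 1)) ^ r) := by
  rw [div_le_iff₀ hs] at hκ
  have hκ0 : 0 < κ := by by_contra hcon; nlinarith
  have hr1 : 0 < r - 1 := by linarith
  set K := ⌊κ⌋₊ with hK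
  set M := ⌊κ / s⌋₊ with hM
  have hKM : K ≤ M := Nat.floor_mono (by rw [le_div_iff₀ hs]; nlinarith)
  have hK1 : (K:ℝ) ≤ κ := Nat.floor_le hκ0.le
  have hK2 : κ < K + 1 := Nat.lt_floor_add_one κ
  have hM2 : κ / s < M + 1 := Nat.lt_floor_add_one _
  rw [Finset.range_eq_Ico, ← Finset.sum_Ico_consecutive _ (Nat.zero_le K) hKM]
  -- Ranks up to ⌊κ⌋ are saturated; rounding loses at most 1 ≤ sκ.
  have h1 : (1 - s) * κ ≤ ∑ b ∈ Finset.Ico 0 K, min 1 ((κ / ((b:ℝ) + 1)) ^ r) := by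
    have : ∑ b ∈ Finset.Ico 0 K, min 1 ((κ / ((b:ℝ) + 1)) ^ r) = ∑ b ∈ Finset.Ico 0 K, (1:ℝ) := by
      refine Finset.sum_congr rfl fun b hb => min_eq_left (Real.one_le_rpow ?_ (by linarith))
      rw [one_le_div (by positivity)]
      have : b + 1 ≤ K := (Finset.mem_Ico.1 hb).2
      have : (b:ℝ) + 1 ≤ K := by exact_mod_cast this
      linarith
    rw [this]
    simp only [Finset.sum_const, Nat.card_Ico, tsub_zero, nsmul_eq_mul, mul_one]
    linarith
  have h2 : κ * (((1 + s) ^ (1 - r) - s ^ (r - 1)) / (r - 1))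
      ≤ ∑ b ∈ Finset.Ico K M, min 1 ((κ / ((b:ℝ) + 1)) ^ r) := by
    have e1 : ∑ b ∈ Finset.Ico K M, min 1 ((κ / ((b:ℝ) + 1)) ^ r)
        = κ ^ r * ∑ b ∈ Finset.Ico K M, ((b:ℝ) + 1) ^ (-r) := by
      rw [Finset.mul_sum]
      refine Finset.sum_congr rfl fun b hb => ?_
      have hb' : (K:ℝ) ≤ b := by exact_mod_cast (Finset.mem_Ico.1 hb).1
      rw [min_eq_right, Real.div_rpow hκ0.le (by positivity), Real.rpow_neg (by positivity),
        div_eq_mul_inv]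
      refine Real.rpow_le_one (by positivity) ?_ (by linarith)
      rw [div_le_one (by positivity)]; linarith
    have e2 : (1 + s) ^ (1 - r) * κ ^ (1 - r) ≤ ((K:ℝ) + 1) ^ (1 - r) := by
      rw [← Real.mul_rpow (by linarith) hκ0.le]
      exact Real.rpow_le_rpow_of_nonpos (by positivity) (by nlinarith) (by linarith)
    have e3 : ((M:ℝ) + 1) ^ (1 - r) ≤ s ^ (r - 1) * κ ^ (1 - r) := by
      refine (Real.rpow_le_rpow_of_nonpos (by positivity) hM2.le (by linarith)).trans
        (le_of_eq ?_)
      rw [Real.div_rpow hκ0.le hs.le, show 1 - r = -(r - 1) by ring, Real.rpow_neg hs.le]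
      field_simp
    have e4 : κ ^ r * κ ^ (1 - r) = κ := by
      rw [← Real.rpow_add hκ0, add_sub_cancel, Real.rpow_one]
    rw [e1]
    refine le_trans ?_ (mul_le_mul_of_nonneg_left (le_sum_rpow_Ico hr hKM) (by positivity))
    calc κ * (((1 + s) ^ (1 - r) - s ^ (r - 1)) / (r - 1))
        = κ ^ r * κ ^ (1 - r) * (((1 + s) ^ (1 - r) - s ^ (r - 1)) / (r - 1)) := by rw [e4]
      _ = κ ^ r * (((1 + s) ^ (1 - r) * κ ^ (1 - r) - s ^ (r - 1) * κ ^ (1 - r)) / (r - 1)) := by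
          ring
      _ ≤ _ := by gcongr
  linarith

theorem spikeVec_ne_zero {n M B : ℕ} {e : Fin M × Fin B → Fin n} (he : Function.Injective e)
    {h : Fin M → ℝ} {J : Fin M → Fin B} {i : Fin n} (hi : spikeVec e h J i ≠ 0) :
    ∃ b, i = e (b, J b) ∧ spikeVec e h J i = h b := by
  by_contra hcon
  refine hi (spikeVec_eq_zero fun b hb => hcon ⟨b, hb, ?_⟩)
  rw [hb, spikeVec_apply he, if_pos rfl]

namespace SparsityClass

theorem spikeVec_mem_ball {c : SparsityClass} (hc : c.Admissible) {n M B : ℕ} (hn : 0 < n)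
    {η : ℝ} (hη : 0 ≤ η) {e : Fin M × Fin B → Fin n} (he : Function.Injective e) {a : ℝ}
    (ha : 0 < a) (hcard : (M : ℝ) * a ^ c.expo ≤ n * c.sparsity η) (J : Fin M → Fin B) :
    spikeVec e (fun _ => a) J ∈ c.ball n η := by
  classical
  refine mem_ball_of_card_mul_le hc hn hη (A := Finset.univ.image fun b => e (b, J b)) ha
    (fun i hi => ?_) (fun i hi => ?_) (le_trans ?_ hcard)
  · by_contra h0
    obtain ⟨b, hb, _⟩ := spikeVec_ne_zero he h0
    exact hi (Finset.mem_image.2 ⟨b, Finset.mem_univ _, hb.symm⟩)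
  · obtain ⟨b, _, rfl⟩ := Finset.mem_image.1 hi
    rw [spikeVec_apply he, if_pos rfl, abs_of_pos ha]
  · gcongr
    exact Finset.card_image_le.trans (by simp)

theorem spikeVec_mem_weak {p : ℝ} (hp : 0 < p) {n M B : ℕ} {η : ℝ} (hη : 0 ≤ η)
    {e : Fin M × Fin B → Fin n} (he : Function.Injective e) {h : Fin M → ℝ} (hh : ∀ b, 0 ≤ h b)
    (hle : ∀ b : Fin M, h b ≤ (n * η ^ p / (((b : ℕ) : ℝ) + 1)) ^ (1 / p)) (J : Fin M → Fin B) :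
    spikeVec e h J ∈ (weak p).ball n η := by
  have hf : ∀ b, Function.extend e (fun x => (x.1 : ℕ)) 0 (e (b, J b)) = b := fun b =>
    he.extend_apply _ _ _
  refine mem_weak_of_rank hp hη (f := Function.extend e (fun x => (x.1 : ℕ)) 0) ?_ ?_
  · intro i j hi hj hij
    obtain ⟨b, rfl, _⟩ := spikeVec_ne_zero he hi
    obtain ⟨b', rfl, _⟩ := spikeVec_ne_zero he hj
    rw [hf, hf] at hij
    rw [Fin.ext hij]
  · intro i hi
    obtain ⟨b, rfl, hb⟩ := spikeVec_ne_zero he hi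
    rw [hf, hb, abs_of_nonneg (hh b)]
    exact hle b

end SparsityClass

namespace ClassRegime

variable {c : SparsityClass} {qs τ κ η : ℕ → ℝ} {q : ℝ}

/-- About κ equal spikes of height (1 - s)τ, one per block. The four factors 1 - s come from the
Bayes risk, the rounding of κ, and the squared height. -/
theorem eventually_le_minimaxSqRisk_of_level (h : ClassRegime c qs τ κ q η) {s : ℝ} (hs : 0 < s)
    (hs1 : s < 1) :
    ∀ᶠ n : ℕ in atTop,
      (1 - s) ^ 4 * (κ n * τ n ^ 2) ≤ minimaxSqRisk (c.ball n (η n)) := by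
  filter_upwards [h.sparse.eventually_basic, h.sparsity_eq,
    h.sparse.eventually_sum_sq_le_minimaxSqRisk hs hs1 one_pos hs hs1,
    h.sparse.eventually_pow_le_κ (show 0 < 1 / s by positivity) (k := 0) (by norm_num)]
    with n ⟨hn, _, _, hτ, hκ⟩ hν hR hκs
  have hτ0 : 0 < τ n := by linarith
  have hs' : 0 < 1 - s := by linarith
  rw [pow_zero, mul_one, div_le_iff₀ hs] at hκs
  have hM1 : (⌊κ n⌋₊ : ℝ) ≤ κ n := Nat.floor_le (by linarith)
  have hM2 : (1 - s) * κ n ≤ ⌊κ n⌋₊ := by linarith [Nat.lt_floor_add_one (κ n)]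
  have h1 := hR (c.ball n (η n)) ⌊κ n⌋₊ (Nat.floor_pos.2 hκ) (by linarith)
    (fun _ => (1 - s) * τ n) (fun _ => by positivity) (fun _ => le_rfl)
    (fun B e he J => SparsityClass.spikeVec_mem_ball h.admissible hn (h.η_nonneg n) he
      (by positivity) (by
        rw [hν, Real.mul_rpow hs'.le hτ0.le, ← mul_assoc]
        have e1 : (1 - s) ^ c.expo ≤ 1 := Real.rpow_le_one hs'.le (by linarith)
          (SparsityClass.expo_nonneg h.admissible)
        have e2 : (⌊κ n⌋₊ : ℝ) * (1 - s) ^ c.expo ≤ κ n * 1 := by gcongr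
        rw [mul_one] at e2
        gcongr) J)
  refine le_trans ?_ h1
  rw [Finset.sum_const, Finset.card_univ, Fintype.card_fin, nsmul_eq_mul]
  calc (1 - s) ^ 4 * (κ n * τ n ^ 2)
      = (1 - s) * ((1 - s) * κ n * ((1 - s) * τ n) ^ 2) := by ring
    _ ≤ _ := by gcongr

/-- Equal spikes miss the tail of the weak ball. The heights here follow the extremal profile (κ/(b
+ 1))^{1/p}, cut at 1 and scaled by (1 - s)τ, over κ/s ranks; as s tends to 0 the constant becomes 1
+ 1/(2/p - 1) = 1/u. -/
theorem eventually_le_minimaxSqRisk_weak {p : ℝ} (h : ClassRegime (.weak p) qs τ κ q η) {s : ℝ}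
    (hs : 0 < s) (hs1 : s < 1) :
    ∀ᶠ n : ℕ in atTop,
      (1 - s) ^ 3 * ((1 - s) + ((1 + s) ^ (1 - 2 / p) - s ^ (2 / p - 1)) / (2 / p - 1))
        * (κ n * τ n ^ 2) ≤ minimaxSqRisk ((SparsityClass.weak p).ball n (η n)) := by
  obtain ⟨hp0, hp2⟩ := h.admissible
  have hr : 1 < 2 / p := by rwa [one_lt_div hp0]
  filter_upwards [h.sparse.eventually_basic, h.sparsity_eq,
    h.sparse.eventually_sum_sq_le_minimaxSqRisk hs hs1 (one_div_pos.2 hs) hs hs1,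
    h.sparse.eventually_pow_le_κ (show 0 < 1 / s by positivity) (k := 0) (by norm_num)]
    with n ⟨hn, _, _, hτ, hκ⟩ hν hR hκs
  have hτ0 : 0 < τ n := by linarith
  have hκ0 : 0 < κ n := by linarith
  have hs' : 0 < 1 - s := by linarith
  rw [pow_zero, mul_one] at hκs
  have hM1 : (⌊κ n / s⌋₊ : ℝ) ≤ 1 / s * κ n := by
    rw [one_div_mul_eq_div]; exact Nat.floor_le (by positivity)
  set f : ℕ → ℝ := fun b => (1 - s) * τ n * min 1 ((κ n / ((b : ℝ) + 1)) ^ (1 / p)) with hf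
  have hf0 : ∀ b, 0 ≤ f b := fun b => by positivity
  have h1 := hR ((SparsityClass.weak p).ball n (η n)) ⌊κ n / s⌋₊
    (Nat.floor_pos.2 (by rw [le_div_iff₀ hs]; linarith)) hM1
    (fun b => f b) (fun b => hf0 b)
    (fun b => mul_le_of_le_one_right (by positivity) (min_le_left _ _))
    (fun B e he J => SparsityClass.spikeVec_mem_weak hp0 (h.η_nonneg n) he (fun b => hf0 b)
      (fun b => by
        have e1 : n * η n ^ p = κ n * τ n ^ p := hν
        have e2 : (κ n * τ n ^ p / (((b:ℕ):ℝ) + 1)) ^ (1 / p)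
            = τ n * (κ n / (((b:ℕ):ℝ) + 1)) ^ (1 / p) := by
          rw [mul_div_right_comm, Real.mul_rpow (by positivity) (by positivity),
            ← Real.rpow_mul hτ0.le, mul_one_div_cancel hp0.ne', Real.rpow_one, mul_comm]
        rw [e1, e2]
        simp only [hf]
        gcongr
        · nlinarith
        · exact min_le_right _ _) J)
  refine le_trans ?_ h1
  rw [Fin.sum_univ_eq_sum_range (fun b => f b ^ 2)]
  have h2 : ∀ b : ℕ, ((1 - s) * τ n) ^ 2 * min 1 ((κ n / ((b:ℝ) + 1)) ^ (2 / p)) ≤ f b ^ 2 :=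
    fun b => by
      simp only [hf]
      rw [mul_pow ((1 - s) * τ n)]
      have e1 : (κ n / ((b:ℝ) + 1)) ^ (2 / p) = ((κ n / ((b:ℝ) + 1)) ^ (1 / p)) ^ 2 := by
        rw [← Real.rpow_two, ← Real.rpow_mul (by positivity)]; ring_nf
      gcongr
      rw [e1]
      rcases min_cases (1:ℝ) ((κ n / ((b:ℝ) + 1)) ^ (1 / p)) with ⟨e2, _⟩ | ⟨e2, _⟩ <;> rw [e2]
      · rw [one_pow]; exact min_le_left _ _
      · exact min_le_right _ _
  have h3 := Finset.sum_le_sum fun b (_ : b ∈ Finset.range ⌊κ n / s⌋₊) => h2 b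
  rw [← Finset.mul_sum] at h3
  have h4 := le_sum_min_one_rpow hr hs hs1 hκs
  have h5 := mul_le_mul_of_nonneg_left h4 (sq_nonneg ((1 - s) * τ n))
  have h6 := mul_le_mul_of_nonneg_left (h5.trans h3) hs'.le
  refine le_trans (le_of_eq ?_) h6
  ring

/-- The minimax risk is at least `(1 - o(1)) κ τ² / u`. -/
theorem eventually_le_minimaxSqRisk (h : ClassRegime c qs τ κ q η) {ε : ℝ} (hε : 0 < ε) :
    ∀ᶠ n : ℕ in atTop,
      (1 - ε) * (κ n * τ n ^ 2) ≤ minimaxSqRisk (c.ball n (η n)) * c.u := by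
  have key : ∀ f : ℝ → ℝ, Tendsto f (nhdsWithin 0 (Set.Ioi 0)) (nhds 1) →
      ∃ s : ℝ, 0 < s ∧ s < 1 ∧ 1 - ε ≤ f s := fun f hf => by
    have h1 : ∀ᶠ s : ℝ in nhdsWithin 0 (Set.Ioi 0), 1 - ε < f s :=
      hf.eventually (lt_mem_nhds (by linarith))
    have h2 : ∀ᶠ s : ℝ in nhdsWithin 0 (Set.Ioi 0), s < 1 :=
      nhdsWithin_le_nhds (gt_mem_nhds one_pos)
    have h3 : ∀ᶠ s : ℝ in nhdsWithin 0 (Set.Ioi 0), 0 < s := self_mem_nhdsWithin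
    obtain ⟨s, h4, h5, h6⟩ := (h3.and (h2.and h1)).exists
    exact ⟨s, h4, h5, h6.le⟩
  have hgen : c.u = 1 → ∀ᶠ n : ℕ in atTop,
      (1 - ε) * (κ n * τ n ^ 2) ≤ minimaxSqRisk (c.ball n (η n)) * c.u := fun hu => by
    obtain ⟨s, hs0, hs1, hs⟩ := key (fun s => (1 - s) ^ 4) (by
      have : ContinuousAt (fun s : ℝ => (1 - s) ^ 4) 0 := by fun_prop
      simpa using this.tendsto.mono_left nhdsWithin_le_nhds)
    filter_upwards [h.eventually_le_minimaxSqRisk_of_level hs0 hs1, h.sparse.eventually_basic]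
      with n h1 ⟨_, _, _, hτ, hκ⟩
    rw [hu, mul_one]
    refine le_trans ?_ h1
    gcongr
  cases c with
  | nearlyBlack => exact hgen rfl
  | strong p => exact hgen rfl
  | weak p =>
    obtain ⟨hp0, hp2⟩ := h.admissible
    have hr : 0 < 2 / p - 1 := by rw [sub_pos, one_lt_div hp0]; exact hp2
    have hu0 : 0 < (SparsityClass.weak p).u := SparsityClass.u_pos h.admissible
    obtain ⟨s, hs0, hs1, hs⟩ := key (fun s => (1 - s) ^ 3
        * ((1 - s) + ((1 + s) ^ (1 - 2 / p) - s ^ (2 / p - 1)) / (2 / p - 1))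
        * (SparsityClass.weak p).u) (by
      have h1 : ContinuousAt (fun s : ℝ => (1 + s) ^ (1 - 2 / p)) 0 :=
        ContinuousAt.rpow_const (by fun_prop) (Or.inl (by norm_num))
      have h2 : ContinuousAt (fun s : ℝ => s ^ (2 / p - 1)) 0 :=
        ContinuousAt.rpow_const continuousAt_id (Or.inr hr.le)
      have h3 : ContinuousAt (fun s : ℝ => (1 - s) ^ 3
        * ((1 - s) + ((1 + s) ^ (1 - 2 / p) - s ^ (2 / p - 1)) / (2 / p - 1))
        * (SparsityClass.weak p).u) 0 := by
        refine ContinuousAt.mul (ContinuousAt.mul (by fun_prop)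
          (ContinuousAt.add (by fun_prop) ((h1.sub h2).div_const _))) continuousAt_const
      have h4 : (1 - (0:ℝ)) ^ 3
        * ((1 - 0) + ((1 + 0) ^ (1 - 2 / p) - 0 ^ (2 / p - 1)) / (2 / p - 1))
        * (SparsityClass.weak p).u = 1 := by
        rw [Real.zero_rpow hr.ne']
        simp only [sub_zero, one_pow, add_zero, Real.one_rpow, one_mul, SparsityClass.u]
        have : 2 - p ≠ 0 := by linarith
        field_simp
        ring
      have h5 := h3.tendsto.mono_left (nhdsWithin_le_nhds (s := Set.Ioi 0))
      rwa [h4] at h5)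
    filter_upwards [h.eventually_le_minimaxSqRisk_weak hs0 hs1, h.sparse.eventually_basic]
      with n h1 ⟨_, _, _, hτ, hκ⟩
    have h2 := mul_le_mul_of_nonneg_right h1 hu0.le
    have h3 := mul_le_mul_of_nonneg_right hs (show 0 ≤ κ n * τ n ^ 2 by positivity)
    linarith

end ClassRegime

/-! ### The worst case of the error functional over a class -/

theorem SparsityClass.zero_mem_ball {c : SparsityClass} (hc : c.Admissible) {n : ℕ} (hn : 0 < n)
    {η : ℝ} (hη : 0 ≤ η) (hs : 0 ≤ c.sparsity η) : (0 : Fin n → ℝ) ∈ c.ball n η :=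
  mem_ball_of_card_mul_le hc hn hη (A := ∅) one_pos (fun _ _ => rfl) (by simp)
    (by simp only [Finset.card_empty, Nat.cast_zero, zero_mul]; positivity)

namespace ClassRegime

variable {c : SparsityClass} {qs τ κ η : ℕ → ℝ} {q : ℝ}

theorem eventually_sparsity_pos (h : ClassRegime c qs τ κ q η) :
    ∀ᶠ n : ℕ in atTop, 0 < c.sparsity (η n) := by
  filter_upwards [h.sparse.eventually_basic, h.sparsity_eq] with n ⟨hn, _, _, hτ, hκ⟩ hν
  have hτ0 : 0 < τ n := by linarith
  have hn' : (0:ℝ) < n := by exact_mod_cast hn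
  have : 0 < n * c.sparsity (η n) := by rw [hν]; positivity
  exact pos_of_mul_pos_right this hn'.le

theorem eventually_err₂_le (h : ClassRegime c qs τ κ q η) {ε : ℝ} (hε : 0 < ε) :
    ∀ᶠ n : ℕ in atTop, ∀ m : (Fin n → ℝ) → Fin n → ℝ, IsPenalizedFDR (qs n) m →
      ∀ μ ∈ c.ball n (η n),
        err₂ (qs n) m μ ≤ (max (2 * q - 1) 0 / (1 - q) + ε) * (κ n * τ n ^ 2) := by
  have hC : 0 < 2 / c.u := div_pos two_pos (SparsityClass.u_pos h.admissible)
  have hq := h.sparse.q_lt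
  have hq' : 0 < 1 - q := by linarith
  -- The expected penalty is only bounded above, so a negative coefficient must be replaced by 0.
  set w := max (2 * q - 1) 0 with hw
  have hw0 : 0 ≤ w := le_max_right _ _
  have hw1 : 2 * q - 1 ≤ w := le_max_left _ _
  obtain ⟨s, hs0, hs⟩ : ∃ s : ℝ, 0 < s ∧ (w + s) * (1 / (1 - q) + s) + s ≤ w / (1 - q) + ε := by
    have h1 : ContinuousAt (fun s : ℝ => (w + s) * (1 / (1 - q) + s) + s) 0 := by fun_prop
    have h2 := h1.tendsto.mono_left (nhdsWithin_le_nhds (s := Set.Ioi 0))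
    have h3 : ∀ᶠ s : ℝ in nhdsWithin 0 (Set.Ioi 0),
        (w + s) * (1 / (1 - q) + s) + s < w / (1 - q) + ε :=
      h2.eventually (gt_mem_nhds (by
        simp only [add_zero, mul_one_div]; linarith))
    have h4 : ∀ᶠ s : ℝ in nhdsWithin 0 (Set.Ioi 0), 0 < s := self_mem_nhdsWithin
    obtain ⟨s, h5, h6⟩ := (h4.and h3).exists
    exact ⟨s, h5, h6.le⟩
  filter_upwards [h.sparse.eventually_basic, h.eventually_effSparse,
    h.sparse.eventually_err₂_le hs0 hC, h.sparse.eventually_integral_fdrPen_le hs0 hC,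
    h.sparse.tendsto_q.eventually (gt_mem_nhds (show q < q + s / 2 by linarith))]
    with n ⟨_, _, _, hτ, hκ⟩ heff herr hpen hqn m hm μ hμ
  have hP0 : 0 ≤ ∫ y, fdrPen (qs n) (m y) ∂gaussShift μ :=
    integral_nonneg fun y => penSum_nonneg _ _ _
  have h1 := herr m hm μ (heff μ hμ)
  have h2 := hpen m hm μ (heff μ hμ)
  calc _ ≤ (2 * qs n - 1) * ∫ y, fdrPen (qs n) (m y) ∂gaussShift μ + s * (κ n * τ n ^ 2) := h1
    _ ≤ (w + s) * ((1 / (1 - q) + s) * (κ n * τ n ^ 2)) + s * (κ n * τ n ^ 2) := by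
        gcongr; linarith
    _ = ((w + s) * (1 / (1 - q) + s) + s) * (κ n * τ n ^ 2) := by ring
    _ ≤ _ := by gcongr

/-- Equal spikes slightly above the threshold nearly attain the upper bound when `q > 1 / 2`. -/
theorem eventually_exists_le_err₂ (h : ClassRegime c qs τ κ q η) (hq2 : 1 / 2 < q) {ε : ℝ}
    (hε : 0 < ε) :
    ∀ᶠ n : ℕ in atTop, ∀ m : (Fin n → ℝ) → Fin n → ℝ, IsPenalizedFDR (qs n) m →
      ∃ μ ∈ c.ball n (η n),
        ((2 * q - 1) / (1 - q) - ε) * (κ n * τ n ^ 2) ≤ err₂ (qs n) m μ := by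
  have hC : 0 < 2 / c.u := div_pos two_pos (SparsityClass.u_pos h.admissible)
  have hq := h.sparse.q_lt
  have hq' : 1 - q ≠ 0 := by linarith
  set G : ℝ → ℝ := fun s =>
    (1 - s) ^ 2 * (1 - 7 * s) / (1 + s - (1 - s) * (q - s) / (1 + s)) with hG
  obtain ⟨s, hs0, hs7, hsq, hs⟩ : ∃ s : ℝ, 0 < s ∧ s < 1 / 7 ∧ s < 2 * q - 1 ∧
      (2 * q - 1) / (1 - q) - ε ≤ (2 * q - 1 - s) * G s - s := by
    have h1 : ContinuousAt (fun s : ℝ => (2 * q - 1 - s) * G s - s) 0 := by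
      simp only [hG]
      fun_prop (disch := first | norm_num; done | simpa using hq')
    have h2 := h1.tendsto.mono_left (nhdsWithin_le_nhds (s := Set.Ioi 0))
    have h3 : ∀ᶠ s : ℝ in nhdsWithin 0 (Set.Ioi 0),
        (2 * q - 1) / (1 - q) - ε < (2 * q - 1 - s) * G s - s :=
      h2.eventually (lt_mem_nhds (by
        simp only [hG, mul_zero, sub_zero, add_zero, one_pow, one_mul, div_one, mul_one_div]
        linarith))
    have h4 : ∀ᶠ s : ℝ in nhdsWithin 0 (Set.Ioi 0), 0 < s := self_mem_nhdsWithin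
    have h5 : ∀ᶠ s : ℝ in nhdsWithin 0 (Set.Ioi 0), s < 1 / 7 :=
      nhdsWithin_le_nhds (gt_mem_nhds (by norm_num))
    have h6 : ∀ᶠ s : ℝ in nhdsWithin 0 (Set.Ioi 0), s < 2 * q - 1 :=
      nhdsWithin_le_nhds (gt_mem_nhds (by linarith))
    obtain ⟨s, a, b, c, d⟩ := (h4.and (h5.and (h6.and h3))).exists
    exact ⟨s, a, b, c, d.le⟩
  filter_upwards [h.sparse.eventually_basic, h.eventually_effSparse, h.sparsity_eq,
    h.sparse.eventually_le_err₂ hs0 hC, h.sparse.eventually_le_integral_fdrPen_of_level hs0 hs7,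
    h.sparse.tendsto_q.eventually (lt_mem_nhds (show q - s / 2 < q by linarith)),
    h.sparse.eventually_κ_le one_pos,
    h.sparse.eventually_pow_le_κ (show 0 < 1 / s by positivity) (k := 0) (by norm_num)]
    with n ⟨hn, _, _, hτ, hκ⟩ heff hν herr hpen hqn hκn hκs m hm
  have hτ0 : 0 < τ n := by linarith
  have hκ0 : 0 < κ n := by linarith
  rw [pow_zero, mul_one, div_le_iff₀ hs0] at hκs
  -- Spikes of height (1 + s)τ use (1 + s)^p ≤ (1 + s)² times the budget of spikes at τ, so their
  -- number is reduced by this factor to stay in the class.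
  have hk1 : (⌊κ n / (1 + s) ^ 2⌋₊ : ℝ) ≤ κ n / (1 + s) ^ 2 := Nat.floor_le (by positivity)
  have hk2 : κ n / (1 + s) ^ 2 ≤ κ n := div_le_self hκ0.le (one_le_pow₀ (by linarith))
  have hk3 : (1 - 3 * s) * κ n ≤ ⌊κ n / (1 + s) ^ 2⌋₊ := by
    have e1 : (1 - 2 * s) * κ n ≤ κ n / (1 + s) ^ 2 := by
      rw [le_div_iff₀ (by positivity)]
      have : (1 - 2 * s) * (1 + s) ^ 2 ≤ 1 := by nlinarith [pow_pos hs0 2, pow_pos hs0 3]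
      nlinarith
    linarith [Nat.lt_floor_add_one (κ n / (1 + s) ^ 2)]
  have hkn : ⌊κ n / (1 + s) ^ 2⌋₊ ≤ (Finset.univ : Finset (Fin n)).card := by
    have e1 : κ n * 1 ≤ κ n * τ n ^ 4 := by gcongr; exact one_le_pow₀ hτ
    rw [Finset.card_univ, Fintype.card_fin]
    exact_mod_cast (show (⌊κ n / (1 + s) ^ 2⌋₊ : ℝ) ≤ n by linarith)
  obtain ⟨A, -, hA⟩ := Finset.exists_subset_card_eq hkn
  have hA' : (A.card : ℝ) = ⌊κ n / (1 + s) ^ 2⌋₊ := by rw [hA]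
  set μ : Fin n → ℝ := fun i => if i ∈ A then (1 + s) * τ n else 0 with hμ
  have hμA : ∀ i ∈ A, μ i = (1 + s) * τ n := fun i hi => if_pos hi
  have hμ0 : ∀ i, i ∉ A → μ i = 0 := fun i hi => if_neg hi
  have hμc : ∀ i ∈ Aᶜ, μ i = 0 := fun i hi => hμ0 i (Finset.mem_compl.1 hi)
  have hpos : 0 < (1 + s) * τ n := by positivity
  have hball : μ ∈ c.ball n (η n) := by
    refine SparsityClass.mem_ball_of_card_mul_le h.admissible hn (h.η_nonneg n) hpos hμ0
      (fun i hi => by rw [hμA i hi, abs_of_pos hpos]) ?_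
    rw [hν, Real.mul_rpow (by linarith) hτ0.le, ← mul_assoc]
    gcongr
    have e1 : (1 + s) ^ c.expo ≤ (1 + s) ^ 2 := by
      rw [← Real.rpow_two]
      exact Real.rpow_le_rpow_of_exponent_le (by linarith)
        (SparsityClass.expo_lt_two h.admissible).le
    calc (A.card : ℝ) * (1 + s) ^ c.expo ≤ κ n / (1 + s) ^ 2 * (1 + s) ^ 2 := by
          rw [hA']; gcongr
      _ = κ n := by field_simp
  refine ⟨μ, hball, ?_⟩
  have h1 := herr m hm μ (heff μ hball) A (by rw [hA']; linarith) hμc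
    (fun i hi => by rw [hμA i hi, abs_of_pos hpos]; nlinarith)
  have h2 := hpen m hm μ A (by rw [hA']; exact hk3) (by rw [hA']; linarith) hμc hμA
  have hP0 : 0 ≤ ∫ y, fdrPen (qs n) (m y) ∂gaussShift μ :=
    integral_nonneg fun y => penSum_nonneg _ _ _
  calc _ ≤ ((2 * q - 1 - s) * G s - s) * (κ n * τ n ^ 2) := by gcongr
    _ = (2 * q - 1 - s) * (G s * (κ n * τ n ^ 2)) - s * (κ n * τ n ^ 2) := by ring
    _ ≤ (2 * q - 1 - s) * ∫ y, fdrPen (qs n) (m y) ∂gaussShift μ - s * (κ n * τ n ^ 2) := by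
        have : 0 ≤ 2 * q - 1 - s := by linarith
        gcongr
    _ ≤ (2 * qs n - 1) * ∫ y, fdrPen (qs n) (m y) ∂gaussShift μ - s * (κ n * τ n ^ 2) := by
        have : 2 * q - 1 - s ≤ 2 * qs n - 1 := by linarith
        gcongr ?_ - _
        exact mul_le_mul_of_nonneg_right this hP0
    _ ≤ _ := h1

variable {m : (n : ℕ) → (Fin n → ℝ) → Fin n → ℝ}

theorem eventually_bddAbove (h : ClassRegime c qs τ κ q η)
    (hm : ∀ n, IsPenalizedFDR (qs n) (m n)) :
    ∀ᶠ n : ℕ in atTop, BddAbove (err₂ (qs n) (m n) '' c.ball n (η n)) := by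
  filter_upwards [h.eventually_err₂_le one_pos] with n h1
  exact ⟨_, Set.forall_mem_image.2 fun μ hμ => h1 (m n) (hm n) μ hμ⟩

theorem eventually_sSup_le (h : ClassRegime c qs τ κ q η)
    (hm : ∀ n, IsPenalizedFDR (qs n) (m n)) {ε : ℝ} (hε : 0 < ε) :
    ∀ᶠ n : ℕ in atTop, sSup (err₂ (qs n) (m n) '' c.ball n (η n))
      ≤ (max (2 * q - 1) 0 / (1 - q) + ε) * (κ n * τ n ^ 2) := by
  filter_upwards [h.eventually_err₂_le hε, h.sparse.eventually_basic, h.eventually_sparsity_pos]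
    with n h1 ⟨hn, _⟩ hs
  exact csSup_le ⟨_, Set.mem_image_of_mem _
    (SparsityClass.zero_mem_ball h.admissible hn (h.η_nonneg n) hs.le)⟩
    (Set.forall_mem_image.2 fun μ hμ => h1 (m n) (hm n) μ hμ)

theorem isLittleO_sSup_err₂ (h : ClassRegime c qs τ κ q η)
    (hm : ∀ n, IsPenalizedFDR (qs n) (m n)) (hq : q ≤ 1 / 2) :
    (fun n : ℕ => sSup (err₂ (qs n) (m n) '' c.ball n (η n)))
      =o[atTop] fun n : ℕ => minimaxSqRisk (c.ball n (η n)) := by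
  refine isLittleO_iff.2 fun a ha => ?_
  filter_upwards [h.eventually_sSup_le hm (half_pos ha), h.eventually_bddAbove hm,
    h.eventually_le_minimaxSqRisk (ε := 1 / 2) (by norm_num), h.sparse.eventually_basic,
    h.eventually_sparsity_pos] with n h1 hb hR ⟨hn, _, _, _, hκ⟩ hs
  -- The origin belongs to the class and Err₂ ≥ 0 there, so no lower estimate on the penalty is
  -- needed.
  have h0 : 0 ≤ sSup (err₂ (qs n) (m n) '' c.ball n (η n)) :=
    (err₂_zero_nonneg (hm n)).trans (le_csSup hb (Set.mem_image_of_mem _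
      (SparsityClass.zero_mem_ball h.admissible hn (h.η_nonneg n) hs.le)))
  have hR0 : 0 ≤ minimaxSqRisk (c.ball n (η n)) := ENNReal.toReal_nonneg
  rw [Real.norm_of_nonneg h0, Real.norm_of_nonneg hR0]
  rw [max_eq_right (by linarith), zero_div, zero_add] at h1
  have h2 : minimaxSqRisk (c.ball n (η n)) * c.u ≤ minimaxSqRisk (c.ball n (η n)) :=
    mul_le_of_le_one_right hR0 (SparsityClass.u_le_one h.admissible)
  have h3 := mul_le_mul_of_nonneg_left (hR.trans h2) ha.le
  linarith

theorem isEquivalent_sSup_err₂ (h : ClassRegime c qs τ κ q η)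
    (hm : ∀ n, IsPenalizedFDR (qs n) (m n)) (hq : 1 / 2 < q) :
    (fun n : ℕ => sSup (err₂ (qs n) (m n) '' c.ball n (η n)))
      ~[atTop] fun n : ℕ =>
        minimaxSqRisk (c.ball n (η n)) * c.u * ((2 * q - 1) / (1 - q)) := by
  have hq1 := h.sparse.q_lt
  set b := (2 * q - 1) / (1 - q) with hb
  have hb0 : 0 < b := div_pos (by linarith) (by linarith)
  refine isLittleO_iff.2 fun a ha => ?_
  set ε := min (1 / 2) (a * b / (2 * (1 + b))) with hε
  have hε0 : 0 < ε := by positivity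
  have hε1 : ε ≤ 1 / 2 := min_le_left _ _
  have hε2 : ε * (1 + b) ≤ a * b / 2 := by
    have : ε ≤ a * b / (2 * (1 + b)) := min_le_right _ _
    rw [le_div_iff₀ (by positivity)] at this
    linarith
  filter_upwards [h.eventually_sSup_le hm hε0, h.eventually_bddAbove hm,
    h.eventually_exists_le_err₂ hq hε0, h.eventually_le_minimaxSqRisk hε0,
    h.eventually_minimaxSqRisk_le hε0, h.sparse.eventually_basic]
    with n h1 hbdd h2 hR1 hR2 ⟨_, _, _, hτ, hκ⟩
  obtain ⟨μ, hμ, h3⟩ := h2 (m n) (hm n)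
  have h4 := h3.trans (le_csSup hbdd (Set.mem_image_of_mem _ hμ))
  rw [max_eq_left (by linarith), ← hb] at h1
  simp only [Pi.sub_apply]
  set S := sSup (err₂ (qs n) (m n) '' c.ball n (η n)) with hS
  set R := minimaxSqRisk (c.ball n (η n)) * c.u with hR
  set L := κ n * τ n ^ 2 with hL
  have hL0 : 0 < L := by positivity
  have hRL : 1 / 2 * L ≤ R := by
    refine le_trans ?_ hR1
    gcongr; linarith
  have hR0 : 0 ≤ R := by linarith
  rw [Real.norm_of_nonneg (mul_nonneg hR0 hb0.le), Real.norm_eq_abs]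
  have h5 : a * b * (1 / 2 * L) ≤ a * b * R := by gcongr
  have h6 : ε * (1 + b) * L ≤ a * b / 2 * L := by gcongr
  have h7 := mul_le_mul_of_nonneg_right hR1 hb0.le
  have h8 := mul_le_mul_of_nonneg_right hR2 hb0.le
  rw [abs_le]
  constructor <;> linarith

end ClassRegime

/-! ### The regime determined by the standing assumptions -/

/-- The detection level `(2 log (1 / ν))^{1/2}`. -/
def detectionLevel (ν : ℝ) : ℝ := Real.sqrt (2 * -Real.log ν)

/-- By the choice of τ, ν = e^{-τ²/2}. The upper bound in (H) makes τ² at least a multiple of log n;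
the lower bound n ν ≥ log⁵ n makes κ at least of order τ⁸. -/
theorem classRegime {c : SparsityClass} (hc : c.Admissible) {qs : ℕ → ℝ} {q : ℝ}
    (hQ : AssumptionQ qs q) {η : ℕ → ℝ} (hH : AssumptionH c η) :
    ClassRegime c qs (fun n => detectionLevel (c.sparsity (η n)))
      (fun n => n * c.sparsity (η n) * detectionLevel (c.sparsity (η n)) ^ (-c.expo)) q η := by
  obtain ⟨⟨hq0, hq1⟩, hqt, hqb⟩ := hQ
  obtain ⟨hη, b₂, b₃, hb₂, hb₃, hν⟩ := hH
  have hlog : Tendsto (fun n : ℕ => Real.log n) atTop atTop :=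
    Real.tendsto_log_atTop.comp tendsto_natCast_atTop_atTop
  have hbasic : ∀ᶠ n : ℕ in atTop, 0 < c.sparsity (η n) ∧ 1 ≤ Real.log n
      ∧ b₃ / 2 * Real.log n ≤ -Real.log (c.sparsity (η n))
      ∧ Real.log n ^ 5 ≤ n * c.sparsity (η n) := by
    filter_upwards [hν, hlog.eventually_ge_atTop 1,
      hlog.eventually_ge_atTop (Real.log b₂ / (b₃ / 2)), eventually_gt_atTop 0]
      with n ⟨h1, h2⟩ h3 h4 hn
    have hn' : (0:ℝ) < n := by exact_mod_cast hn
    have h5 : 0 < c.sparsity (η n) := lt_of_lt_of_le (by positivity) h1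
    refine ⟨h5, h3, ?_, ?_⟩
    · have h6 := Real.log_le_log h5 h2
      rw [Real.log_mul hb₂.ne' (Real.rpow_pos_of_pos hn' _).ne', Real.log_rpow hn'] at h6
      rw [div_le_iff₀ (by positivity)] at h4
      linarith
    · rwa [inv_mul_eq_div, div_le_iff₀ hn', mul_comm] at h1
  have hτ2 : ∀ᶠ n : ℕ in atTop,
      detectionLevel (c.sparsity (η n)) ^ 2 = 2 * -Real.log (c.sparsity (η n)) := by
    filter_upwards [hbasic] with n ⟨_, h1, h2, _⟩
    have : 0 < b₃ / 2 * Real.log n := by positivity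
    exact Real.sq_sqrt (by linarith)
  have hτt : Tendsto (fun n => detectionLevel (c.sparsity (η n))) atTop atTop := by
    refine Real.tendsto_sqrt_atTop.comp (Tendsto.const_mul_atTop two_pos ?_)
    exact tendsto_atTop_mono' _ (hbasic.mono fun n hn => hn.2.2.1)
      (hlog.const_mul_atTop (by positivity))
  set τ := fun n => detectionLevel (c.sparsity (η n)) with hτ
  have hτ1 := hτt.eventually_ge_atTop 1
  have hp0 := SparsityClass.expo_nonneg hc
  have hp2 := SparsityClass.expo_lt_two hc
  have hlogτ : ∀ᶠ n : ℕ in atTop, Real.log n ≤ 1 / b₃ * τ n ^ 2 := by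
    filter_upwards [hbasic, hτ2] with n ⟨_, _, h1, _⟩ h2
    simp only [hτ]
    rw [h2, one_div_mul_eq_div, le_div_iff₀ hb₃]
    linarith
  refine ⟨⟨hp0, hp2, hq0, hq1, hqt, hτt, ?_, ?_, ⟨1 / b₃, by positivity, hlogτ⟩, ?_⟩, hc, hη, ?_⟩
  · filter_upwards [hbasic, hτ2] with n ⟨h1, _⟩ h2
    rw [h2, show -(2 * -Real.log (c.sparsity (η n))) / 2 = Real.log (c.sparsity (η n)) by ring,
      Real.exp_log h1]
  · filter_upwards [hbasic, hτ2, hτ1, eventually_gt_atTop 0] with n ⟨h1, h3, _, h4⟩ h2 h5 hn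
    have hn' : (0:ℝ) < n := by exact_mod_cast hn
    have hτ0 : 0 < τ n := by linarith
    have h6 : τ n ^ 2 ≤ 2 * Real.log n := by
      have h7 : 1 ≤ n * c.sparsity (η n) := (one_le_pow₀ h3).trans h4
      have h8 := Real.log_nonneg h7
      rw [Real.log_mul hn'.ne' h1.ne'] at h8
      simp only [hτ]
      rw [h2]; linarith
    have h7 : τ n ^ 10 / 32 ≤ n * c.sparsity (η n) := by
      refine le_trans ?_ h4
      have h8 : (τ n ^ 2) ^ 5 ≤ (2 * Real.log n) ^ 5 := by gcongr
      have h9 : (τ n ^ 2) ^ 5 = τ n ^ 10 := by ring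
      have h10 : (2 * Real.log n) ^ 5 = 32 * Real.log n ^ 5 := by ring
      linarith
    -- As p < 2, passing from n ν to κ costs at most a factor τ², from the tenth to the eighth
    -- power.
    have h8 : (τ n ^ 2)⁻¹ ≤ τ n ^ (-c.expo) := by
      rw [← Real.rpow_two, ← Real.rpow_neg hτ0.le]
      exact Real.rpow_le_rpow_of_exponent_le h5 (by linarith)
    calc τ n ^ 8 / 32 = τ n ^ 10 / 32 * (τ n ^ 2)⁻¹ := by field_simp
      _ ≤ _ := by gcongr
  -- For q = 0 the bound b₁/log n is converted by log n ≤ τ²/b₃; for q > 0 eventually q_n ≥ q/2.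
  · rcases hq0.eq_or_lt with h0 | h0
    · obtain ⟨b₁, hb₁, h1⟩ := hqb h0.symm
      refine ⟨1 / (b₁ * b₃), by positivity, ?_⟩
      filter_upwards [h1, hlogτ, hbasic, hτ1] with n h1 h2 ⟨_, h3, _⟩ h4
      rw [div_le_iff₀ (by linarith)] at h1
      have hq : 0 ≤ qs n := by
        by_contra hcon
        have : qs n * Real.log n ≤ 0 :=
          mul_nonpos_of_nonpos_of_nonneg (not_le.1 hcon).le (by linarith)
        linarith
      have h5 : b₁ ≤ qs n * (1 / b₃ * τ n ^ 2) := h1.trans (by gcongr)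
      calc (1:ℝ) = 1 / b₁ * b₁ := by field_simp
        _ ≤ 1 / b₁ * (qs n * (1 / b₃ * τ n ^ 2)) := by gcongr
        _ = _ := by field_simp
    · refine ⟨2 / q, by positivity, ?_⟩
      filter_upwards [hqt.eventually (lt_mem_nhds (show q / 2 < q by linarith)), hτ1] with n h1 h2
      calc (1:ℝ) = 2 / q * 1 * (q / 2) := by field_simp
        _ ≤ 2 / q * τ n ^ 2 * qs n := by gcongr; exact one_le_pow₀ h2
  · filter_upwards [hτ1] with n h1
    have hτ0 : 0 < τ n := by linarith
    change _ = _ * τ n ^ (-c.expo) * τ n ^ c.expo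
    rw [mul_assoc, ← Real.rpow_add hτ0, neg_add_cancel, Real.rpow_zero, mul_one]

end

theorem mainTheorem7 (c : SparsityClass) (hc : c.Admissible)
    (qs : ℕ → ℝ) (q : ℝ) (hQ : AssumptionQ qs q)
    (η : ℕ → ℝ) (hH : AssumptionH c η)
    (μhat₂ : (n : ℕ) → (Fin n → ℝ) → Fin n → ℝ)
    (hμhat₂ : ∀ n, IsPenalizedFDR (qs n) (μhat₂ n)) :
    (∀ᶠ n : ℕ in atTop, BddAbove (err₂ (qs n) (μhat₂ n) '' c.ball n (η n))) ∧
    (q ≤ 1 / 2 →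
      (fun n : ℕ => sSup (err₂ (qs n) (μhat₂ n) '' c.ball n (η n)))
        =o[atTop] fun n : ℕ => minimaxSqRisk (c.ball n (η n))) ∧
    (1 / 2 < q →
      (fun n : ℕ => sSup (err₂ (qs n) (μhat₂ n) '' c.ball n (η n)))
        ~[atTop] fun n : ℕ => minimaxSqRisk (c.ball n (η n)) * c.u * ((2 * q - 1) / (1 - q))) := by
  have h := classRegime hc hQ hH
  exact ⟨h.eventually_bddAbove hμhat₂, h.isLittleO_sSup_err₂ hμhat₂,
    h.isEquivalent_sSup_err₂ hμhat₂⟩
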